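/- Let $R>0$, $\gamma>1$, $\mu>0$, $\lambda$ with $2\mu+3\lambda\ge 0$, and $\kappa>0$ be constants, and put $c_v=R/(\gamma-1)$. Consider, on $\mathbb R^3\times(0,T)$ with $0<T<\infty$, the heat conductive compressible Navier--Stokes equations $$\partial_t\rho+\operatorname{div}(\rho u)=0,$$ $$\rho(\partial_t u+(u\cdot\nabla)u)-\mu\Delta u-(\mu+\lambda)\nabla\operatorname{div}u+\nabla p=0,$$ $$c_v\rho(\partial_t\theta+u\cdot\nabla\theta)+p\operatorname{div}u-\kappa\Delta\theta=\tfrac{\mu}{2}|\nabla u+(\nabla u)^t|^2+\lambda(\operatorname{div}u)^2,$$ where $\rho\ge0$, $u\in\mathbb R^3$, $\theta\ge0$ and $p=R\rho\theta$. Write $\|\cdot\|_r$ for the norm of $L^r=L^r(\mathbb R^3)$, $D^{2,r}=\{f\in L^1_{loc}:\|\nabla^2f\|_r<\infty\}$, $D^2=D^{2,2}$, and $D^1_0=\{f\in L^6:\|\nabla f\|_2<\infty\}$. There is a constant $C>0$, depending only on $R,\gamma,\mu,\lambda,\kappa$, such that the following holds for every $q\in(3,6]$ and every $T\in(0,\infty)$.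 Let $(\rho,u,\theta)$ be a strong solution of this system on $\mathbb R^3\times(0,T)$ with initial data $(\rho_0,u_0,\theta_0)$, the equations holding almost everywhere, such that $$\rho\in C([0,T];H^1\cap W^{1,q}),\quad \rho_t\in C([0,T];L^2\cap L^q),$$ $$(u,\theta)\in C([0,T];D^1_0\cap D^2)\cap L^2(0,T;D^{2,q}),$$ $$(u_t,\theta_t)\in L^2(0,T;D^1_0),\quad(\sqrt\rho\,u_t,\sqrt\rho\,\theta_t)\in L^\infty_{loc}(0,T;L^2).$$ Then $$\sup_{0\le t\le T}\|\rho\|_3^3+\int_0^T\!\!\int_{\mathbb R^3}\rho^3p\,dx\,dt\le C\sup_{0\le t\le T}\Big(\|\rho\|_\infty^{2/3}\|\sqrt\rho\,u\|_2^{1/3}\|\sqrt\rho|u|^2\|_2^{1/3}\|\rho\|_3^3\Big)+C\int_0^T\|\rho\|_\infty^2\|\rho\|_3^2\|\nabla u\|_2^2\,dt+C\|\rho_0\|_3^3,$$ where all norms take values in $[0,\infty]$. -/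

import Mathlib

open MeasureTheory Set Filter Topology
open scoped ENNReal NNReal ContDiff

namespace HeatNS

/-- Three-dimensional Euclidean space. -/
abbrev E3 : Type := EuclideanSpace ℝ (Fin 3)

/-- Gradients of `F`-valued functions on `ℝ³`: the entry `A i : F` is the `i`-th partial derivative.
The norm is the Euclidean (Frobenius) one. -/
abbrev Grad (F : Type) : Type := PiLp 2 (fun _ : Fin 3 => F)

/-- `G` is the weak gradient of `f` on `ℝ³`. -/
def HasWeakGrad {F : Type} [NormedAddCommGroup F] [NormedSpace ℝ F]
    (f : E3 → F) (G : E3 → Grad F) : Prop :=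
  LocallyIntegrable f volume ∧ LocallyIntegrable G volume ∧
    ∀ φ : E3 → ℝ, ContDiff ℝ ∞ φ → HasCompactSupport φ → ∀ i : Fin 3,
      ∫ x, (fderiv ℝ φ x (EuclideanSpace.single i 1)) • f x = - ∫ x, φ x • G x i

/-- Lebesgue measure on `(0,T) × ℝ³`. -/
noncomputable def spaceTime (T : ℝ) : Measure (ℝ × E3) :=
  (volume : Measure (ℝ × E3)).restrict (Ioo 0 T ×ˢ univ)

/-- `g` is the weak time derivative of `f` on `(0,T) × ℝ³`. -/
def HasWeakTimeDeriv {F : Type} [NormedAddCommGroup F] [NormedSpace ℝ F]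
    (T : ℝ) (f g : ℝ → E3 → F) : Prop :=
  LocallyIntegrableOn (fun z : ℝ × E3 => f z.1 z.2) (Ioo 0 T ×ˢ univ) volume ∧
  LocallyIntegrableOn (fun z : ℝ × E3 => g z.1 z.2) (Ioo 0 T ×ˢ univ) volume ∧
    ∀ φ : ℝ × E3 → ℝ, ContDiff ℝ ∞ φ → HasCompactSupport φ → tsupport φ ⊆ Ioo 0 T ×ˢ univ →
      ∫ z, (fderiv ℝ φ z (1, 0)) • f z.1 z.2 = - ∫ z, φ z • g z.1 z.2

/-- Joint measurability on `(0,T) × ℝ³`. -/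
def JointMeas {F : Type} [NormedAddCommGroup F] (T : ℝ) (f : ℝ → E3 → F) : Prop :=
  AEStronglyMeasurable (fun z : ℝ × E3 => f z.1 z.2) (spaceTime T)

/-- `f ∈ C([0,T]; L^p)`. -/
def ContInLp {F : Type} [NormedAddCommGroup F] (T : ℝ) (p : ℝ≥0∞) (f : ℝ → E3 → F) : Prop :=
  (∀ t ∈ Icc 0 T, MemLp (f t) p volume) ∧
    ∀ s ∈ Icc 0 T, Tendsto (fun t => eLpNorm (f t - f s) p volume) (𝓝[Icc 0 T] s) (𝓝 0)

/-- `∫_0^T ‖f‖_p² dt < ∞`. -/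
def L2InLp {F : Type} [NormedAddCommGroup F] (T : ℝ) (p : ℝ≥0∞) (f : ℝ → E3 → F) : Prop :=
  (∫⁻ t in Ioo 0 T, eLpNorm (f t) p volume ^ 2) < ⊤

/-- `f ∈ L^∞_loc(0,T; L²)`. -/
def LinftyLocInL2 {F : Type} [NormedAddCommGroup F] (T : ℝ) (f : ℝ → E3 → F) : Prop :=
  ∀ a b : ℝ, 0 < a → b < T →
    ∃ M : ℝ≥0, ∀ᵐ t ∂(volume.restrict (Icc a b)), eLpNorm (f t) 2 volume ≤ M

/-- The divergence `∑ᵢ ∂ᵢ uᵢ`, read off from the gradient. -/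
noncomputable def divg (A : Grad E3) : ℝ := ∑ i, A i i

/-- `(v · ∇) f = ∑ᵢ vᵢ ∂ᵢ f`, from `v` and the gradient of `f`. -/
noncomputable def advect {F : Type} [NormedAddCommGroup F] [NormedSpace ℝ F]
    (v : E3) (A : Grad F) : F := ∑ i, v i • A i

/-- The Laplacian `∑ᵢ ∂ᵢ ∂ᵢ f`, from the second derivatives. -/
noncomputable def lapl {F : Type} [NormedAddCommGroup F] (H : Grad (Grad F)) : F := ∑ i, H i i

/-- The `j`-th component `∑ᵢ ∂ⱼ ∂ᵢ uᵢ` of `∇ div u`, from the second derivatives. -/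
noncomputable def gradDiv (H : Grad (Grad E3)) (j : Fin 3) : ℝ := ∑ i, H j i i

/-- `𝒬(∇u) = (μ/2) |∇u + (∇u)ᵗ|² + λ (div u)²`. -/
noncomputable def dissip (μ lam : ℝ) (A : Grad E3) : ℝ :=
  μ / 2 * ∑ i, ∑ j, (A i j + A j i) ^ 2 + lam * divg A ^ 2

/-- A regularity class shared by velocity and temperature:
`f ∈ C([0,T]; D₀¹ ∩ D²) ∩ L²(0,T; D^{2,q})`, `∂ₜ f ∈ L²(0,T; D₀¹)`, where `Df, D2f` are the first
and second weak spatial derivatives of `f`, `ft` is its weak time derivative, and `Dft` is the weak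
spatial gradient of `ft`. -/
structure VelReg {F : Type} [NormedAddCommGroup F] [NormedSpace ℝ F] (T : ℝ) (q : ℝ≥0∞)
    (f : ℝ → E3 → F) (Df : ℝ → E3 → Grad F) (D2f : ℝ → E3 → Grad (Grad F))
    (ft : ℝ → E3 → F) (Dft : ℝ → E3 → Grad F) : Prop where
  meas : JointMeas T f
  meas_D : JointMeas T Df
  meas_D2 : JointMeas T D2f
  meas_t : JointMeas T ft
  meas_Dt : JointMeas T Dft
  grad : ∀ t ∈ Icc 0 T, HasWeakGrad (f t) (Df t)
  grad2 : ∀ t ∈ Icc 0 T, HasWeakGrad (Df t) (D2f t)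
  cont : ContInLp T 6 f
  cont_D : ContInLp T 2 Df
  cont_D2 : ContInLp T 2 D2f
  sq_D2 : L2InLp T q D2f
  timeDeriv : HasWeakTimeDeriv T f ft
  grad_t : ∀ᵐ t ∂(volume.restrict (Ioo 0 T)), HasWeakGrad (ft t) (Dft t)
  sq_t : L2InLp T 6 ft
  sq_Dt : L2InLp T 2 Dft

/-- Strong solutions `(ρ, u, θ)` on `ℝ³ × (0,T)` of
`∂ₜρ + div(ρu) = 0`,
`ρ(∂ₜu + (u·∇)u) − μΔu − (μ+λ)∇div u + ∇p = 0`,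
`c_v ρ(∂ₜθ + u·∇θ) + p div u − κΔθ = 𝒬(∇u)`,
with `p = Rρθ`, `c_v = R/(γ−1)`, initial data `(ρ₀, u₀, θ₀)` and the regularity
`ρ ∈ C([0,T]; H¹ ∩ W^{1,q})`, `ρₜ ∈ C([0,T]; L² ∩ L^q)`,
`(u,θ) ∈ C([0,T]; D₀¹ ∩ D²) ∩ L²(0,T; D^{2,q})`,
`(uₜ,θₜ) ∈ L²(0,T; D₀¹)`, `(√ρ uₜ, √ρ θₜ) ∈ L^∞_loc(0,T; L²)`.
The fields `Dρ, ρt, Du, …` are the weak derivatives of `ρ, u, θ`, and the equations hold almost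
everywhere, with `div(ρu) = u·∇ρ + ρ div u` and `∇p = R(θ∇ρ + ρ∇θ)`. -/
structure StrongSolution (R γ μ lam κ : ℝ) (q : ℝ≥0∞) (T : ℝ)
    (ρ0 : E3 → ℝ) (u0 : E3 → E3) (θ0 : E3 → ℝ) where
  ρ : ℝ → E3 → ℝ
  Dρ : ℝ → E3 → Grad ℝ
  ρt : ℝ → E3 → ℝ
  u : ℝ → E3 → E3
  Du : ℝ → E3 → Grad E3
  D2u : ℝ → E3 → Grad (Grad E3)
  ut : ℝ → E3 → E3
  Dut : ℝ → E3 → Grad E3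
  θ : ℝ → E3 → ℝ
  Dθ : ℝ → E3 → Grad ℝ
  D2θ : ℝ → E3 → Grad (Grad ℝ)
  θt : ℝ → E3 → ℝ
  Dθt : ℝ → E3 → Grad ℝ
  ρ_nonneg : ∀ t ∈ Icc 0 T, ∀ᵐ x, 0 ≤ ρ t x
  θ_nonneg : ∀ t ∈ Icc 0 T, ∀ᵐ x, 0 ≤ θ t x
  ρ_init : ρ 0 =ᵐ[volume] ρ0
  u_init : u 0 =ᵐ[volume] u0
  θ_init : θ 0 =ᵐ[volume] θ0
  meas_ρ : JointMeas T ρ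
  meas_Dρ : JointMeas T Dρ
  meas_ρt : JointMeas T ρt
  grad_ρ : ∀ t ∈ Icc 0 T, HasWeakGrad (ρ t) (Dρ t)
  cont_ρ_two : ContInLp T 2 ρ
  cont_ρ_q : ContInLp T q ρ
  cont_Dρ_two : ContInLp T 2 Dρ
  cont_Dρ_q : ContInLp T q Dρ
  timeDeriv_ρ : HasWeakTimeDeriv T ρ ρt
  cont_ρt_two : ContInLp T 2 ρt
  cont_ρt_q : ContInLp T q ρt
  reg_u : VelReg T q u Du D2u ut Dut
  reg_θ : VelReg T q θ Dθ D2θ θt Dθt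
  bdd_ut : LinftyLocInL2 T (fun t x => Real.sqrt (ρ t x) • ut t x)
  bdd_θt : LinftyLocInL2 T (fun t x => Real.sqrt (ρ t x) * θt t x)
  continuity : ∀ᵐ z ∂(spaceTime T),
    ρt z.1 z.2 + (advect (u z.1 z.2) (Dρ z.1 z.2) + ρ z.1 z.2 * divg (Du z.1 z.2)) = 0
  momentum : ∀ᵐ z ∂(spaceTime T), ∀ j : Fin 3,
    ρ z.1 z.2 * (ut z.1 z.2 j + advect (u z.1 z.2) (Du z.1 z.2) j)
      - μ * lapl (D2u z.1 z.2) j - (μ + lam) * gradDiv (D2u z.1 z.2) j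
      + R * (θ z.1 z.2 * Dρ z.1 z.2 j + ρ z.1 z.2 * Dθ z.1 z.2 j) = 0
  temperature : ∀ᵐ z ∂(spaceTime T),
    R / (γ - 1) * ρ z.1 z.2 * (θt z.1 z.2 + advect (u z.1 z.2) (Dθ z.1 z.2))
      + R * ρ z.1 z.2 * θ z.1 z.2 * divg (Du z.1 z.2) - κ * lapl (D2θ z.1 z.2)
      = dissip μ lam (Du z.1 z.2)

/-- The pressure `p = Rρθ`. -/
def StrongSolution.p {R γ μ lam κ : ℝ} {q : ℝ≥0∞} {T : ℝ}
    {ρ0 : E3 → ℝ} {u0 : E3 → E3} {θ0 : E3 → ℝ}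
    (S : StrongSolution R γ μ lam κ q T ρ0 u0 θ0) (t : ℝ) (x : E3) : ℝ :=
  R * S.ρ t x * S.θ t x

end HeatNS

namespace HeatNS

/-! Test the momentum equation with ∇Φ, where Φ is the Newtonian potential of ρ³. Against a gradient
both viscous terms reduce to div u, and ρ(∂ₜu + u·∇u) = ∂ₜ(ρu) + div(ρu⊗u) by continuity.
Normalising ΔΦ = ρ³, this gives ∫ (p − (2μ+λ) div u) ρ³ = d/dt ∫ ρu·∇Φ − ∫ ρ uᵢuⱼ ∂ᵢ∂ⱼΦ − ∫ ρu·∇∂ₜΦ.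
The continuity equation in the form ∂ₜρ³ = −div(ρ³u) − 2ρ³ div u is used twice. It turns −(2μ+λ)∫ρ³
div u into (2μ+λ)/2 · d/dt ∫ρ³, so that after integration in time the left side contains both
quantities to be estimated, each nonnegative. It also expresses ∇∂ₜΦ by the Hessian of the potential
of ρ³u and the gradient of the potential of ρ³ div u (`Flow.rate_eq`, `Flow.integral_flux_eq`).

Two estimates remain. The boundary term ∫ρu·∇Φ is at most ‖ρ³‖₁ times the sup norm of |x|⁻² ∗ |ρu|.
Splitting the kernel at an optimal radius bounds this sup by ‖ρu‖₂^{1/3}‖ρu‖₄^{2/3}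
(`exists_riesz_interp`), and removing powers of ρ from these norms produces the first term on the
right (`exists_pairing_bound`). The other terms, collected in `Slice.defect`, are bounded by
‖ρ‖_∞²‖ρ‖₃²‖∇u‖₂² (`Slice.enorm_defect_le`), with Sobolev's inequality for u and two bounds on the
potential: the Hessian is bounded on L², and the gradient maps L^{6/5} to L². Both follow from
integration by parts (`eLpNorm_cv_ker2_le`, `eLpNorm_cv_ker1_le`), so no singular integrals occur.

To make every step legitimate the potential is replaced by −(|x|²+ε²)^{-1/2}. Its Laplacian `eta ε`
is a positive approximate identity of mass `etaMass`, all bounds that enter the estimate are uniform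
in ε ≤ 1, and ε → 0 is taken at the end (`Flow.enorm_integral_flux_le`). Differentiation in time
uses only weak time derivatives. These are turned into the statement that, for almost every x, the
functions are primitives of their derivatives in time (`TimeAC`, `timeAC_of_weak`), a property that
is stable under products.

The exponent q and the norms of the solution serve only to justify the manipulations. The constant
is built from 2μ+λ and absolute constants. -/

/-- The `i`-th standard basis vector of `ℝ³`. -/
noncomputable abbrev basisVec (i : Fin 3) : E3 := EuclideanSpace.single i 1

/-! ### Scalar weak partial derivatives -/

/-- `g` is the weak `i`-th partial derivative of the scalar function `f`. -/
def IsWeakPartial (i : Fin 3) (f g : E3 → ℝ) : Prop :=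
  LocallyIntegrable f volume ∧ LocallyIntegrable g volume ∧
    ∀ φ : E3 → ℝ, ContDiff ℝ ∞ φ → HasCompactSupport φ →
      ∫ x, fderiv ℝ φ x (basisVec i) * f x = - ∫ x, φ x * g x

lemma _root_.ContDiff.fderiv_apply_continuous {φ : E3 → ℝ} (hφ : ContDiff ℝ ∞ φ) (v : E3) :
    Continuous (fun x => fderiv ℝ φ x v) :=
  (hφ.continuous_fderiv (by simp)).clm_apply continuous_const

lemma locallyIntegrable_clm {F : Type} [NormedAddCommGroup F] [NormedSpace ℝ F]
    (L : F →L[ℝ] ℝ) {f : E3 → F} (hf : LocallyIntegrable f volume) :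
    LocallyIntegrable (fun x => L (f x)) volume := by
  intro x
  obtain ⟨s, hs, h⟩ := hf x
  exact ⟨s, hs, L.integrable_comp h⟩

/-- A continuous functional commutes with the integrals against test functions. Through this lemma
all vector-valued fields are replaced by their scalar entries. -/
lemma HasWeakGrad.isWeakPartial {F : Type} [NormedAddCommGroup F] [NormedSpace ℝ F]
    [CompleteSpace F]
    {f : E3 → F} {G : E3 → Grad F} (h : HasWeakGrad f G) (L : F →L[ℝ] ℝ) (i : Fin 3) :
    IsWeakPartial i (fun x => L (f x)) (fun x => L (G x i)) := by
  obtain ⟨hf, hG, hφ⟩ := h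
  have hGi : LocallyIntegrable (fun x => G x i) volume := by
    intro x
    obtain ⟨s, hs, h⟩ := hG x
    exact ⟨s, hs, (PiLp.proj 2 (fun _ : Fin 3 => F) i : _ →L[ℝ] F).integrable_comp h⟩
  refine ⟨locallyIntegrable_clm L hf, locallyIntegrable_clm L hGi, fun φ hs hc => ?_⟩
  have h1 := congrArg L (hφ φ hs hc i)
  have hc' : HasCompactSupport (fun x => fderiv ℝ φ x (basisVec i)) :=
    (hc.fderiv (𝕜 := ℝ)).comp_left (g := fun A : E3 →L[ℝ] ℝ => A (basisVec i)) rfl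
  have e1 : Integrable (fun x => fderiv ℝ φ x (basisVec i) • f x) volume :=
    hf.integrable_smul_left_of_hasCompactSupport (hs.fderiv_apply_continuous _) hc'
  have e2 : Integrable (fun x => φ x • G x i) volume :=
    hGi.integrable_smul_left_of_hasCompactSupport hs.continuous hc
  rw [map_neg, ← L.integral_comp_comm e1, ← L.integral_comp_comm e2] at h1
  simpa using h1

/-! ### Mollification -/

/-- A sequence of bump functions shrinking to the origin. -/
noncomputable def moll (n : ℕ) : ContDiffBump (0 : E3) where
  rIn := 1 / (n + 1)
  rOut := 2 / (n + 1)
  rIn_pos := by positivity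
  rIn_lt_rOut := by gcongr; norm_num

/-- Mollification of a scalar function. -/
noncomputable def mollify (n : ℕ) (f : E3 → ℝ) : E3 → ℝ :=
  convolution ((moll n).normed volume) f (ContinuousLinearMap.lsmul ℝ ℝ) volume

lemma mollify_apply (n : ℕ) (f : E3 → ℝ) (x : E3) :
    mollify n f x = ∫ y, (moll n).normed volume (x - y) * f y := by
  rw [mollify, convolution_lsmul_swap]; rfl

/-- This is Lebesgue differentiation. It applies because the outer radius of the mollifier is twice
the inner one for every `n`. -/
lemma ae_tendsto_mollify {f : E3 → ℝ} (hf : LocallyIntegrable f volume) :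
    ∀ᵐ x, Tendsto (fun n => mollify n f x) atTop (𝓝 (f x)) := by
  refine ContDiffBump.ae_convolution_tendsto_right_of_locallyIntegrable (K := 2) ?_ ?_ hf
  · have := (tendsto_one_div_add_atTop_nhds_zero_nat (𝕜 := ℝ)).const_mul 2
    simpa [moll, div_eq_mul_inv] using this
  · refine .of_forall fun n => ?_
    simp only [moll]; apply le_of_eq; ring

lemma contDiff_mollify (n : ℕ) {f : E3 → ℝ} (hf : LocallyIntegrable f volume) :
    ContDiff ℝ ∞ (mollify n f) :=
  HasCompactSupport.contDiff_convolution_left _ (moll n).hasCompactSupport_normed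
    (moll n).contDiff_normed hf

lemma abs_mollify_le (n : ℕ) {f : E3 → ℝ} {M : ℝ} (hM : ∀ᵐ x, |f x| ≤ M) (x : E3) :
    |mollify n f x| ≤ M := by
  rw [mollify_apply]
  have hi : Integrable (fun y => (moll n).normed volume (x - y)) volume :=
    (ContDiffBump.integrable_normed (moll n) (μ := volume)).comp_sub_left x
  calc |∫ y, (moll n).normed volume (x - y) * f y|
      ≤ ∫ y, (moll n).normed volume (x - y) * M := by
        refine (Real.norm_eq_abs _).symm.le.trans (norm_integral_le_of_norm_le (hi.mul_const M) ?_)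
        filter_upwards [hM] with y hy
        rw [Real.norm_eq_abs, abs_mul, abs_of_nonneg ((moll n).nonneg_normed _)]
        exact mul_le_mul_of_nonneg_left hy ((moll n).nonneg_normed _)
    _ = M := by
        rw [integral_mul_const, integral_sub_left_eq_self (fun y => (moll n).normed volume y) volume,
          (moll n).integral_normed, one_mul]

/-- The weak derivative is tested with y ↦ η(x − y), whose gradient is minus that of η at x − y. -/
lemma IsWeakPartial.fderiv_mollify {i : Fin 3} {f g : E3 → ℝ} (h : IsWeakPartial i f g)
    (n : ℕ) (x : E3) : fderiv ℝ (mollify n f) x (basisVec i) = mollify n g x := by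
  obtain ⟨hf, hg, hφ⟩ := h
  set η := (moll n).normed (volume : Measure E3) with hη
  have hηs : ContDiff ℝ ∞ η := (moll n).contDiff_normed
  have hηc : HasCompactSupport η := (moll n).hasCompactSupport_normed
  have h1 := HasCompactSupport.hasFDerivAt_convolution_left (ContinuousLinearMap.lsmul ℝ ℝ)
    hηc (hηs.of_le (by simp)) hf x
  rw [mollify, h1.fderiv]
  have key := hφ (fun y => η (x - y)) (by fun_prop)
    (hηc.comp_homeomorph (Homeomorph.subLeft x))
  have hd : ∀ y, fderiv ℝ (fun y => η (x - y)) y (basisVec i)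
      = - fderiv ℝ η (x - y) (basisVec i) := by
    intro y
    have : HasFDerivAt (fun y => η (x - y))
        ((fderiv ℝ η (x - y)).comp (-ContinuousLinearMap.id ℝ E3)) y :=
      ((hηs.differentiable (by simp)) (x - y)).hasFDerivAt.comp y
        ((hasFDerivAt_id y).const_sub x)
    rw [this.fderiv]; simp
  simp only [hd, neg_mul, integral_neg, neg_inj] at key
  rw [mollify_apply, ← hη, ← key, convolution_eq_swap]
  have hi : Integrable (fun t => (ContinuousLinearMap.precompL E3 (ContinuousLinearMap.lsmul ℝ ℝ)
      (fderiv ℝ η (x - t))) (f t)) volume := by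
    have := (HasCompactSupport.convolutionExists_left
      (ContinuousLinearMap.precompL E3 (ContinuousLinearMap.lsmul ℝ ℝ : ℝ →L[ℝ] ℝ →L[ℝ] ℝ))
      (hηc.fderiv (𝕜 := ℝ)) (hηs.continuous_fderiv (by simp)) hf x)
    exact this.integrable_swap
  rw [ContinuousLinearMap.integral_apply hi]
  simp

lemma memLp_top_bound {f : E3 → ℝ} (hf : MemLp f ⊤ volume) : ∃ M, 0 ≤ M ∧ ∀ᵐ x, |f x| ≤ M := by
  refine ⟨(eLpNorm f ⊤ volume).toReal, ENNReal.toReal_nonneg, ?_⟩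
  have := ae_le_eLpNormEssSup (f := f) (μ := (volume : Measure E3))
  filter_upwards [this] with x hx
  rw [← eLpNorm_exponent_top] at hx
  have h2 := ENNReal.toReal_mono hf.2.ne hx
  simpa using h2

/-- Testing a product with a mollified factor. -/
lemma IsWeakPartial.integral_mollify {i : Fin 3} {f f' g g' : E3 → ℝ}
    (hf : IsWeakPartial i f f') (hg : IsWeakPartial i g g')
    {φ : E3 → ℝ} (hφ : ContDiff ℝ ∞ φ) (hc : HasCompactSupport φ) (n : ℕ) :
    ∫ x, (fderiv ℝ φ x (basisVec i) * f x) * mollify n g x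
      = - (∫ x, (φ x * f' x) * mollify n g x) - ∫ x, (φ x * f x) * mollify n g' x := by
  have hm := contDiff_mollify n hg.1
  have hm' := contDiff_mollify n hg.2.1
  -- Only `g` is mollified: φ times the mollification is smooth with compact support, hence an
  -- admissible test function for `f`.
  have h := hf.2.2 (fun x => φ x * mollify n g x) (hφ.mul hm) hc.mul_right
  have hd : ∀ x, fderiv ℝ (fun x => φ x * mollify n g x) x (basisVec i)
      = fderiv ℝ φ x (basisVec i) * mollify n g x + φ x * mollify n g' x := by
    intro x
    rw [fderiv_fun_mul (hφ.differentiable (by simp) x) (hm.differentiable (by simp) x)]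
    simp [hg.fderiv_mollify n x]; ring
  have hc' : HasCompactSupport (fun x => fderiv ℝ φ x (basisVec i)) :=
    (hc.fderiv (𝕜 := ℝ)).comp_left (g := fun A : E3 →L[ℝ] ℝ => A (basisVec i)) rfl
  have e1 : Integrable (fun x => (fderiv ℝ φ x (basisVec i) * mollify n g x) * f x) volume :=
    hf.1.integrable_smul_left_of_hasCompactSupport
      ((hφ.fderiv_apply_continuous _).mul hm.continuous) hc'.mul_right
  have e2 : Integrable (fun x => (φ x * mollify n g' x) * f x) volume :=
    hf.1.integrable_smul_left_of_hasCompactSupport (hφ.continuous.mul hm'.continuous) hc.mul_right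
  simp only [hd, add_mul] at h
  rw [integral_add e1 e2] at h
  have r1 : ∫ x, (fderiv ℝ φ x (basisVec i) * f x) * mollify n g x
      = ∫ x, fderiv ℝ φ x (basisVec i) * mollify n g x * f x := by congr 1; ext x; ring
  have r2 : ∫ x, (φ x * f' x) * mollify n g x = ∫ x, φ x * mollify n g x * f' x := by
    congr 1; ext x; ring
  have r3 : ∫ x, (φ x * f x) * mollify n g' x = ∫ x, φ x * mollify n g' x * f x := by
    congr 1; ext x; ring
  rw [r1, r2, r3]; linarith

/-- Mollifying a bounded factor under the integral sign. -/
lemma tendsto_integral_mul_mollify {h g : E3 → ℝ} (hh : Integrable h volume)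
    (hg : LocallyIntegrable g volume) (hb : MemLp g ⊤ volume) :
    Tendsto (fun n => ∫ x, h x * mollify n g x) atTop (𝓝 (∫ x, h x * g x)) := by
  obtain ⟨M, hM0, hM⟩ := memLp_top_bound hb
  refine tendsto_integral_of_dominated_convergence (fun x => |h x| * M) ?_ ?_ ?_ ?_
  · exact fun n => hh.1.mul (contDiff_mollify n hg).continuous.aestronglyMeasurable
  · exact hh.abs.mul_const M
  · intro n
    refine .of_forall fun x => ?_
    rw [Real.norm_eq_abs, abs_mul]
    exact mul_le_mul_of_nonneg_left (abs_mollify_le n hM x) (abs_nonneg _)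
  · filter_upwards [ae_tendsto_mollify hg] with x hx
    exact hx.const_mul _

lemma norm_lt_of_moll_ne_zero {n : ℕ} {x : E3} (h : (moll n).normed volume x ≠ 0) : ‖x‖ < 2 := by
  have h1 : x ∈ Function.support ((moll n).normed (volume : Measure E3)) := h
  rw [ContDiffBump.support_normed_eq, mem_ball_zero_iff] at h1
  refine h1.trans_le ?_
  simp only [moll]
  rw [div_le_iff₀ (by positivity)]
  have : (0 : ℝ) ≤ n := n.cast_nonneg
  linarith

/-- Moving the mollification to the other, compactly supported factor. -/
lemma integral_mul_mollify_comm {h g : E3 → ℝ} (hh : Integrable h volume)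
    (hc : HasCompactSupport h) (hg : LocallyIntegrable g volume) (n : ℕ) :
    ∫ x, h x * mollify n g x = ∫ y, mollify n h y * g y := by
  set η := (moll n).normed (volume : Measure E3) with hη
  have hηs : Continuous η := ((moll n).contDiff_normed (n := 0)).continuous
  obtain ⟨C, hC⟩ := (moll n).hasCompactSupport_normed.exists_bound_of_continuous hηs
  obtain ⟨r, hr⟩ := hc.isBounded.subset_closedBall (0 : E3)
  -- `h` lives in radius r and every mollifier reaches less than 2, so `g` outside B is never seen.
  -- Truncating it there makes the double integral absolutely convergent.
  set B := Metric.closedBall (0 : E3) (r + 2)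
  have hgB : Integrable (B.indicator g) volume :=
    (hg.integrableOn_isCompact (isCompact_closedBall _ _)).integrable_indicator
      measurableSet_closedBall
  have hprod : Integrable (fun z : E3 × E3 => h z.1 * (η (z.1 - z.2) * B.indicator g z.2))
      (volume.prod volume) := by
    have h1 := (hh.mul_prod hgB).bdd_mul (c := C)
      (f := fun z : E3 × E3 => η (z.1 - z.2)) (by fun_prop) (.of_forall fun z => hC _)
    refine h1.congr (.of_forall fun z => ?_)
    simp only; ring
  have hind : ∀ x y, h x * (η (x - y) * B.indicator g y) = h x * (η (x - y) * g y) := by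
    intro x y
    by_cases hx : h x = 0
    · simp [hx]
    by_cases hxy : η (x - y) = 0
    · simp [hxy]
    have hxr : ‖x‖ ≤ r := by
      simpa using hr (subset_tsupport h hx)
    have hy : y ∈ B := by
      have := norm_lt_of_moll_ne_zero hxy
      simp only [B, mem_closedBall_zero_iff]
      calc ‖y‖ = ‖x - (x - y)‖ := by congr 1; abel
        _ ≤ ‖x‖ + ‖x - y‖ := norm_sub_le _ _
        _ ≤ _ := by linarith
    rw [indicator_of_mem hy]
  have hsw := integral_integral_swap (f := fun x y => h x * (η (x - y) * B.indicator g y)) hprod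
  simp only [hind] at hsw
  calc ∫ x, h x * mollify n g x = ∫ x, ∫ y, h x * (η (x - y) * g y) := by
        simp only [mollify_apply, ← hη, integral_const_mul]
    _ = ∫ y, ∫ x, h x * (η (x - y) * g y) := hsw
    _ = _ := by
        congr 1; ext y
        rw [mollify_apply, ← integral_mul_const]
        congr 1; ext x
        rw [← hη, ← neg_sub x y, hη, ContDiffBump.normed_neg]; ring

/-- Mollifying a locally integrable factor against a bounded, compactly supported one. -/
lemma tendsto_integral_mul_mollify' {h g : E3 → ℝ} (hh : MemLp h ⊤ volume)
    (hi : Integrable h volume)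
    (hc : HasCompactSupport h) (hg : LocallyIntegrable g volume) :
    Tendsto (fun n => ∫ x, h x * mollify n g x) atTop (𝓝 (∫ x, h x * g x)) := by
  obtain ⟨M, hM0, hM⟩ := memLp_top_bound hh
  obtain ⟨r, hr⟩ := hc.isBounded.subset_closedBall (0 : E3)
  set B := Metric.closedBall (0 : E3) (r + 2)
  have hgB : Integrable (B.indicator g) volume :=
    (hg.integrableOn_isCompact (isCompact_closedBall _ _)).integrable_indicator
      measurableSet_closedBall
  have hz : ∀ n, ∀ y ∉ B, mollify n h y = 0 := by
    intro n y hy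
    rw [mollify_apply]
    refine integral_eq_zero_of_ae (.of_forall fun x => ?_)
    by_contra hne
    obtain ⟨h1, h2⟩ := mul_ne_zero_iff.1 hne
    have hxr : ‖x‖ ≤ r := by simpa using hr (subset_tsupport h h2)
    have := norm_lt_of_moll_ne_zero h1
    apply hy
    simp only [B, mem_closedBall_zero_iff]
    calc ‖y‖ = ‖x + (y - x)‖ := by congr 1; abel
      _ ≤ ‖x‖ + ‖y - x‖ := norm_add_le _ _
      _ ≤ _ := by linarith
  have hzh : ∀ y ∉ B, h y = 0 := by
    intro y hy
    by_contra hne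
    apply hy
    have : ‖y‖ ≤ r := by simpa using hr (subset_tsupport h hne)
    simp only [B, mem_closedBall_zero_iff]; linarith
  -- Once the mollifier is moved onto `h`, the roles are exchanged: `h` is the bounded factor and
  -- the truncated `g` the integrable one, as required by `tendsto_integral_mul_mollify`.
  have e1 : ∀ n, ∫ x, h x * mollify n g x = ∫ x, B.indicator g x * mollify n h x := by
    intro n
    rw [integral_mul_mollify_comm hi hc hg]
    congr 1; ext y
    by_cases hy : y ∈ B
    · simp [hy, mul_comm]
    · simp [hz n y hy]
  have e2 : ∫ x, h x * g x = ∫ x, B.indicator g x * h x := by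
    congr 1; ext y
    by_cases hy : y ∈ B
    · simp [hy, mul_comm]
    · simp [hzh y hy]
  simp only [e1, e2]
  exact tendsto_integral_mul_mollify hgB hi.locallyIntegrable hh

lemma locallyIntegrable_mul_top {f g : E3 → ℝ} (hf : LocallyIntegrable f volume)
    (hg : MemLp g ⊤ volume) : LocallyIntegrable (fun x => f x * g x) volume := by
  obtain ⟨M, hM0, hM⟩ := memLp_top_bound hg
  intro x
  obtain ⟨s, hs, h⟩ := hf x
  exact ⟨s, hs, Integrable.mul_bdd h hg.1.restrict (ae_restrict_of_ae hM)⟩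

/-- Product rule for bounded functions. -/
lemma IsWeakPartial.mul {i : Fin 3} {f f' g g' : E3 → ℝ}
    (hf : IsWeakPartial i f f') (hg : IsWeakPartial i g g')
    (bf : MemLp f ⊤ volume) (bg : MemLp g ⊤ volume) :
    IsWeakPartial i (fun x => f x * g x) (fun x => f' x * g x + f x * g' x) := by
  have l1 := locallyIntegrable_mul_top hf.2.1 bg
  have l2 : LocallyIntegrable (fun x => f x * g' x) volume := by
    simpa only [mul_comm] using locallyIntegrable_mul_top hg.2.1 bf
  refine ⟨locallyIntegrable_mul_top hf.1 bg, l1.add l2, fun φ hφ hc => ?_⟩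
  have hc' : HasCompactSupport (fun x => fderiv ℝ φ x (basisVec i)) :=
    (hc.fderiv (𝕜 := ℝ)).comp_left (g := fun A : E3 →L[ℝ] ℝ => A (basisVec i)) rfl
  have int : ∀ {ψ : E3 → ℝ} {k : E3 → ℝ}, Continuous ψ → HasCompactSupport ψ →
      LocallyIntegrable k volume → Integrable (fun x => ψ x * k x) volume :=
    fun h1 h2 h3 => h3.integrable_smul_left_of_hasCompactSupport h1 h2
  have hφf := int hφ.continuous hc hf.1
  have t1 := tendsto_integral_mul_mollify (int (hφ.fderiv_apply_continuous (basisVec i)) hc' hf.1)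
    hg.1 bg
  have t2 := tendsto_integral_mul_mollify (int hφ.continuous hc hf.2.1) hg.1 bg
  have bφ : MemLp φ ⊤ volume := hφ.continuous.memLp_top_of_hasCompactSupport hc volume
  -- Here `g'` is only locally integrable, so the boundedness must come from the other factor φ f.
  have t3 := tendsto_integral_mul_mollify' (h := fun x => φ x * f x) (bf.mul bφ) hφf hc.mul_right
    hg.2.1
  have t4 := (t2.neg.sub t3).congr fun n => (hf.integral_mollify hg hφ hc n).symm
  have key := tendsto_nhds_unique t1 t4
  simp only [mul_add, ← mul_assoc] at key ⊢
  rw [integral_add, key]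
  · ring
  · simpa only [mul_assoc] using int hφ.continuous hc l1
  · simpa only [mul_assoc] using int hφ.continuous hc l2

/-- Product rule with one factor bounded together with its weak derivative. -/
lemma IsWeakPartial.mul_of_lipschitz {i : Fin 3} {f f' g g' : E3 → ℝ}
    (hf : IsWeakPartial i f f') (hg : IsWeakPartial i g g')
    (bg : MemLp g ⊤ volume) (bg' : MemLp g' ⊤ volume) :
    IsWeakPartial i (fun x => f x * g x) (fun x => f' x * g x + f x * g' x) := by
  have l1 := locallyIntegrable_mul_top hf.2.1 bg
  have l2 := locallyIntegrable_mul_top hf.1 bg'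
  refine ⟨locallyIntegrable_mul_top hf.1 bg, l1.add l2, fun φ hφ hc => ?_⟩
  have hc' : HasCompactSupport (fun x => fderiv ℝ φ x (basisVec i)) :=
    (hc.fderiv (𝕜 := ℝ)).comp_left (g := fun A : E3 →L[ℝ] ℝ => A (basisVec i)) rfl
  have int : ∀ {ψ : E3 → ℝ} {k : E3 → ℝ}, Continuous ψ → HasCompactSupport ψ →
      LocallyIntegrable k volume → Integrable (fun x => ψ x * k x) volume :=
    fun h1 h2 h3 => h3.integrable_smul_left_of_hasCompactSupport h1 h2
  have t1 := tendsto_integral_mul_mollify (int (hφ.fderiv_apply_continuous (basisVec i)) hc' hf.1)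
    hg.1 bg
  have t2 := tendsto_integral_mul_mollify (int hφ.continuous hc hf.2.1) hg.1 bg
  have t3 := tendsto_integral_mul_mollify (int hφ.continuous hc hf.1) hg.2.1 bg'
  have t4 := (t2.neg.sub t3).congr fun n => (hf.integral_mollify hg hφ hc n).symm
  have key := tendsto_nhds_unique t1 t4
  simp only [mul_add, ← mul_assoc] at key ⊢
  rw [integral_add, key]
  · ring
  · simpa only [mul_assoc] using int hφ.continuous hc l1
  · simpa only [mul_assoc] using int hφ.continuous hc l2

/-! ### Cutoff functions -/

/-- A fixed cutoff function, equal to one on the unit ball. -/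
noncomputable def cutoffBase : ContDiffBump (0 : E3) where
  rIn := 1
  rOut := 2
  rIn_pos := by norm_num
  rIn_lt_rOut := by norm_num

/-- The cutoff at scale `n + 1`. -/
noncomputable def cutoff (n : ℕ) (x : E3) : ℝ := cutoffBase (((n : ℝ) + 1)⁻¹ • x)

lemma contDiff_cutoff (n : ℕ) : ContDiff ℝ ∞ (cutoff n) :=
  cutoffBase.contDiff.comp (contDiff_id.const_smul _)

lemma hasCompactSupport_cutoff (n : ℕ) : HasCompactSupport (cutoff n) :=
  cutoffBase.hasCompactSupport.comp_smul (by positivity)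

lemma cutoff_mem (n : ℕ) (x : E3) : 0 ≤ cutoff n x ∧ cutoff n x ≤ 1 :=
  ⟨cutoffBase.nonneg, cutoffBase.le_one⟩

lemma tendsto_cutoff (x : E3) : Tendsto (fun n => cutoff n x) atTop (𝓝 1) := by
  obtain ⟨N, hN⟩ := exists_nat_ge ‖x‖
  refine tendsto_const_nhds.congr' ?_
  filter_upwards [eventually_ge_atTop N] with n hn
  refine (cutoffBase.one_of_mem_closedBall ?_).symm
  have : (N : ℝ) ≤ n := by exact_mod_cast hn
  rw [mem_closedBall_zero_iff, norm_smul, norm_inv, Real.norm_of_nonneg (by positivity)]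
  change _ ≤ (1 : ℝ)
  rw [inv_mul_le_iff₀ (by positivity)]; linarith

/-- The partial derivative of the cutoff. -/
noncomputable def cutoffDeriv (i : Fin 3) (n : ℕ) (x : E3) : ℝ :=
  fderiv ℝ (cutoff n) x (basisVec i)

lemma continuous_cutoffDeriv (i : Fin 3) (n : ℕ) : Continuous (cutoffDeriv i n) :=
  (contDiff_cutoff n).fderiv_apply_continuous _

lemma cutoffDeriv_eq (i : Fin 3) (n : ℕ) (x : E3) : cutoffDeriv i n x
    = ((n : ℝ) + 1)⁻¹ * fderiv ℝ cutoffBase (((n : ℝ) + 1)⁻¹ • x) (basisVec i) := by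
  have h1 : HasFDerivAt (cutoff n) ((fderiv ℝ cutoffBase (((n : ℝ) + 1)⁻¹ • x)).comp
      (((n : ℝ) + 1)⁻¹ • ContinuousLinearMap.id ℝ E3)) x :=
    (((cutoffBase.contDiff (n := 1)).differentiable (by simp)) _).hasFDerivAt.comp x
      ((hasFDerivAt_id x).fun_const_smul (((n : ℝ) + 1)⁻¹))
  rw [cutoffDeriv, h1.fderiv]; simp

/-- Dilation by n + 1 divides the gradient by n + 1, so one bound for the fixed cutoff serves all
scales. -/
lemma exists_bound_cutoffDeriv (i : Fin 3) :
    ∃ C : ℝ, 0 ≤ C ∧ ∀ n x, |cutoffDeriv i n x| ≤ C * ((n : ℝ) + 1)⁻¹ := by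
  have hs : ContDiff ℝ ∞ (cutoffBase : E3 → ℝ) := cutoffBase.contDiff
  have hc' : HasCompactSupport (fun x => fderiv ℝ cutoffBase x (basisVec i)) :=
    (cutoffBase.hasCompactSupport.fderiv (𝕜 := ℝ)).comp_left
      (g := fun A : E3 →L[ℝ] ℝ => A (basisVec i)) rfl
  obtain ⟨C, hC⟩ := hc'.exists_bound_of_continuous (hs.fderiv_apply_continuous _)
  refine ⟨C, (norm_nonneg _).trans (hC 0), fun n x => ?_⟩
  rw [cutoffDeriv_eq, abs_mul, abs_of_pos (by positivity : (0:ℝ) < ((n : ℝ) + 1)⁻¹), mul_comm]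
  gcongr
  exact hC _

/-- Together with `cutoffDeriv_eq_zero'` this confines the gradient of the cutoff to the shell n + 1
≤ |x| ≤ 2(n + 1). -/
lemma cutoffDeriv_eq_zero {i : Fin 3} {n : ℕ} {x : E3} (hx : ‖x‖ < n + 1) :
    cutoffDeriv i n x = 0 := by
  have : (cutoffBase : E3 → ℝ) =ᶠ[𝓝 (((n : ℝ) + 1)⁻¹ • x)] fun _ => 1 := by
    refine cutoffBase.eventuallyEq_one_of_mem_ball ?_
    rw [mem_ball_zero_iff, norm_smul, norm_inv, Real.norm_of_nonneg (by positivity)]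
    change _ < (1 : ℝ)
    rw [inv_mul_lt_iff₀ (by positivity)]; linarith
  rw [cutoffDeriv_eq, this.fderiv_eq]; simp

lemma cutoffDeriv_eq_zero' {i : Fin 3} {n : ℕ} {x : E3} (hx : 2 * ((n : ℝ) + 1) < ‖x‖) :
    cutoffDeriv i n x = 0 := by
  have h0 : ((n : ℝ) + 1)⁻¹ • x ∉ tsupport (cutoffBase : E3 → ℝ) := by
    rw [cutoffBase.tsupport_eq, mem_closedBall_zero_iff, norm_smul, norm_inv,
      Real.norm_of_nonneg (by positivity)]
    change ¬ (_ ≤ (2 : ℝ))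
    rw [not_le, lt_inv_mul_iff₀ (by positivity)]; linarith
  rw [cutoffDeriv_eq, image_eq_zero_of_notMem_tsupport
    (fun h => h0 (tsupport_fderiv_subset ℝ h))]
  simp

lemma tendsto_cutoffDeriv (i : Fin 3) (x : E3) :
    Tendsto (fun n => cutoffDeriv i n x) atTop (𝓝 0) := by
  obtain ⟨N, hN⟩ := exists_nat_ge ‖x‖
  refine tendsto_const_nhds.congr' ?_
  filter_upwards [eventually_ge_atTop N] with n hn
  have : (N : ℝ) ≤ n := by exact_mod_cast hn
  exact (cutoffDeriv_eq_zero (by linarith)).symm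

/-! ### Integrals of weak derivatives over the whole space -/

/-- With the cutoffs χₙ as test functions, ∫ χₙ g tends to ∫ g by dominated convergence, so only the
boundary term containing ∂ᵢχₙ has to vanish. `IsWeakPartial.integral_eq_zero` and its primed version
differ in how it does. -/
lemma IsWeakPartial.integral_eq_zero_of_tendsto {i : Fin 3} {f g : E3 → ℝ}
    (h : IsWeakPartial i f g) (hg : Integrable g volume)
    (ht : Tendsto (fun n => ∫ x, cutoffDeriv i n x * f x) atTop (𝓝 0)) : ∫ x, g x = 0 := by
  have t1 : Tendsto (fun n => ∫ x, cutoff n x * g x) atTop (𝓝 (∫ x, g x)) := by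
    refine tendsto_integral_of_dominated_convergence (fun x => |g x|) ?_ hg.abs ?_ ?_
    · exact fun n => (contDiff_cutoff n).continuous.aestronglyMeasurable.mul hg.1
    · refine fun n => .of_forall fun x => ?_
      rw [Real.norm_eq_abs, abs_mul, abs_of_nonneg (cutoff_mem n x).1]
      exact mul_le_of_le_one_left (abs_nonneg _) (cutoff_mem n x).2
    · refine .of_forall fun x => ?_
      simpa using (tendsto_cutoff x).mul_const (g x)
  have t2 := ht.congr fun n => h.2.2 _ (contDiff_cutoff n) (hasCompactSupport_cutoff n)
  have := tendsto_nhds_unique t1.neg t2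
  linarith

/-- The integral of an integrable weak derivative of an integrable function vanishes. -/
lemma IsWeakPartial.integral_eq_zero {i : Fin 3} {f g : E3 → ℝ}
    (h : IsWeakPartial i f g) (hf : Integrable f volume) (hg : Integrable g volume) :
    ∫ x, g x = 0 := by
  refine h.integral_eq_zero_of_tendsto hg ?_
  obtain ⟨C, hC0, hC⟩ := exists_bound_cutoffDeriv i
  have : ∫ x : E3, (0 : ℝ) * f x = 0 := by simp
  rw [← this]
  refine tendsto_integral_of_dominated_convergence (fun x => C * |f x|) ?_ (hf.abs.const_mul _) ?_ ?_
  · exact fun n => (continuous_cutoffDeriv i n).aestronglyMeasurable.mul hf.1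
  · refine fun n => .of_forall fun x => ?_
    rw [Real.norm_eq_abs, abs_mul]
    gcongr
    refine (hC n x).trans (mul_le_of_le_one_right hC0 ?_)
    rw [inv_le_one₀ (by positivity)]
    have : (0 : ℝ) ≤ n := n.cast_nonneg
    linarith
  · exact .of_forall fun x => (tendsto_cutoffDeriv i x).mul_const _


/-- The L³ norm of a gradient is scale invariant in dimension three: the size 1/(n+1) is compensated
by the volume of a ball of radius 2(n+1). -/
lemma exists_eLpNorm_cutoffDeriv_le (i : Fin 3) :
    ∃ C : ℝ≥0, ∀ n, eLpNorm (cutoffDeriv i n) 3 volume ≤ C := by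
  obtain ⟨C, hC0, hC⟩ := exists_bound_cutoffDeriv i
  set v : ℝ≥0∞ := volume (Metric.ball (0 : E3) 1) with hv
  have hvt : v ≠ ⊤ := measure_ball_lt_top.ne
  refine ⟨Real.toNNReal (2 * C) * (v ^ (1 / 3 : ℝ)).toNNReal, fun n => ?_⟩
  set B := Metric.closedBall (0 : E3) (2 * ((n : ℝ) + 1))
  have h1 : cutoffDeriv i n = B.indicator (cutoffDeriv i n) := by
    ext x
    by_cases hx : x ∈ B
    · simp [hx]
    · rw [indicator_of_notMem hx]
      exact cutoffDeriv_eq_zero' (by simpa [B] using hx)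
  have h2 := eLpNorm_le_of_ae_bound (p := 3) (μ := volume.restrict B)
    (f := cutoffDeriv i n) (.of_forall fun x => hC n x)
  rw [h1, eLpNorm_indicator_eq_eLpNorm_restrict measurableSet_closedBall]
  refine h2.trans (le_of_eq ?_)
  rw [Measure.restrict_apply_univ, Measure.addHaar_closedBall _ _ (by positivity), finrank_euclideanSpace,
    Fintype.card_fin, ← hv, ENNReal.mul_rpow_of_nonneg _ _ (by simp), ENNReal.coe_mul,
    ENNReal.coe_toNNReal (ENNReal.rpow_ne_top_of_nonneg (by norm_num) hvt), mul_right_comm]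
  have e3 : (ENNReal.toReal 3)⁻¹ = (1 / 3 : ℝ) := by simp
  rw [e3]
  congr 1
  rw [ENNReal.ofReal_rpow_of_nonneg (by positivity) (by norm_num), ← Real.rpow_natCast,
    ← Real.rpow_mul (by positivity), ← ENNReal.ofReal_mul (by positivity)]
  change _ = ENNReal.ofReal (2 * C)
  congr 1
  norm_num
  field_simp

lemma tendsto_eLpNorm_tail {f : E3 → ℝ} {p : ℝ≥0∞} (hp0 : p ≠ 0) (hp : p ≠ ⊤)
    (hf : MemLp f p volume) :
    Tendsto (fun n : ℕ => eLpNorm ({x : E3 | (n : ℝ) + 1 ≤ ‖x‖}.indicator f) p volume)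
      atTop (𝓝 0) := by
  have hms : ∀ n : ℕ, MeasurableSet {x : E3 | (n : ℝ) + 1 ≤ ‖x‖} := fun n =>
    measurableSet_le measurable_const measurable_norm
  have hpp := ENNReal.toReal_pos hp0 hp
  have h1 : Tendsto (fun n : ℕ => ∫⁻ x, ‖{x : E3 | (n : ℝ) + 1 ≤ ‖x‖}.indicator f x‖ₑ ^ p.toReal)
      atTop (𝓝 (∫⁻ x : E3, 0)) := by
    refine tendsto_lintegral_of_dominated_convergence' (fun x => ‖f x‖ₑ ^ p.toReal) ?_ ?_ ?_ ?_
    · exact fun n => ((hf.1.indicator (hms n)).enorm).pow_const _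
    · refine fun n => .of_forall fun x => ?_
      simp only
      gcongr
      by_cases hx : x ∈ {x : E3 | (n : ℝ) + 1 ≤ ‖x‖}
      · rw [indicator_of_mem hx]
      · rw [indicator_of_notMem hx]; simp
    · exact (lintegral_rpow_enorm_lt_top_of_eLpNorm_lt_top hp0 hp hf.2).ne
    · refine .of_forall fun x => ?_
      obtain ⟨N, hN⟩ := exists_nat_ge ‖x‖
      refine tendsto_const_nhds.congr' ?_
      filter_upwards [eventually_ge_atTop N] with n hn
      have : (N : ℝ) ≤ n := by exact_mod_cast hn
      rw [indicator_of_notMem]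
      · simp [hpp]
      · simp only [mem_ofPred_eq, not_le]; linarith
  simp only [lintegral_zero] at h1
  have h2 := ((ENNReal.continuous_rpow_const (y := 1 / p.toReal)).tendsto 0).comp h1
  rw [ENNReal.zero_rpow_of_pos (by positivity)] at h2
  refine h2.congr fun n => ?_
  rw [eLpNorm_eq_lintegral_rpow_enorm_toReal hp0 hp]; rfl

/-- The L³ norm of the cutoff gradient stays bounded while its support moves to infinity. Hölder's
inequality then leaves a tail of the L^p norm of `f`. This removes boundary terms for functions that
decay too slowly to be integrable. -/
lemma tendsto_eLpNorm_cutoffDeriv_mul (i : Fin 3) {f : E3 → ℝ} {p r : ℝ≥0∞} (hp0 : p ≠ 0)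
    (hp : p ≠ ⊤) [ENNReal.HolderTriple 3 p r] (hf : MemLp f p volume) :
    Tendsto (fun n => eLpNorm (fun x => cutoffDeriv i n x * f x) r volume) atTop (𝓝 0) := by
  obtain ⟨C, hC⟩ := exists_eLpNorm_cutoffDeriv_le i
  have t := ENNReal.Tendsto.const_mul (a := (C : ℝ≥0∞)) (tendsto_eLpNorm_tail hp0 hp hf)
    (.inr ENNReal.coe_ne_top)
  rw [mul_zero] at t
  refine tendsto_of_tendsto_of_tendsto_of_le_of_le tendsto_const_nhds t (fun n => zero_le)
    fun n => ?_
  have hms : MeasurableSet {x : E3 | (n : ℝ) + 1 ≤ ‖x‖} :=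
    measurableSet_le measurable_const measurable_norm
  have e : (fun x => cutoffDeriv i n x * f x)
      = cutoffDeriv i n • {x : E3 | (n : ℝ) + 1 ≤ ‖x‖}.indicator f := by
    ext x
    by_cases hx : (n : ℝ) + 1 ≤ ‖x‖
    · simp [hx]
    · simp [hx, cutoffDeriv_eq_zero (i := i) (not_le.1 hx)]
  simp only
  rw [e]
  refine (eLpNorm_smul_le_mul_eLpNorm (p := 3) (q := p) (hf.1.indicator hms)
    (continuous_cutoffDeriv i n).aestronglyMeasurable).trans ?_
  gcongr
  exact hC n

/-- The integral of an integrable weak derivative of an `L^{3/2}` function vanishes. -/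
lemma IsWeakPartial.integral_eq_zero' {i : Fin 3} {f g : E3 → ℝ}
    (h : IsWeakPartial i f g) (hf : MemLp f (3 / 2) volume) (hg : Integrable g volume) :
    ∫ x, g x = 0 := by
  refine h.integral_eq_zero_of_tendsto hg ?_
  have : ENNReal.HolderTriple 3 (3 / 2) 1 := ⟨by
    rw [ENNReal.inv_div (by simp) (by simp), inv_one, ← one_div, ← ENNReal.add_div]; norm_num
    exact ENNReal.div_self (by simp) (by simp)⟩
  have t := tendsto_eLpNorm_cutoffDeriv_mul (r := 1) i (ENNReal.div_ne_zero.2 (by simp))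
    (ENNReal.div_ne_top (by simp) (by simp)) hf
  rw [tendsto_zero_iff_enorm_tendsto_zero]
  refine tendsto_of_tendsto_of_tendsto_of_le_of_le tendsto_const_nhds t (fun n => zero_le)
    fun n => ?_
  simp only [eLpNorm_one_eq_lintegral_enorm]
  exact enorm_integral_le_lintegral_enorm _


/-! ### Convolutions -/

/-- Convolution of scalar functions on `ℝ³`. -/
noncomputable def cv (k g : E3 → ℝ) (x : E3) : ℝ := ∫ y, k (x - y) * g y

lemma cv_comm (k g : E3 → ℝ) : cv k g = cv g k := by
  ext x
  rw [cv, cv, ← integral_sub_left_eq_self (fun y => k (x - y) * g y) volume x]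
  simp [mul_comm]

lemma mollify_eq_cv (n : ℕ) (f : E3 → ℝ) : mollify n f = cv ((moll n).normed volume) f := by
  ext x; rw [mollify_apply, cv]

/-- Jensen's inequality for a convolution. -/
lemma lintegral_conv_rpow_le_aux {r : ℝ} (hr : 1 < r) {a b : E3 → ℝ≥0∞} (ha : Measurable a)
    (hb : Measurable b) (x : E3) :
    (∫⁻ y, a (x - y) * b y) ^ r
      ≤ (∫⁻ y, a y) ^ (r - 1) * ∫⁻ y, a (x - y) * b y ^ r := by
  have hr0 : 0 < r := by linarith
  have hc := (Real.HolderConjugate.conjExponent hr).symm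
  set q := Real.conjExponent r with hq
  have hq0 : 0 < q := hc.pos
  have hax : Measurable fun y => a (x - y) := ha.comp (measurable_const.sub measurable_id)
  -- Write a b = a^{1/q} · (a^{1/r} b), so that the first factor contributes only the mass of `a`.
  have h := ENNReal.lintegral_mul_le_Lp_mul_Lq volume hc
    (f := fun y => a (x - y) ^ (1 / q)) (g := fun y => a (x - y) ^ (1 / r) * b y)
    (hax.pow_const _).aemeasurable ((hax.pow_const _).mul hb).aemeasurable
  have e1 : ∀ y, ((fun y => a (x - y) ^ (1 / q)) * fun y => a (x - y) ^ (1 / r) * b y) y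
      = a (x - y) * b y := by
    intro y
    simp only [Pi.mul_apply]
    rw [← mul_assoc, ← ENNReal.rpow_add_of_nonneg _ _ (by positivity) (by positivity), one_div, one_div,
      hc.inv_add_inv_eq_one, ENNReal.rpow_one]
  have e2 : ∀ y, (a (x - y) ^ (1 / q)) ^ q = a (x - y) := fun y => by
    rw [← ENNReal.rpow_mul, one_div_mul_cancel hq0.ne', ENNReal.rpow_one]
  have e3 : ∀ y, (a (x - y) ^ (1 / r) * b y) ^ r = a (x - y) * b y ^ r := fun y => by
    rw [ENNReal.mul_rpow_of_nonneg _ _ hr0.le, ← ENNReal.rpow_mul, one_div_mul_cancel hr0.ne',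
      ENNReal.rpow_one]
  simp only [e1, e2, e3] at h
  have h2 := ENNReal.rpow_le_rpow h hr0.le
  refine h2.trans (le_of_eq ?_)
  rw [ENNReal.mul_rpow_of_nonneg _ _ hr0.le, ← ENNReal.rpow_mul, ← ENNReal.rpow_mul,
    one_div_mul_cancel hr0.ne', ENNReal.rpow_one, lintegral_sub_left_eq_self a]
  congr 2
  have := hc.inv_add_inv_eq_one
  have h3 : q⁻¹ = 1 - r⁻¹ := by linarith
  rw [one_div, h3]; field_simp

/-- Young's inequality, `L¹ * L^r → L^r`, for nonnegative functions. -/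
lemma lintegral_conv_rpow_le {r : ℝ} (hr : 1 < r) {a b : E3 → ℝ≥0∞} (ha : Measurable a)
    (hb : Measurable b) :
    ∫⁻ x, (∫⁻ y, a (x - y) * b y) ^ r ≤ (∫⁻ y, a y) ^ r * ∫⁻ y, b y ^ r := by
  -- The masses 0 and ∞ are treated apart because the end of the computation adds exponents of ∫ a,
  -- which needs a finite nonzero base.
  by_cases h0 : ∫⁻ y, a y = 0
  · have ha0 := (lintegral_eq_zero_iff ha).1 h0
    have : ∀ x, ∫⁻ y, a (x - y) * b y = 0 := by
      intro x
      have h1 : ∀ᵐ y, a (x - y) = 0 :=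
        (quasiMeasurePreserving_sub_left volume x).ae ha0
      refine (lintegral_congr_ae (g := 0) ?_).trans lintegral_zero
      filter_upwards [h1] with y hy
      simp [hy]
    simp [this, (by linarith : 0 < r)]
  by_cases ht : ∫⁻ y, a y = ⊤
  · by_cases hb0 : ∫⁻ y, b y ^ r = 0
    · have h1 := (lintegral_eq_zero_iff (hb.pow_const r)).1 hb0
      have : ∀ x, ∫⁻ y, a (x - y) * b y = 0 := by
        intro x
        refine (lintegral_congr_ae (g := 0) ?_).trans lintegral_zero
        filter_upwards [h1] with y hy
        have : b y = 0 := by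
          have h2 : b y ^ r = 0 := hy
          rw [ENNReal.rpow_eq_zero_iff_of_pos (by linarith)] at h2; exact h2
        simp [this]
      simp [this, (by linarith : 0 < r)]
    · rw [ht, ENNReal.top_rpow_of_pos (by linarith), ENNReal.top_mul hb0]; exact le_top
  have hm : Measurable fun z : E3 × E3 => a (z.1 - z.2) * b z.2 ^ r :=
    (ha.comp (measurable_fst.sub measurable_snd)).mul ((hb.comp measurable_snd).pow_const r)
  calc ∫⁻ x, (∫⁻ y, a (x - y) * b y) ^ r
      ≤ ∫⁻ x, (∫⁻ y, a y) ^ (r - 1) * ∫⁻ y, a (x - y) * b y ^ r :=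
        lintegral_mono fun x => lintegral_conv_rpow_le_aux hr ha hb x
    _ = (∫⁻ y, a y) ^ (r - 1) * ∫⁻ x, ∫⁻ y, a (x - y) * b y ^ r :=
        lintegral_const_mul _ hm.lintegral_prod_right'
    _ = (∫⁻ y, a y) ^ (r - 1) * ∫⁻ y, ∫⁻ x, a (x - y) * b y ^ r := by
        rw [lintegral_lintegral_swap hm.aemeasurable]
    _ = (∫⁻ y, a y) ^ (r - 1) * ∫⁻ y, (∫⁻ x, a x) * b y ^ r := by
        congr 2; ext y
        have hay : Measurable fun x => a (x - y) := ha.comp (measurable_id.sub measurable_const)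
        rw [lintegral_mul_const _ hay,
          lintegral_sub_right_eq_self a]
    _ = _ := by
        rw [lintegral_const_mul _ (hb.pow_const r), ← mul_assoc]
        congr 1
        nth_rw 2 [← ENNReal.rpow_one (∫⁻ y, a y)]
        rw [← ENNReal.rpow_add _ _ h0 ht]; congr 1; ring

/-- Young's inequality, `L¹ * L^p → L^p`. -/
lemma eLpNorm_cv_le {p : ℝ≥0∞} (hp : 1 < p) (hp' : p ≠ ⊤) {k g : E3 → ℝ} (hk : Measurable k)
    (hg : AEStronglyMeasurable g volume) :
    eLpNorm (cv k g) p volume ≤ eLpNorm k 1 volume * eLpNorm g p volume := by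
  have hp0 : p ≠ 0 := (zero_lt_one.trans hp).ne'
  have hr : 1 < p.toReal := by
    rw [← ENNReal.toReal_one]; exact (ENNReal.toReal_lt_toReal (by simp) hp').2 hp
  have hr0 : 0 < p.toReal := by linarith
  obtain ⟨g', hg'm, hgg'⟩ := hg
  have e : cv k g = cv k g' := by
    ext x
    refine integral_congr_ae ?_
    filter_upwards [hgg'] with y hy
    rw [hy]
  rw [e, eLpNorm_congr_ae hgg', eLpNorm_eq_lintegral_rpow_enorm_toReal hp0 hp',
    eLpNorm_eq_lintegral_rpow_enorm_toReal hp0 hp', eLpNorm_one_eq_lintegral_enorm]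
  have h1 := lintegral_conv_rpow_le hr hk.enorm hg'm.measurable.enorm
  have h2 : ∫⁻ x, ‖cv k g' x‖ₑ ^ p.toReal
      ≤ (∫⁻ y, ‖k y‖ₑ) ^ p.toReal * ∫⁻ y, ‖g' y‖ₑ ^ p.toReal := by
    refine le_trans (lintegral_mono fun x => ?_) h1
    gcongr
    refine (enorm_integral_le_lintegral_enorm _).trans (le_of_eq ?_)
    simp [enorm_mul]
  calc _ ≤ ((∫⁻ y, ‖k y‖ₑ) ^ p.toReal * ∫⁻ y, ‖g' y‖ₑ ^ p.toReal) ^ (1 / p.toReal) := by gcongr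
    _ = _ := by
      rw [ENNReal.mul_rpow_of_nonneg _ _ (by positivity), ← ENNReal.rpow_mul,
        mul_one_div_cancel hr0.ne', ENNReal.rpow_one]

/-- Young's inequality, `L^p * L¹ → L^p`. -/
lemma eLpNorm_cv_le' {p : ℝ≥0∞} (hp : 1 < p) (hp' : p ≠ ⊤) {k g : E3 → ℝ} (hk : Measurable k)
    (hg : AEStronglyMeasurable g volume) :
    eLpNorm (cv k g) p volume ≤ eLpNorm k p volume * eLpNorm g 1 volume := by
  obtain ⟨g', hg'm, hgg'⟩ := hg
  have e : cv k g = cv k g' := by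
    ext x
    refine integral_congr_ae ?_
    filter_upwards [hgg'] with y hy
    rw [hy]
  rw [e, eLpNorm_congr_ae hgg', cv_comm, mul_comm]
  exact eLpNorm_cv_le hp hp' hg'm.measurable hk.aestronglyMeasurable

lemma continuous_cv {k g : E3 → ℝ} {M : ℝ} (hk : Continuous k) (hM : ∀ x, |k x| ≤ M)
    (hg : Integrable g volume) : Continuous (cv k g) := by
  refine continuous_of_dominated (bound := fun y => M * |g y|) (fun x => ?_) (fun x => ?_)
    (hg.abs.const_mul M) ?_
  · exact (hk.comp (continuous_const.sub continuous_id)).aestronglyMeasurable.mul hg.1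
  · refine .of_forall fun y => ?_
    rw [Real.norm_eq_abs, abs_mul]
    exact mul_le_mul_of_nonneg_right (hM _) (abs_nonneg _)
  · exact .of_forall fun y => (hk.comp (continuous_id.sub continuous_const)).mul continuous_const

lemma abs_cv_le {k g : E3 → ℝ} {M : ℝ} (hM : ∀ x, |k x| ≤ M)
    (hg : Integrable g volume) (x : E3) : |cv k g x| ≤ M * ∫ y, |g y| := by
  rw [← integral_const_mul, cv]
  refine (Real.norm_eq_abs _).symm.le.trans
    (norm_integral_le_of_norm_le (hg.abs.const_mul M) (.of_forall fun y => ?_))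
  rw [Real.norm_eq_abs, abs_mul]
  exact mul_le_mul_of_nonneg_right (hM _) (abs_nonneg _)

lemma memLp_top_cv {k g : E3 → ℝ} {M : ℝ} (hk : Continuous k) (hM : ∀ x, |k x| ≤ M)
    (hg : Integrable g volume) : MemLp (cv k g) ⊤ volume :=
  memLp_top_of_bound (continuous_cv hk hM hg).aestronglyMeasurable _
    (.of_forall fun x => abs_cv_le hM hg x)

lemma memLp_cv {p : ℝ≥0∞} (hp : 1 < p) (hp' : p ≠ ⊤) {k g : E3 → ℝ} {M : ℝ} (hk : Continuous k)
    (hM : ∀ x, |k x| ≤ M) (hkp : MemLp k p volume) (hg : Integrable g volume) :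
    MemLp (cv k g) p volume :=
  ⟨(continuous_cv hk hM hg).aestronglyMeasurable,
    (eLpNorm_cv_le' hp hp' hk.measurable hg.1).trans_lt
      (ENNReal.mul_lt_top hkp.2 (memLp_one_iff_integrable.2 hg).2)⟩

/-! ### Weak derivatives of convolutions -/

/-- A classical directional derivative is a weak one. -/
lemma isWeakPartial_of_hasLineDerivAt {j : Fin 3} {k k' : E3 → ℝ} (hk : Continuous k)
    (hk' : Continuous k') (hd : ∀ x, HasLineDerivAt ℝ k (k' x) x (basisVec j)) :
    IsWeakPartial j k k' := by
  refine ⟨hk.locallyIntegrable, hk'.locallyIntegrable, fun φ hφ hc => ?_⟩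
  have hc' : HasCompactSupport (fun x => fderiv ℝ φ x (basisVec j)) :=
    (hc.fderiv (𝕜 := ℝ)).comp_left (g := fun A : E3 →L[ℝ] ℝ => A (basisVec j)) rfl
  have h := integral_bilinear_hasLineDerivAt_right_eq_neg_left_of_integrable
    (μ := (volume : Measure E3))
    (f := φ) (f' := fun x => fderiv ℝ φ x (basisVec j)) (g := k) (g' := k') (v := basisVec j)
    (B := ContinuousLinearMap.mul ℝ ℝ)
    (((hφ.fderiv_apply_continuous _).mul hk).integrable_of_hasCompactSupport hc'.mul_right)
    ((hφ.continuous.mul hk').integrable_of_hasCompactSupport hc.mul_right)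
    ((hφ.continuous.mul hk).integrable_of_hasCompactSupport hc.mul_right)
    (fun x _ => ((hφ.differentiable (by simp)) x).hasFDerivAt.hasLineDerivAt _)
    (fun x _ => hd x)
  simp only [ContinuousLinearMap.mul_apply'] at h
  linarith

lemma IsWeakPartial.comp_sub_right {j : Fin 3} {k k' : E3 → ℝ} (h : IsWeakPartial j k k')
    (hk : Continuous k) (hk' : Continuous k') (y : E3) :
    IsWeakPartial j (fun x => k (x - y)) (fun x => k' (x - y)) := by
  refine ⟨(hk.comp (continuous_id.sub continuous_const)).locallyIntegrable,
    (hk'.comp (continuous_id.sub continuous_const)).locallyIntegrable, fun φ hφ hc => ?_⟩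
  have h1 := h.2.2 (fun x => φ (x + y)) (hφ.comp (contDiff_id.add contDiff_const))
    (hc.comp_homeomorph (Homeomorph.addRight y))
  rw [← integral_sub_right_eq_self _ y, ← integral_sub_right_eq_self (fun x => φ (x + y) * k' x) y]
    at h1
  simpa [fderiv_comp_add_right] using h1

/-- Differentiating a convolution through its kernel. -/
lemma isWeakPartial_cv {j : Fin 3} {k k' g : E3 → ℝ} {M M' : ℝ} (h : IsWeakPartial j k k')
    (hk : Continuous k) (hk' : Continuous k') (hM : ∀ x, |k x| ≤ M) (hM' : ∀ x, |k' x| ≤ M')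
    (hg : Integrable g volume) : IsWeakPartial j (cv k g) (cv k' g) := by
  refine ⟨(continuous_cv hk hM hg).locallyIntegrable, (continuous_cv hk' hM' hg).locallyIntegrable,
    fun φ hφ hc => ?_⟩
  have hc' : HasCompactSupport (fun x => fderiv ℝ φ x (basisVec j)) :=
    (hc.fderiv (𝕜 := ℝ)).comp_left (g := fun A : E3 →L[ℝ] ℝ => A (basisVec j)) rfl
  have swap : ∀ {ψ κ : E3 → ℝ} {c : ℝ}, Continuous ψ → HasCompactSupport ψ → Continuous κ →
      (∀ x, |κ x| ≤ c) → ∫ x, ψ x * cv κ g x = ∫ y, (∫ x, ψ x * κ (x - y)) * g y := by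
    intro ψ κ c h1 h2 h3 h4
    have hi : Integrable (fun z : E3 × E3 => ψ z.1 * (κ (z.1 - z.2) * g z.2))
        (volume.prod volume) := by
      have h5 := ((h1.integrable_of_hasCompactSupport (μ := volume) h2).mul_prod hg).bdd_mul (c := c)
        (f := fun z : E3 × E3 => κ (z.1 - z.2))
        (h3.comp (continuous_fst.sub continuous_snd)).aestronglyMeasurable
        (.of_forall fun z => h4 _)
      refine h5.congr (.of_forall fun z => ?_)
      simp only; ring
    have h6 := integral_integral_swap (f := fun x y => ψ x * (κ (x - y) * g y)) hi
    simp only [cv, ← integral_const_mul, h6, ← integral_mul_const, mul_assoc]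
  rw [swap (hφ.fderiv_apply_continuous _) hc' hk hM, swap hφ.continuous hc hk' hM', ← integral_neg]
  congr 1; ext y
  rw [(h.comp_sub_right hk hk' y).2.2 φ hφ hc]; ring

/-- Moving a weak derivative from one factor of a convolution to the other. -/
lemma cv_partial {j : Fin 3} {k k' g g' : E3 → ℝ} {M M' : ℝ} (h : IsWeakPartial j k k')
    (hk : Continuous k) (hk' : Continuous k') (hM : ∀ x, |k x| ≤ M) (hM' : ∀ x, |k' x| ≤ M')
    (hgg : IsWeakPartial j g g') (x : E3)
    (h0 : Integrable (fun y => k (x - y) * g y) volume ∨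
      MemLp (fun y => k (x - y) * g y) (3 / 2) volume)
    (h1 : Integrable (fun y => k' (x - y) * g y) volume)
    (h2 : Integrable (fun y => k (x - y) * g' y) volume) : cv k' g x = cv k g' x := by
  -- For fixed x the reflected kernel y ↦ k(x − y) is a bounded factor with bounded weak derivative.
  -- The claim says that the derivative of k(x − ·) g has integral zero; the two alternatives in
  -- `h0` are the two decay classes for which this is known.
  have hneg : IsWeakPartial j (fun y => k (x - y)) (fun y => - k' (x - y)) := by
    refine ⟨(hk.comp (continuous_const.sub continuous_id)).locallyIntegrable,
      (hk'.comp (continuous_const.sub continuous_id)).neg.locallyIntegrable, fun φ hφ hc => ?_⟩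
    have h1 := h.2.2 (fun y => φ (x - y)) (hφ.comp (contDiff_const.sub contDiff_id))
      (hc.comp_homeomorph (Homeomorph.subLeft x))
    have hd : ∀ y, fderiv ℝ (fun y => φ (x - y)) y (basisVec j)
        = - fderiv ℝ φ (x - y) (basisVec j) := by
      intro y
      have : HasFDerivAt (fun y => φ (x - y))
          ((fderiv ℝ φ (x - y)).comp (-ContinuousLinearMap.id ℝ E3)) y :=
        ((hφ.differentiable (by simp)) (x - y)).hasFDerivAt.comp y
          ((hasFDerivAt_id y).const_sub x)
      rw [this.fderiv]; simp
    simp only [hd] at h1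
    rw [← integral_sub_left_eq_self _ volume x,
      ← integral_sub_left_eq_self (fun y => φ (x - y) * k' y) volume x] at h1
    simp only [sub_sub_cancel, neg_mul, integral_neg] at h1
    simp only [mul_neg, integral_neg]
    linarith
  have hb : MemLp (fun y => k (x - y)) ⊤ volume :=
    memLp_top_of_bound (hk.comp (continuous_const.sub continuous_id)).aestronglyMeasurable M
      (.of_forall fun y => hM _)
  have hb' : MemLp (fun y => -k' (x - y)) ⊤ volume :=
    memLp_top_of_bound (hk'.comp (continuous_const.sub continuous_id)).neg.aestronglyMeasurable M'
      (.of_forall fun y => by rw [norm_neg]; exact hM' _)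
  have hp := hgg.mul_of_lipschitz hneg hb hb'
  have e : (fun y => g' y * k (x - y) + g y * -k' (x - y))
      = fun y => k (x - y) * g' y - k' (x - y) * g y := by ext y; ring
  have e' : (fun y => g y * k (x - y)) = fun y => k (x - y) * g y := by ext y; ring
  rw [e, e'] at hp
  have hz : ∫ y, (k (x - y) * g' y - k' (x - y) * g y) = 0 := by
    rcases h0 with h0 | h0
    · exact hp.integral_eq_zero h0 (h2.sub h1)
    · exact hp.integral_eq_zero' h0 (h2.sub h1)
  rw [integral_sub h2 h1] at hz
  simp only [cv]; linarith


/-! ### The regularised Newtonian kernel -/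

/-- The regularised square of the distance to the origin. -/
noncomputable def bq (ε : ℝ) (x : E3) : ℝ := ‖x‖ ^ 2 + ε ^ 2

/-- Kronecker's delta. -/
noncomputable def kron (i j : Fin 3) : ℝ := if i = j then 1 else 0

/-- The regularised Newtonian potential (up to normalisation). -/
noncomputable def ker0 (ε : ℝ) (x : E3) : ℝ := - bq ε x ^ (-(1 / 2) : ℝ)

/-- First derivatives of the regularised Newtonian potential. -/
noncomputable def ker1 (ε : ℝ) (i : Fin 3) (x : E3) : ℝ := x i * bq ε x ^ (-(3 / 2) : ℝ)

/-- Second derivatives of the regularised Newtonian potential. -/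
noncomputable def ker2 (ε : ℝ) (i j : Fin 3) (x : E3) : ℝ :=
  kron i j * bq ε x ^ (-(3 / 2) : ℝ) - 3 * (x i * (x j * bq ε x ^ (-(5 / 2) : ℝ)))

/-- Third derivatives of the regularised Newtonian potential. -/
noncomputable def ker3 (ε : ℝ) (i j k : Fin 3) (x : E3) : ℝ :=
  - 3 * (kron i j * (x k * bq ε x ^ (-(5 / 2) : ℝ)) + kron k i * (x j * bq ε x ^ (-(5 / 2) : ℝ))
    + kron k j * (x i * bq ε x ^ (-(5 / 2) : ℝ)))
    + 15 * (x i * (x j * (x k * bq ε x ^ (-(7 / 2) : ℝ))))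

/-- The Laplacian of the regularised Newtonian potential. -/
noncomputable def eta (ε : ℝ) (x : E3) : ℝ := 3 * ε ^ 2 * bq ε x ^ (-(5 / 2) : ℝ)

lemma bq_pos {ε : ℝ} (hε : 0 < ε) (x : E3) : 0 < bq ε x := by unfold bq; positivity

lemma continuous_bq_rpow {ε : ℝ} (hε : 0 < ε) (s : ℝ) : Continuous (fun x => bq ε x ^ s) := by
  refine Continuous.rpow_const (by unfold bq; fun_prop) fun x => .inl (bq_pos hε x).ne'

lemma continuous_ker0 {ε : ℝ} (hε : 0 < ε) : Continuous (ker0 ε) := (continuous_bq_rpow hε _).neg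

lemma continuous_ker1 {ε : ℝ} (hε : 0 < ε) (i : Fin 3) : Continuous (ker1 ε i) := by
  have := continuous_bq_rpow hε (-(3 / 2)); unfold ker1; fun_prop

lemma continuous_ker2 {ε : ℝ} (hε : 0 < ε) (i j : Fin 3) : Continuous (ker2 ε i j) := by
  have := continuous_bq_rpow hε (-(3 / 2)); have := continuous_bq_rpow hε (-(5 / 2))
  unfold ker2; fun_prop

lemma continuous_ker3 {ε : ℝ} (hε : 0 < ε) (i j k : Fin 3) : Continuous (ker3 ε i j k) := by
  have := continuous_bq_rpow hε (-(7 / 2)); have := continuous_bq_rpow hε (-(5 / 2))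
  unfold ker3; fun_prop

lemma continuous_eta {ε : ℝ} (hε : 0 < ε) : Continuous (eta ε) := by
  have := continuous_bq_rpow hε (-(5 / 2)); unfold eta; fun_prop

lemma hasLineDerivAt_coord (i j : Fin 3) (x : E3) :
    HasLineDerivAt ℝ (fun y : E3 => y i) (kron i j) x (basisVec j) := by
  have h := ((EuclideanSpace.proj i : E3 →L[ℝ] ℝ).hasFDerivAt (x := x)).hasLineDerivAt
    (basisVec j)
  simpa [kron, Pi.single_apply] using h

lemma hasLineDerivAt_bq_rpow {ε : ℝ} (hε : 0 < ε) (s : ℝ) (j : Fin 3) (x : E3) :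
    HasLineDerivAt ℝ (fun y => bq ε y ^ s) (2 * s * (x j * bq ε x ^ (s - 1))) x (basisVec j) := by
  have h1 : HasFDerivAt (fun y : E3 => bq ε y) (2 • (innerSL ℝ x)) x :=
    (hasStrictFDerivAt_norm_sq x).hasFDerivAt.add_const _
  have h2 := (h1.rpow_const (p := s) (.inl (bq_pos hε x).ne')).hasLineDerivAt (basisVec j)
  have h3 : inner ℝ x (basisVec j) = x j := by
    simp [basisVec, EuclideanSpace.inner_single_right]
  have h4 : 2 * s * (x j * bq ε x ^ (s - 1))
      = ((s * bq ε x ^ (s - 1)) • 2 • innerSL ℝ x) (basisVec j) := by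
    simp only [_root_.smul_apply, innerSL_apply_apply, h3, smul_eq_mul, nsmul_eq_mul]
    push_cast; ring
  rw [h4]; exact h2

lemma hasLineDerivAt_mul {f g : E3 → ℝ} {f' g' : ℝ} {x v : E3} (hf : HasLineDerivAt ℝ f f' x v)
    (hg : HasLineDerivAt ℝ g g' x v) :
    HasLineDerivAt ℝ (fun y => f y * g y) (f' * g x + f x * g') x v := by
  have := HasDerivAt.mul hf hg
  simp only [zero_smul, add_zero] at this
  exact this

lemma hasLineDerivAt_ker0 {ε : ℝ} (hε : 0 < ε) (i : Fin 3) (x : E3) :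
    HasLineDerivAt ℝ (ker0 ε) (ker1 ε i x) x (basisVec i) := by
  have h : HasLineDerivAt ℝ (ker0 ε) (-_) x (basisVec i) :=
    HasDerivAt.neg (hasLineDerivAt_bq_rpow hε (-(1 / 2)) i x)
  convert h using 1
  simp only [ker1]; norm_num

lemma hasLineDerivAt_ker1 {ε : ℝ} (hε : 0 < ε) (i j : Fin 3) (x : E3) :
    HasLineDerivAt ℝ (ker1 ε i) (ker2 ε i j x) x (basisVec j) := by
  have : HasLineDerivAt ℝ (ker1 ε i) _ x (basisVec j) :=
    hasLineDerivAt_mul (hasLineDerivAt_coord i j x) (hasLineDerivAt_bq_rpow hε (-(3 / 2)) j x)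
  convert this using 1
  simp only [ker2]
  rw [show (-(3 / 2) - 1 : ℝ) = -(5 / 2) by norm_num]; ring

lemma hasLineDerivAt_ker2 {ε : ℝ} (hε : 0 < ε) (i j k : Fin 3) (x : E3) :
    HasLineDerivAt ℝ (ker2 ε i j) (ker3 ε i j k x) x (basisVec k) := by
  have h1 := HasDerivAt.const_mul (kron i j) (hasLineDerivAt_bq_rpow hε (-(3 / 2)) k x)
  have h2 := HasDerivAt.const_mul 3 (hasLineDerivAt_mul (hasLineDerivAt_coord i k x)
    (hasLineDerivAt_mul (hasLineDerivAt_coord j k x) (hasLineDerivAt_bq_rpow hε (-(5 / 2)) k x)))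
  have : HasLineDerivAt ℝ (ker2 ε i j) (_ - _) x (basisVec k) := HasDerivAt.sub h1 h2
  convert this using 1
  have e : ∀ a b : Fin 3, kron a b = kron b a := fun a b => by simp [kron, eq_comm]
  simp only [ker3]
  rw [e k i, e k j, show (-(3 / 2) - 1 : ℝ) = -(5 / 2) by norm_num,
    show (-(5 / 2) - 1 : ℝ) = -(7 / 2) by norm_num]
  ring

lemma isWeakPartial_ker0 {ε : ℝ} (hε : 0 < ε) (i : Fin 3) : IsWeakPartial i (ker0 ε) (ker1 ε i) :=
  isWeakPartial_of_hasLineDerivAt (continuous_ker0 hε) (continuous_ker1 hε i)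
    (hasLineDerivAt_ker0 hε i)

lemma isWeakPartial_ker1 {ε : ℝ} (hε : 0 < ε) (i j : Fin 3) : IsWeakPartial j (ker1 ε i) (ker2 ε i j) :=
  isWeakPartial_of_hasLineDerivAt (continuous_ker1 hε i) (continuous_ker2 hε i j)
    (hasLineDerivAt_ker1 hε i j)

lemma isWeakPartial_ker2 {ε : ℝ} (hε : 0 < ε) (i j k : Fin 3) : IsWeakPartial k (ker2 ε i j) (ker3 ε i j k) :=
  isWeakPartial_of_hasLineDerivAt (continuous_ker2 hε i j) (continuous_ker3 hε i j k)
    (hasLineDerivAt_ker2 hε i j k)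

lemma ker2_comm {ε : ℝ} (i j : Fin 3) : ker2 ε i j = ker2 ε j i := by
  ext x
  simp only [ker2, kron, eq_comm (a := i) (b := j)]; ring

lemma ker3_comm {ε : ℝ} (i j k : Fin 3) : ker3 ε i j k = ker3 ε k j i := by
  ext x
  simp only [ker3, kron, eq_comm (a := k) (b := i), eq_comm (a := k) (b := j)]; ring

/-- The trace leaves 3(|x|²+ε²) − 3|x|² = 3ε². Hence the Laplacian of the regularised potential is a
positive bump concentrating at the origin, and convolution with it is an approximate identity up to
a fixed factor. -/
lemma sum_ker2 {ε : ℝ} (hε : 0 < ε) (x : E3) : ∑ i, ker2 ε i i x = eta ε x := by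
  have h0 := bq_pos hε x
  have e : bq ε x ^ (-(3 / 2) : ℝ) = bq ε x * bq ε x ^ (-(5 / 2) : ℝ) := by
    nth_rw 2 [← Real.rpow_one (bq ε x)]
    rw [← Real.rpow_add h0]; norm_num
  have hn : ‖x‖ ^ 2 = x 0 ^ 2 + x 1 ^ 2 + x 2 ^ 2 := by
    rw [EuclideanSpace.real_norm_sq_eq, Fin.sum_univ_three]
  simp only [ker2, kron, eta, Fin.sum_univ_three, e]
  simp only [if_true]
  have : bq ε x = x 0 ^ 2 + x 1 ^ 2 + x 2 ^ 2 + ε ^ 2 := by rw [bq, hn]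
  generalize bq ε x ^ (-(5 / 2) : ℝ) = A
  rw [this]; ring

/-! ### Size and integrability of the kernels -/

/-- Since |xᵢ| ≤ (|x|²+ε²)^{1/2}, each coordinate in a numerator costs half a power. Iterating this
gives the decay |x|⁻², |x|⁻³, |x|⁻⁴ of the first, second and third derivatives. -/
lemma abs_coord_mul_le {ε : ℝ} (hε : 0 < ε) (i : Fin 3) (x : E3) (s : ℝ) :
    |x i| * bq ε x ^ s ≤ bq ε x ^ (s + 1 / 2) := by
  have h0 := bq_pos hε x
  rw [Real.rpow_add h0, mul_comm]
  gcongr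
  rw [← Real.sqrt_eq_rpow]
  refine Real.le_sqrt_of_sq_le ?_
  rw [sq_abs, bq]
  have : x i ^ 2 ≤ ‖x‖ ^ 2 := by
    rw [← sq_abs]; gcongr; exact PiLp.norm_apply_le x i
  nlinarith [sq_nonneg ε]

lemma abs_kron_le (i j : Fin 3) : |kron i j| ≤ 1 := by
  unfold kron; split_ifs <;> simp

lemma abs_ker0_le {ε : ℝ} (hε : 0 < ε) (x : E3) : |ker0 ε x| ≤ bq ε x ^ (-(1 / 2) : ℝ) := by
  rw [ker0, abs_neg, abs_of_pos (Real.rpow_pos_of_pos (bq_pos hε x) _)]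

lemma abs_ker1_le {ε : ℝ} (hε : 0 < ε) (i : Fin 3) (x : E3) : |ker1 ε i x| ≤ bq ε x ^ (-1 : ℝ) := by
  rw [ker1, abs_mul, abs_of_pos (Real.rpow_pos_of_pos (bq_pos hε x) _)]
  refine (abs_coord_mul_le hε i x _).trans_eq ?_
  norm_num

lemma abs_ker2_le {ε : ℝ} (hε : 0 < ε) (i j : Fin 3) (x : E3) : |ker2 ε i j x| ≤ 4 * bq ε x ^ (-(3 / 2) : ℝ) := by
  have hp : ∀ s : ℝ, 0 < bq ε x ^ s := fun s => Real.rpow_pos_of_pos (bq_pos hε x) _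
  have h1 : |kron i j * bq ε x ^ (-(3 / 2) : ℝ)| ≤ bq ε x ^ (-(3 / 2) : ℝ) := by
    rw [abs_mul, abs_of_pos (hp _)]
    exact mul_le_of_le_one_left (hp _).le (abs_kron_le i j)
  have h2 : |x i * (x j * bq ε x ^ (-(5 / 2) : ℝ))| ≤ bq ε x ^ (-(3 / 2) : ℝ) := by
    rw [abs_mul, abs_mul, abs_of_pos (hp _)]
    calc _ ≤ |x i| * bq ε x ^ (-(5 / 2) + 1 / 2 : ℝ) := by
          gcongr; exact abs_coord_mul_le hε j x _
      _ ≤ _ := (abs_coord_mul_le hε i x _).trans_eq (by norm_num)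
  rw [ker2]
  refine (abs_sub _ _).trans ?_
  rw [abs_mul 3, abs_of_pos (by norm_num : (0:ℝ) < 3)]
  linarith

lemma abs_ker3_le {ε : ℝ} (hε : 0 < ε) (i j k : Fin 3) (x : E3) : |ker3 ε i j k x| ≤ 24 * bq ε x ^ (-2 : ℝ) := by
  have hp : ∀ s : ℝ, 0 < bq ε x ^ s := fun s => Real.rpow_pos_of_pos (bq_pos hε x) _
  have h1 : ∀ a b c : Fin 3, |kron a b * (x c * bq ε x ^ (-(5 / 2) : ℝ))| ≤ bq ε x ^ (-2 : ℝ) := by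
    intro a b c
    rw [abs_mul, abs_mul, abs_of_pos (hp _)]
    calc _ ≤ 1 * (|x c| * bq ε x ^ (-(5 / 2) : ℝ)) :=
          mul_le_mul_of_nonneg_right (abs_kron_le a b) (mul_nonneg (abs_nonneg _) (hp _).le)
      _ ≤ _ := by rw [one_mul]; exact (abs_coord_mul_le hε c x _).trans_eq (by norm_num)
  have h2 : |x i * (x j * (x k * bq ε x ^ (-(7 / 2) : ℝ)))| ≤ bq ε x ^ (-2 : ℝ) := by
    rw [abs_mul, abs_mul, abs_mul, abs_of_pos (hp _)]
    calc _ ≤ |x i| * (|x j| * bq ε x ^ (-(7 / 2) + 1 / 2 : ℝ)) := by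
          gcongr; exact abs_coord_mul_le hε k x _
      _ ≤ |x i| * bq ε x ^ (-(7 / 2) + 1 / 2 + 1 / 2 : ℝ) := by
          gcongr; exact abs_coord_mul_le hε j x _
      _ ≤ _ := (abs_coord_mul_le hε i x _).trans_eq (by norm_num)
  have a1 := abs_le.1 (h1 i j k)
  have a2 := abs_le.1 (h1 k i j)
  have a3 := abs_le.1 (h1 k j i)
  have a4 := abs_le.1 h2
  rw [ker3, abs_le]; constructor <;> linarith [a1.1, a1.2, a2.1, a2.2, a3.1, a3.2, a4.1, a4.2]

/-- For fixed ε the kernels are bounded because |x|²+ε² ≥ ε². These bounds blow up as ε → 0 and only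
serve to justify manipulations at fixed ε. -/
lemma bq_rpow_le {ε : ℝ} (hε : 0 < ε) {s : ℝ} (hs : 0 ≤ s) (x : E3) : bq ε x ^ (-s) ≤ (ε ^ 2) ^ (-s) := by
  refine Real.rpow_le_rpow_of_nonpos (by positivity) ?_ (by linarith)
  unfold bq; nlinarith [sq_nonneg ‖x‖]

lemma abs_ker0_le' {ε : ℝ} (hε : 0 < ε) (x : E3) : |ker0 ε x| ≤ (ε ^ 2) ^ (-(1 / 2) : ℝ) := by
  exact (abs_ker0_le hε x).trans (bq_rpow_le hε (by norm_num) x)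

lemma abs_ker1_le' {ε : ℝ} (hε : 0 < ε) (i : Fin 3) (x : E3) : |ker1 ε i x| ≤ (ε ^ 2) ^ (-1 : ℝ) :=
  (abs_ker1_le hε i x).trans (bq_rpow_le hε (by norm_num) x)

lemma abs_ker2_le' {ε : ℝ} (hε : 0 < ε) (i j : Fin 3) (x : E3) : |ker2 ε i j x| ≤ 4 * (ε ^ 2) ^ (-(3 / 2) : ℝ) := by
  exact (abs_ker2_le hε i j x).trans
    (mul_le_mul_of_nonneg_left (bq_rpow_le hε (by norm_num) x) (by norm_num))

lemma abs_ker3_le' {ε : ℝ} (hε : 0 < ε) (i j k : Fin 3) (x : E3) : |ker3 ε i j k x| ≤ 24 * (ε ^ 2) ^ (-2 : ℝ) := by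
  exact (abs_ker3_le hε i j k x).trans
    (mul_le_mul_of_nonneg_left (bq_rpow_le hε (by norm_num) x) (by norm_num))

/-- Integrability of negative powers of the regularised distance. -/
lemma memLp_bq_rpow {ε : ℝ} (hε : 0 < ε) (h1 : ε ≤ 1) {s : ℝ} (hs : 0 < s) {p : ℝ≥0∞} (hp0 : p ≠ 0) (hp : p ≠ ⊤)
    (hsp : 3 < 2 * s * p.toReal) : MemLp (fun x => bq ε x ^ (-s)) p volume := by
  have hpp := ENNReal.toReal_pos hp0 hp
  have hc : Continuous fun x : E3 => (1 + ‖x‖ ^ 2) ^ (-s) :=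
    Continuous.rpow_const (by fun_prop) fun x => .inl (by positivity)
  have hm : MemLp (fun x : E3 => (1 + ‖x‖ ^ 2) ^ (-s)) p volume := by
    rw [← integrable_norm_rpow_iff hc.aestronglyMeasurable hp0 hp]
    have := integrable_rpow_neg_one_add_norm_sq (E := E3) (μ := volume) (r := 2 * s * p.toReal)
      (by simpa using hsp)
    refine this.congr (.of_forall fun x => ?_)
    simp only
    rw [Real.norm_of_nonneg (by positivity), ← Real.rpow_mul (by positivity)]
    congr 1; ring
  refine (hm.const_mul ((ε ^ 2) ^ (-s))).mono' (continuous_bq_rpow hε _).aestronglyMeasurable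
    (.of_forall fun x => ?_)
  rw [Real.norm_of_nonneg (Real.rpow_pos_of_pos (bq_pos hε x) _).le,
    ← Real.mul_rpow (by positivity) (by positivity)]
  -- As ε ≤ 1, one has |x|²+ε² ≥ ε²(1+|x|²), which reduces the claim to the weight 1+|x|².
  refine Real.rpow_le_rpow_of_nonpos (by positivity) ?_ (by linarith)
  unfold bq
  nlinarith [sq_nonneg ‖x‖, mul_nonneg (sq_nonneg ‖x‖) (by nlinarith : 0 ≤ 1 - ε ^ 2)]

/-- In dimension three the decay |x|⁻¹, |x|⁻², |x|⁻³ of the potential, its gradient and its Hessian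
gives the thresholds p > 3, p > 3/2, p > 1. The Hessian just fails to be integrable, so it is paired
through the exponents 2 and 6/5; third derivatives decay like |x|⁻⁴ and are integrable. -/
lemma memLp_ker0 {ε : ℝ} (hε : 0 < ε) (h1 : ε ≤ 1) {p : ℝ≥0∞} (hp : p ≠ ⊤) (hp3 : 3 < p.toReal) :
    MemLp (ker0 ε) p volume := by
  have hp0 : p ≠ 0 := by rintro rfl; norm_num at hp3
  have h := memLp_bq_rpow hε h1 (s := 1 / 2) (by norm_num) hp0 hp (by linarith)
  exact h.mono' (continuous_ker0 hε).aestronglyMeasurable (.of_forall fun x => abs_ker0_le hε x)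

lemma memLp_ker1 {ε : ℝ} (hε : 0 < ε) (h1 : ε ≤ 1) {p : ℝ≥0∞} (hp : p ≠ ⊤) (hp3 : 3 < 2 * p.toReal) (i : Fin 3) :
    MemLp (ker1 ε i) p volume := by
  have hp0 : p ≠ 0 := by rintro rfl; norm_num at hp3
  have h := memLp_bq_rpow hε h1 (s := 1) (by norm_num) hp0 hp (by linarith)
  exact h.mono' (continuous_ker1 hε i).aestronglyMeasurable (.of_forall fun x => abs_ker1_le hε i x)

lemma memLp_ker2 {ε : ℝ} (hε : 0 < ε) (h1 : ε ≤ 1) {p : ℝ≥0∞} (hp : p ≠ ⊤) (hp3 : 1 < p.toReal) (i j : Fin 3) :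
    MemLp (ker2 ε i j) p volume := by
  have hp0 : p ≠ 0 := by rintro rfl; norm_num at hp3
  have h := (memLp_bq_rpow hε h1 (s := 3 / 2) (by norm_num) hp0 hp (by linarith)).const_mul 4
  exact h.mono' (continuous_ker2 hε i j).aestronglyMeasurable
    (.of_forall fun x => abs_ker2_le hε i j x)

lemma memLp_ker3 {ε : ℝ} (hε : 0 < ε) (h1 : ε ≤ 1) {p : ℝ≥0∞} (hp : p ≠ ⊤) (hp3 : 1 ≤ p.toReal) (i j k : Fin 3) :
    MemLp (ker3 ε i j k) p volume := by
  have hp0 : p ≠ 0 := by rintro rfl; norm_num at hp3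
  have h := (memLp_bq_rpow hε h1 (s := 2) (by norm_num) hp0 hp (by linarith)).const_mul 24
  exact h.mono' (continuous_ker3 hε i j k).aestronglyMeasurable
    (.of_forall fun x => abs_ker3_le hε i j k x)

lemma eta_pos {ε : ℝ} (hε : 0 < ε) (x : E3) : 0 < eta ε x := by
  have := Real.rpow_pos_of_pos (bq_pos hε x) (-(5 / 2)); unfold eta; positivity

lemma integrable_eta {ε : ℝ} (hε : 0 < ε) (h1 : ε ≤ 1) : Integrable (eta ε) volume := by
  have h := memLp_bq_rpow hε h1 (s := 5 / 2) (p := 1) (by norm_num) (by simp) (by simp) (by norm_num)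
  have := (memLp_one_iff_integrable.1 h).const_mul (3 * ε ^ 2)
  refine this.congr (.of_forall fun x => ?_)
  simp only [eta]

/-- `eta ε` is the mass-preserving dilation of `eta 1`. This makes its mass independent of ε and
makes convolution with it an average of small translations. -/
lemma eta_scale {ε : ℝ} (hε : 0 < ε) (x : E3) : eta ε (ε • x) = (ε ^ 3)⁻¹ * eta 1 x := by
  have e : bq ε (ε • x) = ε ^ 2 * bq 1 x := by
    simp only [bq, norm_smul, Real.norm_of_nonneg hε.le]; ring
  have hp := bq_pos one_pos x
  simp only [eta, e]
  rw [Real.mul_rpow (by positivity) hp.le]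
  have : (ε ^ 2) ^ (-(5 / 2) : ℝ) = (ε ^ 5)⁻¹ := by
    rw [← Real.rpow_natCast, ← Real.rpow_mul hε.le, ← Real.rpow_natCast, ← Real.rpow_neg hε.le]
    norm_num
  rw [this]; field_simp

/-- The mass of `eta ε`, which does not depend on `ε`. -/
noncomputable def etaMass : ℝ := ∫ x, eta 1 x

lemma etaMass_pos : 0 < etaMass := by
  rw [etaMass, integral_pos_iff_support_of_nonneg (fun x => (eta_pos one_pos x).le)
    (integrable_eta one_pos le_rfl)]
  have : Function.support (eta 1) = univ := by
    ext x; simp [(eta_pos one_pos x).ne']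
  simp [this]

/-- Rescaling in the convolution with `eta ε`. -/
lemma cv_eta {ε : ℝ} (hε : 0 < ε) (f : E3 → ℝ) (x : E3) :
    cv (eta ε) f x = ∫ z, eta 1 z * f (x - ε • z) := by
  rw [cv, ← integral_sub_left_eq_self _ volume x]
  simp only [sub_sub_cancel]
  have h := Measure.integral_comp_smul (volume : Measure E3) (fun y => eta ε y * f (x - y)) ε
  simp only [finrank_euclideanSpace, Fintype.card_fin, smul_eq_mul] at h
  have h3 : 0 < ε ^ 3 := by positivity
  rw [abs_of_pos (by positivity)] at h
  have h2 : ∫ y, eta ε y * f (x - y) = ε ^ 3 * ∫ y, eta ε (ε • y) * f (x - ε • y) := by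
    rw [h]; field_simp
  rw [h2, ← integral_const_mul]
  congr 1; ext z
  rw [eta_scale hε]; field_simp

lemma integral_eta {ε : ℝ} (hε : 0 < ε) : ∫ x, eta ε x = etaMass := by
  have := cv_eta hε (fun _ => 1) 0
  simp only [cv, mul_one, zero_sub] at this
  rw [integral_neg_eq_self (fun y => eta ε y) volume] at this
  exact this

lemma eLpNorm_eta {ε : ℝ} (hε : 0 < ε) (h1 : ε ≤ 1) :
    eLpNorm (eta ε) 1 volume = ENNReal.ofReal etaMass := by
  rw [eLpNorm_one_eq_lintegral_enorm, ← integral_eta hε,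
    ofReal_integral_eq_lintegral_ofReal (integrable_eta hε h1)
      (.of_forall fun x => (eta_pos hε x).le)]
  congr 1; ext x
  rw [Real.enorm_eq_ofReal (eta_pos hε x).le]


/-! ### Approximation of the identity -/

lemma enorm_integral_mul_le {p q : ℝ≥0∞} [ENNReal.HolderTriple p q 1] {α : Type*}
    {m : MeasurableSpace α} {μ : Measure α} {f g : α → ℝ}
    (hf : AEStronglyMeasurable f μ) (hg : AEStronglyMeasurable g μ) :
    ‖∫ x, f x * g x ∂μ‖ₑ ≤ eLpNorm f p μ * eLpNorm g q μ := by
  refine (enorm_integral_le_lintegral_enorm _).trans ?_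
  have := eLpNorm_smul_le_mul_eLpNorm (p := p) (q := q) (r := 1) hg hf
  rwa [eLpNorm_one_eq_lintegral_enorm] at this

lemma lintegral_mul_le {p q : ℝ≥0∞} [ENNReal.HolderTriple p q 1] {α : Type*}
    {m : MeasurableSpace α} {μ : Measure α} {f g : α → ℝ}
    (hf : AEStronglyMeasurable f μ) (hg : AEStronglyMeasurable g μ) :
    ∫⁻ x, ‖f x * g x‖ₑ ∂μ ≤ eLpNorm f p μ * eLpNorm g q μ := by
  have := eLpNorm_smul_le_mul_eLpNorm (p := p) (q := q) (r := 1) hg hf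
  rwa [eLpNorm_one_eq_lintegral_enorm] at this

lemma eLpNorm_comp_sub_right (f : E3 → ℝ) (p : ℝ≥0∞) (hf : AEStronglyMeasurable f volume)
    (h : E3) : eLpNorm (fun x => f (x - h)) p volume = eLpNorm f p volume :=
  eLpNorm_comp_measurePreserving hf (measurePreserving_sub_right volume h)

/-- Continuity of translations in `L^p`. -/
lemma tendsto_eLpNorm_translate {p : ℝ≥0∞} (hp1 : 1 ≤ p) (hp : p ≠ ⊤) {f : E3 → ℝ}
    (hf : MemLp f p volume) :
    Tendsto (fun h : E3 => eLpNorm (fun x => f (x - h) - f x) p volume) (𝓝 0) (𝓝 0) := by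
  have : Fact (1 ≤ p) := ⟨hp1⟩
  let g : C(E3, C(E3, E3)) :=
    (ContinuousMap.mk (fun a : E3 × E3 => a.2 - a.1) (by fun_prop)).curry
  have hgm : ∀ h, MeasurePreserving (g h) volume volume := fun h =>
    measurePreserving_sub_right volume h
  have hc := (continuous_const (y := hf.toLp f)).compMeasurePreservingLp
    g.continuous hgm hp
  have ht := (hc.tendsto 0)
  rw [tendsto_iff_edist_tendsto_0] at ht
  refine ht.congr fun h => ?_
  rw [Lp.toLp_compMeasurePreserving, Lp.toLp_compMeasurePreserving, Lp.edist_toLp_toLp]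
  refine eLpNorm_congr_ae (.of_forall fun x => ?_)
  simp [g]

/-- The scales used in the regularisation. -/
noncomputable def scale (n : ℕ) : ℝ := 1 / ((n : ℝ) + 1)

lemma scale_pos (n : ℕ) : 0 < scale n := by unfold scale; positivity

lemma scale_le (n : ℕ) : scale n ≤ 1 := by
  unfold scale; rw [div_le_one (by positivity)]
  have : (0 : ℝ) ≤ n := n.cast_nonneg
  linarith

lemma tendsto_scale : Tendsto scale atTop (𝓝 0) := tendsto_one_div_add_atTop_nhds_zero_nat

/-- By Fubini and scaling the integral equals ∫ eta₁(z) H(εz) dz with H(h) = ∫ P f(· − h). Hölder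
bounds H, and continuity of translations in L^p makes it continuous at 0, so dominated convergence
applies. Strong measurability is assumed in order to have genuinely measurable functions on the
product. -/
lemma tendsto_integral_mul_cv_eta_aux {p p' : ℝ≥0∞} [ENNReal.HolderTriple p' p 1] (hp1 : 1 ≤ p)
    (hp : p ≠ ⊤) {P f : E3 → ℝ} (hP : MemLp P p' volume) (hf : MemLp f p volume)
    (hPm : StronglyMeasurable P) (hfm : StronglyMeasurable f) :
    Tendsto (fun n => ∫ x, P x * cv (eta (scale n)) f x) atTop
      (𝓝 (etaMass * ∫ x, P x * f x)) := by
  set H : E3 → ℝ := fun h => ∫ x, P x * f (x - h) with hH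
  have hfh : ∀ h, MemLp (fun x => f (x - h)) p volume := fun h =>
    hf.comp_measurePreserving (measurePreserving_sub_right volume h)
  have hHb : ∀ h, ‖H h‖ₑ ≤ eLpNorm P p' volume * eLpNorm f p volume := by
    intro h
    rw [← eLpNorm_comp_sub_right f p hf.1 h]
    exact enorm_integral_mul_le hP.1 (hfh h).1
  have hH0 : Tendsto H (𝓝 0) (𝓝 (H 0)) := by
    rw [tendsto_iff_edist_tendsto_0]
    have t := ENNReal.Tendsto.const_mul (a := eLpNorm P p' volume)
      (tendsto_eLpNorm_translate hp1 hp hf) (.inr hP.2.ne)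
    rw [mul_zero] at t
    refine tendsto_of_tendsto_of_tendsto_of_le_of_le tendsto_const_nhds t (fun n => zero_le)
      fun h => ?_
    simp only [hH, edist_eq_enorm_sub, sub_zero]
    have e : (∫ x, P x * f (x - h)) - ∫ x, P x * f x = ∫ x, P x * (f (x - h) - f x) := by
      simp only [mul_sub]
      exact (integral_sub (hP.integrable_mul (hfh h)) (hP.integrable_mul hf)).symm
    rw [e]
    exact enorm_integral_mul_le hP.1 ((hfh h).sub hf).1
  have hswap : ∀ n, ∫ x, P x * cv (eta (scale n)) f x = ∫ z, eta 1 z * H (scale n • z) := by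
    intro n
    have hm : StronglyMeasurable fun z : E3 × E3 => P z.1 * (eta 1 z.2 * f (z.1 - scale n • z.2)) :=
      (hPm.comp_measurable measurable_fst).mul
        (((continuous_eta one_pos).comp continuous_snd).stronglyMeasurable.mul
          (hfm.comp_measurable (measurable_fst.sub (measurable_snd.fun_const_smul _))))
    have hi : Integrable (fun z : E3 × E3 => P z.1 * (eta 1 z.2 * f (z.1 - scale n • z.2)))
        (volume.prod volume) := by
      refine ⟨hm.aestronglyMeasurable, ?_⟩
      rw [HasFiniteIntegral, lintegral_prod_symm' _ hm.measurable.enorm]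
      have hb : ∀ z, ∫⁻ x, ‖P x * (eta 1 z * f (x - scale n • z))‖ₑ
          ≤ ‖eta 1 z‖ₑ * (eLpNorm P p' volume * eLpNorm f p volume) := by
        intro z
        have e : ∀ x, ‖P x * (eta 1 z * f (x - scale n • z))‖ₑ
            = ‖eta 1 z‖ₑ * ‖P x * f (x - scale n • z)‖ₑ := fun x => by
          simp only [enorm_mul]; ring
        simp only [e]
        have hm1 : Measurable fun x => f (x - scale n • z) :=
          hfm.measurable.comp (measurable_id.sub measurable_const)
        have hm2 : Measurable fun x => ‖P x * f (x - scale n • z)‖ₑ :=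
          (hPm.measurable.mul hm1).enorm
        rw [lintegral_const_mul _ hm2]
        gcongr
        rw [← eLpNorm_comp_sub_right f p hf.1 (scale n • z)]
        exact lintegral_mul_le hP.1 (hfh _).1
      refine (lintegral_mono hb).trans_lt ?_
      rw [lintegral_mul_const _ (continuous_eta one_pos).measurable.enorm]
      exact ENNReal.mul_lt_top (integrable_eta one_pos le_rfl).2
        (ENNReal.mul_lt_top hP.2 hf.2)
    have h6 := integral_integral_swap
      (f := fun x z => P x * (eta 1 z * f (x - scale n • z))) hi
    simp only [cv_eta (scale_pos n), hH, ← integral_const_mul]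
    rw [h6]
    congr 1; ext z; congr 1; ext x; ring
  simp only [hswap]
  have hlim : etaMass * ∫ x, P x * f x = ∫ z, eta 1 z * H 0 := by
    rw [integral_mul_const, etaMass]; simp [hH]
  rw [hlim]
  set B := (eLpNorm P p' volume * eLpNorm f p volume).toReal
  have hB : ∀ h, ‖H h‖ ≤ B := by
    intro h
    have := ENNReal.toReal_mono (ENNReal.mul_lt_top hP.2 hf.2).ne (hHb h)
    rwa [toReal_enorm] at this
  have hHm : StronglyMeasurable H := by
    have hm : StronglyMeasurable fun z : E3 × E3 => P z.2 * f (z.2 - z.1) :=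
      (hPm.comp_measurable measurable_snd).mul
        (hfm.comp_measurable (measurable_snd.sub measurable_fst))
    exact hm.integral_prod_right'
  refine tendsto_integral_of_dominated_convergence (fun z => eta 1 z * B) (fun n => ?_)
    ((integrable_eta one_pos le_rfl).mul_const B) (fun n => .of_forall fun z => ?_)
    (.of_forall fun z => ?_)
  · have h1 : Measurable fun z : E3 => scale n • z := measurable_id.fun_const_smul _
    exact ((continuous_eta one_pos).stronglyMeasurable.mul
      (hHm.comp_measurable h1)).aestronglyMeasurable
  · rw [norm_mul, Real.norm_of_nonneg (eta_pos one_pos z).le]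
    exact mul_le_mul_of_nonneg_left (hB _) (eta_pos one_pos z).le
  · refine (hH0.comp ?_).const_mul _
    simpa using tendsto_scale.smul_const z

/-- Weak convergence of the regularisations by `eta`. -/
lemma tendsto_integral_mul_cv_eta {p p' : ℝ≥0∞} [ENNReal.HolderTriple p' p 1] (hp1 : 1 ≤ p)
    (hp : p ≠ ⊤) {P f : E3 → ℝ} (hP : MemLp P p' volume) (hf : MemLp f p volume) :
    Tendsto (fun n => ∫ x, P x * cv (eta (scale n)) f x) atTop
      (𝓝 (etaMass * ∫ x, P x * f x)) := by
  obtain ⟨P', hP'm, hPP'⟩ := hP.1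
  obtain ⟨f', hf'm, hff'⟩ := hf.1
  have h := tendsto_integral_mul_cv_eta_aux (p' := p') hp1 hp ((memLp_congr_ae hPP').1 hP)
    ((memLp_congr_ae hff').1 hf) hP'm hf'm
  have e : ∀ n, cv (eta (scale n)) f = cv (eta (scale n)) f' := by
    intro n; ext x
    refine integral_congr_ae ?_
    filter_upwards [hff'] with y hy
    rw [hy]
  have e1 : ∀ n, ∫ x, P x * cv (eta (scale n)) f x = ∫ x, P' x * cv (eta (scale n)) f' x := by
    intro n
    rw [e]
    refine integral_congr_ae ?_
    filter_upwards [hPP'] with y hy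
    rw [hy]
  have e2 : ∫ x, P x * f x = ∫ x, P' x * f' x := by
    refine integral_congr_ae ?_
    filter_upwards [hPP', hff'] with y hy hy'
    rw [hy, hy']
  simp only [e1, e2]; exact h

/-- A uniform bound of the regularisations bounds the function. -/
lemma ae_abs_le_of_cv_eta {p : ℝ≥0∞} (hp1 : 1 ≤ p) (hp : p ≠ ⊤) {f : E3 → ℝ}
    (hf : MemLp f p volume) {M : ℝ} (hM : ∀ n x, |cv (eta (scale n)) f x| ≤ M) :
    ∀ᵐ x, |f x| ≤ etaMass⁻¹ * M := by
  have hM0 : 0 ≤ M := (abs_nonneg _).trans (hM 0 0)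
  have key : ∀ g : E3 → ℝ, MemLp g p volume → (∀ n x, cv (eta (scale n)) g x ≤ M) →
      ∀ᵐ x, g x ≤ etaMass⁻¹ * M := by
    intro g hg hgM
    refine ae_of_forall_measure_lt_top_ae_restrict _ fun s hs hsf => ?_
    have : IsFiniteMeasure (volume.restrict s) := ⟨by simpa using hsf⟩
    have hgi : Integrable g (volume.restrict s) :=
      (hg.restrict s).integrable hp1
    refine ae_le_of_forall_setIntegral_le hgi (integrable_const _) fun t ht _ => ?_
    rw [Measure.restrict_restrict ht]
    have htf : volume (t ∩ s) < ⊤ := (measure_mono inter_subset_right).trans_lt hsf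
    -- Testing with indicators of sets of finite measure, the weak limit bounds every set integral
    -- of `g`, hence `g` itself almost everywhere.
    set P : E3 → ℝ := (t ∩ s).indicator fun _ => 1
    have hP : MemLp P (ENNReal.conjExponent p) volume :=
      memLp_indicator_const _ (ht.inter hs) 1 (.inr htf.ne)
    have := ENNReal.HolderConjugate.conjExponent hp1
    have hl := tendsto_integral_mul_cv_eta (p' := ENNReal.conjExponent p) hp1 hp hP hg
    have hle : ∀ n, ∫ x, P x * cv (eta (scale n)) g x ≤ M * (volume (t ∩ s)).toReal := by
      intro n
      by_cases hi : Integrable (fun x => P x * cv (eta (scale n)) g x) volume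
      · calc ∫ x, P x * cv (eta (scale n)) g x ≤ ∫ x, (t ∩ s).indicator (fun _ => M) x := by
              refine integral_mono hi (memLp_one_iff_integrable.1
                (memLp_indicator_const 1 (ht.inter hs) M (.inr htf.ne))) fun x => ?_
              by_cases hx : x ∈ t ∩ s
              · simp only [P, indicator_of_mem hx, one_mul]; exact hgM n x
              · simp only [P, indicator_of_notMem hx, zero_mul]; exact le_rfl
          _ = _ := by
              rw [integral_indicator_const _ (ht.inter hs)]; simp [mul_comm, Measure.real]
      · rw [integral_undef hi]; exact mul_nonneg hM0 ENNReal.toReal_nonneg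
    have h2 := le_of_tendsto' hl hle
    have h3 : ∫ x, P x * g x = ∫ x in t ∩ s, g x := by
      rw [← integral_indicator (ht.inter hs)]
      congr 1; ext x
      by_cases hx : x ∈ t ∩ s
      · simp only [P, indicator_of_mem hx, one_mul]
      · simp only [P, indicator_of_notMem hx, zero_mul]
    rw [h3] at h2
    rw [setIntegral_const, smul_eq_mul, Measure.real]
    have h4 : ∫ x in t ∩ s, g x ≤ etaMass⁻¹ * (M * (volume (t ∩ s)).toReal) := by
      rw [le_inv_mul_iff₀ etaMass_pos]; exact h2
    linarith
  have h1 := key f hf fun n x => (le_abs_self _).trans (hM n x)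
  have h2 := key (-f) hf.neg fun n x => by
    have : cv (eta (scale n)) (-f) x = - cv (eta (scale n)) f x := by
      simp only [cv, Pi.neg_apply, mul_neg, integral_neg]
    rw [this]; exact (neg_le_abs _).trans (hM n x)
  filter_upwards [h1, h2] with x h1 h2
  rw [abs_le]; simp only [Pi.neg_apply] at h2; constructor <;> linarith

/-! ### The singular kernel `|x|⁻²` -/

/-- The volume of the unit ball. -/
noncomputable def ballVol : ℝ := (volume : Measure E3).real (Metric.ball 0 1)

lemma ballVol_nonneg : 0 ≤ ballVol := measureReal_nonneg

/-- In polar coordinates this is ∫₀ʳ s^{2−a} ds, which converges because a < 3; `lintegral_far` is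
the complementary case a > 3. The kernel |y|⁻² falls under the first after raising it to a power
below 3/2, and under the second after squaring. -/
lemma lintegral_near {a r : ℝ} (ha : a < 3) (hr : 0 < r) :
    ∫⁻ y in Metric.ball (0 : E3) r, ENNReal.ofReal (‖y‖ ^ (-a))
      = ENNReal.ofReal (3 * ballVol * (r ^ (3 - a) / (3 - a))) := by
  set F : ℝ → ℝ := (Iio r).indicator fun s => s ^ (-a) with hF
  have h2 : ∀ s ∈ Ioi (0 : ℝ), s ^ 2 * F s = (Iio r).indicator (fun s => s ^ (2 - a)) s := by
    intro s hs
    by_cases h : s ∈ Iio r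
    · simp only [hF, indicator_of_mem h]
      rw [← Real.rpow_natCast, ← Real.rpow_add hs]; congr 1
    · simp only [hF, indicator_of_notMem h, mul_zero]
  have hI : IntervalIntegrable (fun s : ℝ => s ^ (2 - a)) volume 0 r :=
    intervalIntegral.intervalIntegrable_rpow' (by linarith)
  have hI' : IntegrableOn (fun s : ℝ => s ^ (2 - a)) (Ioo 0 r) volume := by
    rw [intervalIntegrable_iff_integrableOn_Ioo_of_le hr.le] at hI; exact hI
  have hon : IntegrableOn (fun y : ℝ => y ^ 2 * F y) (Ioi 0) volume := by
    rw [integrableOn_congr_fun h2 measurableSet_Ioi, integrableOn_indicator_iff measurableSet_Iio,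
      inter_comm, Ioi_inter_Iio]
    exact hI'
  have hint : Integrable (fun x : E3 => F ‖x‖) volume := by
    rw [integrable_fun_norm_addHaar]
    simpa using hon
  have hval : ∫ x : E3, F ‖x‖ = 3 * ballVol * (r ^ (3 - a) / (3 - a)) := by
    rw [integral_fun_norm_addHaar]
    simp only [finrank_euclideanSpace, Fintype.card_fin, smul_eq_mul, nsmul_eq_mul]
    rw [show (3 - 1 : ℕ) = 2 from rfl, setIntegral_congr_fun measurableSet_Ioi h2,
      setIntegral_indicator measurableSet_Iio, Ioi_inter_Iio, ← integral_Ioc_eq_integral_Ioo,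
      ← intervalIntegral.integral_of_le hr.le, integral_rpow (.inl (by linarith)), ballVol,
      Real.zero_rpow (by linarith)]
    push_cast
    rw [show 2 - a + 1 = 3 - a by ring]; ring
  rw [← hval, ofReal_integral_eq_lintegral_ofReal hint, ← lintegral_indicator measurableSet_ball]
  · congr 1; ext x
    by_cases hx : ‖x‖ < r
    · simp [hF, hx]
    · simp [hF, hx]
  · refine .of_forall fun x => ?_
    simp only [hF]
    by_cases hx : ‖x‖ ∈ Iio r
    · rw [indicator_of_mem hx]; positivity
    · rw [indicator_of_notMem hx]; exact le_rfl

lemma lintegral_far {a r : ℝ} (ha : 3 < a) (hr : 0 < r) :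
    ∫⁻ y in (Metric.ball (0 : E3) r)ᶜ, ENNReal.ofReal (‖y‖ ^ (-a))
      = ENNReal.ofReal (3 * ballVol * (r ^ (3 - a) / (a - 3))) := by
  set F : ℝ → ℝ := (Ici r).indicator fun s => s ^ (-a) with hF
  have h2 : ∀ s ∈ Ioi (0 : ℝ), s ^ 2 * F s = (Ici r).indicator (fun s => s ^ (2 - a)) s := by
    intro s hs
    by_cases h : s ∈ Ici r
    · simp only [hF, indicator_of_mem h]
      rw [← Real.rpow_natCast, ← Real.rpow_add hs]; congr 1
    · simp only [hF, indicator_of_notMem h, mul_zero]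
  have hset : Ioi (0 : ℝ) ∩ Ici r = Ici r := by
    ext s; simp only [mem_inter_iff, mem_Ioi, mem_Ici]; constructor
    · exact fun h => h.2
    · exact fun h => ⟨hr.trans_le h, h⟩
  have hI' : IntegrableOn (fun s : ℝ => s ^ (2 - a)) (Ici r) volume := by
    rw [integrableOn_Ici_iff_integrableOn_Ioi]
    exact integrableOn_Ioi_rpow_of_lt (by linarith) hr
  have hon : IntegrableOn (fun y : ℝ => y ^ 2 * F y) (Ioi 0) volume := by
    rw [integrableOn_congr_fun h2 measurableSet_Ioi, integrableOn_indicator_iff measurableSet_Ici,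
      inter_comm, hset]
    exact hI'
  have hint : Integrable (fun x : E3 => F ‖x‖) volume := by
    rw [integrable_fun_norm_addHaar]
    simpa using hon
  have hval : ∫ x : E3, F ‖x‖ = 3 * ballVol * (r ^ (3 - a) / (a - 3)) := by
    rw [integral_fun_norm_addHaar]
    simp only [finrank_euclideanSpace, Fintype.card_fin, smul_eq_mul, nsmul_eq_mul]
    rw [show (3 - 1 : ℕ) = 2 from rfl, setIntegral_congr_fun measurableSet_Ioi h2,
      setIntegral_indicator measurableSet_Ici, hset, integral_Ici_eq_integral_Ioi,
      integral_Ioi_rpow_of_lt (by linarith) hr, ballVol]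
    push_cast
    rw [show 2 - a + 1 = -(a - 3) by ring, show -(a - 3) = 3 - a by ring, neg_div,
      ← div_neg, neg_sub]; ring
  rw [← hval, ofReal_integral_eq_lintegral_ofReal hint,
    ← lintegral_indicator measurableSet_ball.compl]
  · congr 1; ext x
    by_cases hx : ‖x‖ < r
    · simp [hF, hx]
    · simp [hF, hx, not_lt.1 hx]
  · refine .of_forall fun x => ?_
    simp only [hF]
    by_cases hx : ‖x‖ ∈ Ici r
    · rw [indicator_of_mem hx]; positivity
    · rw [indicator_of_notMem hx]; exact le_rfl

/-- Splitting the convolution with `|x|⁻²` at the radius `r`. -/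
lemma lintegral_riesz_le {p p' r : ℝ} (hc : p'.HolderConjugate p) (hp : 3 < p) (hr : 0 < r)
    {f : E3 → ℝ} (hf : AEStronglyMeasurable f volume) (x : E3) :
    ∫⁻ y, ENNReal.ofReal (‖x - y‖ ^ (-2 : ℝ)) * ‖f y‖ₑ
      ≤ ENNReal.ofReal (3 * ballVol * (r ^ (3 - 2 * p') / (3 - 2 * p'))) ^ (1 / p')
          * (∫⁻ y, ‖f y‖ₑ ^ p) ^ (1 / p)
        + ENNReal.ofReal (3 * ballVol * r⁻¹) ^ (1 / 2 : ℝ) * (∫⁻ y, ‖f y‖ₑ ^ (2 : ℝ)) ^ (1 / 2 : ℝ) := by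
  -- p > 3 forces p' < 3/2. Hence |y|^{-2p'} is integrable near the origin and |y|⁻⁴ far from it,
  -- and Hölder is used with L^p inside the ball and with L² outside.
  have hp' : 2 * p' < 3 := by
    have h1 := hc.inv_add_inv_eq_one
    have h2 : p⁻¹ < 3⁻¹ := inv_strictAnti₀ (by norm_num) hp
    have h3 : (2 / 3 : ℝ) < p'⁻¹ := by linarith
    have h4 := hc.pos
    rw [lt_inv_comm₀ (by norm_num) h4] at h3
    norm_num at h3; linarith
  have hg : AEStronglyMeasurable (fun y => f (x - y)) volume :=
    hf.comp_quasiMeasurePreserving (quasiMeasurePreserving_sub_left volume x)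
  have hkm : Measurable fun y : E3 => ENNReal.ofReal (‖y‖ ^ (-2 : ℝ)) :=
    ENNReal.measurable_ofReal.comp (measurable_norm.pow_const _)
  have e1 : ∫⁻ y, ENNReal.ofReal (‖x - y‖ ^ (-2 : ℝ)) * ‖f y‖ₑ
      = ∫⁻ y, ENNReal.ofReal (‖y‖ ^ (-2 : ℝ)) * ‖f (x - y)‖ₑ := by
    rw [← lintegral_sub_left_eq_self _ x]; simp
  have e2 : ∀ s : ℝ, ∫⁻ y, ‖f y‖ₑ ^ s = ∫⁻ y, ‖f (x - y)‖ₑ ^ s := fun s => by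
    rw [← lintegral_sub_left_eq_self _ x]
  have hpow : ∀ (s : ℝ), 0 ≤ s → ∀ y : E3, ENNReal.ofReal (‖y‖ ^ (-2 : ℝ)) ^ s
      = ENNReal.ofReal (‖y‖ ^ (-(2 * s))) := by
    intro s hs y
    rw [ENNReal.ofReal_rpow_of_nonneg (by positivity) hs, ← Real.rpow_mul (norm_nonneg _)]
    congr 2; ring
  rw [e1, e2, e2, ← lintegral_add_compl _ (measurableSet_ball (x := (0 : E3)) (ε := r))]
  have n1 := ENNReal.lintegral_mul_le_Lp_mul_Lq (volume.restrict (Metric.ball (0 : E3) r)) hc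
    hkm.aemeasurable hg.enorm.restrict
  have n2 := ENNReal.lintegral_mul_le_Lp_mul_Lq (volume.restrict (Metric.ball (0 : E3) r)ᶜ)
    Real.HolderConjugate.two_two hkm.aemeasurable hg.enorm.restrict
  simp only [hpow _ hc.nonneg, lintegral_near hp' hr] at n1
  simp only [hpow 2 (by norm_num), lintegral_far (by norm_num : (3 : ℝ) < 2 * 2) hr] at n2
  rw [show (3 - 2 * 2 : ℝ) = -1 by norm_num, show (2 * 2 - 3 : ℝ) = 1 by norm_num, div_one,
    Real.rpow_neg_one] at n2
  refine add_le_add (n1.trans ?_) (n2.trans ?_)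
  · have := hc.symm.pos
    gcongr
    exact Measure.restrict_le_self
  · gcongr
    exact Measure.restrict_le_self


/-- Dropping ε² only enlarges the kernel. The domination by the singular kernel |z|⁻² is uniform in
ε, so estimates proved for it survive the limit ε → 0. -/
lemma enorm_ker1_le {ε : ℝ} (hε : 0 < ε) (i : Fin 3) (z : E3) :
    ‖ker1 ε i z‖ₑ ≤ ENNReal.ofReal (‖z‖ ^ (-2 : ℝ)) := by
  rw [← ofReal_norm, Real.norm_eq_abs]
  refine ENNReal.ofReal_le_ofReal ?_
  by_cases hz : z = 0
  · subst hz; simp [ker1]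
  have hz' : 0 < ‖z‖ := norm_pos_iff.2 hz
  rw [ker1, abs_mul, abs_of_pos (Real.rpow_pos_of_pos (bq_pos hε z) _)]
  calc |z i| * bq ε z ^ (-(3 / 2) : ℝ) ≤ ‖z‖ * (‖z‖ ^ 2) ^ (-(3 / 2) : ℝ) := by
        have h1 : |z i| ≤ ‖z‖ := PiLp.norm_apply_le z i
        have h2 : bq ε z ^ (-(3 / 2) : ℝ) ≤ (‖z‖ ^ 2) ^ (-(3 / 2) : ℝ) := by
          refine Real.rpow_le_rpow_of_nonpos (by positivity) ?_ (by norm_num)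
          unfold bq; nlinarith [sq_nonneg ε]
        exact mul_le_mul h1 h2 (Real.rpow_pos_of_pos (bq_pos hε z) _).le hz'.le
    _ = ‖z‖ ^ (-2 : ℝ) := by
        rw [← Real.rpow_natCast, ← Real.rpow_mul hz'.le]
        nth_rw 1 [← Real.rpow_one ‖z‖]
        rw [← Real.rpow_add hz']; norm_num

lemma enorm_cv_ker1_le {ε : ℝ} (hε : 0 < ε) (i : Fin 3) (f : E3 → ℝ) (x : E3) :
    ‖cv (ker1 ε i) f x‖ₑ ≤ ∫⁻ y, ENNReal.ofReal (‖x - y‖ ^ (-2 : ℝ)) * ‖f y‖ₑ := by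
  refine (enorm_integral_le_lintegral_enorm _).trans (lintegral_mono fun y => ?_)
  rw [enorm_mul]
  gcongr
  exact enorm_ker1_le hε i _

/-- The convolution with `|x|⁻²` maps `L² ∩ L⁴` to bounded functions. -/
lemma exists_riesz_interp : ∃ C : ℝ≥0, ∀ f : E3 → ℝ, MemLp f 2 volume → MemLp f 4 volume →
    ∀ x, ∫⁻ y, ENNReal.ofReal (‖x - y‖ ^ (-2 : ℝ)) * ‖f y‖ₑ
      ≤ C * (eLpNorm f 2 volume ^ (1 / 3 : ℝ) * eLpNorm f 4 volume ^ (2 / 3 : ℝ)) := by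
  have hv := ballVol_nonneg
  refine ⟨Real.toNNReal ((9 * ballVol) ^ (3 / 4 : ℝ) + (3 * ballVol) ^ (1 / 2 : ℝ)),
    fun f h2 h4 x => ?_⟩
  -- The zero function is excluded because the splitting radius below is a quotient of norms.
  by_cases hz : f =ᵐ[volume] 0
  · have : ∫⁻ y, ENNReal.ofReal (‖x - y‖ ^ (-2 : ℝ)) * ‖f y‖ₑ = 0 := by
      refine (lintegral_congr_ae (g := 0) ?_).trans lintegral_zero
      filter_upwards [hz] with y hy
      simp [hy]
    rw [this]; exact zero_le
  have ha0 : eLpNorm f 2 volume ≠ 0 := by rwa [Ne, eLpNorm_eq_zero_iff h2.1 (by simp)]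
  have hb0 : eLpNorm f 4 volume ≠ 0 := by rwa [Ne, eLpNorm_eq_zero_iff h4.1 (by simp)]
  set a := (eLpNorm f 2 volume).toReal with ha
  set b := (eLpNorm f 4 volume).toReal with hb
  have hap : 0 < a := ENNReal.toReal_pos ha0 h2.2.ne
  have hbp : 0 < b := ENNReal.toReal_pos hb0 h4.2.ne
  have ea : eLpNorm f 2 volume = ENNReal.ofReal a := (ENNReal.ofReal_toReal h2.2.ne).symm
  have eb : eLpNorm f 4 volume = ENNReal.ofReal b := (ENNReal.ofReal_toReal h4.2.ne).symm
  -- The inner part is of size r^{1/4} b and the outer part of size r^{-1/2} a. They balance at r =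
  -- (a/b)^{4/3}, where both equal a^{1/3} b^{2/3}.
  have hr : 0 < (a / b) ^ (4 / 3 : ℝ) := Real.rpow_pos_of_pos (by positivity) _
  have hc : (4 / 3 : ℝ).HolderConjugate 4 := by
    rw [Real.holderConjugate_iff]; norm_num
  have h := lintegral_riesz_le hc (by norm_num) hr h2.1 x
  have i4 : (∫⁻ y, ‖f y‖ₑ ^ (4 : ℝ)) ^ (1 / 4 : ℝ) = ENNReal.ofReal b := by
    rw [← eb, eLpNorm_eq_lintegral_rpow_enorm_toReal (by simp) (by simp)]; simp
  have i2 : (∫⁻ y, ‖f y‖ₑ ^ (2 : ℝ)) ^ (1 / 2 : ℝ) = ENNReal.ofReal a := by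
    rw [← ea, eLpNorm_eq_lintegral_rpow_enorm_toReal (by simp) (by simp)]; simp
  rw [i4, i2] at h
  refine h.trans (le_of_eq ?_)
  rw [ea, eb, ENNReal.ofReal_rpow_of_pos hap, ENNReal.ofReal_rpow_of_pos hbp,
    ← ENNReal.ofReal_mul (by positivity)]
  change _ = ENNReal.ofReal _ * _
  rw [← ENNReal.ofReal_mul (by positivity), ENNReal.ofReal_rpow_of_nonneg (by norm_num; positivity)
    (by norm_num), ENNReal.ofReal_rpow_of_nonneg (by positivity) (by norm_num),
    ← ENNReal.ofReal_mul (by positivity), ← ENNReal.ofReal_mul (by positivity),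
    ← ENNReal.ofReal_add (by positivity) (by positivity)]
  congr 1
  have t1 : 3 * ballVol * (((a / b) ^ (4 / 3 : ℝ)) ^ (3 - 2 * (4 / 3) : ℝ) / (3 - 2 * (4 / 3)))
      = 9 * ballVol * (a / b) ^ (4 / 9 : ℝ) := by
    rw [← Real.rpow_mul (by positivity)]; norm_num; ring
  have t2 : 3 * ballVol * ((a / b) ^ (4 / 3 : ℝ))⁻¹ = 3 * ballVol * (a / b) ^ (-(4 / 3) : ℝ) := by
    rw [Real.rpow_neg (by positivity)]
  rw [t1, t2, Real.mul_rpow (x := 9 * ballVol) (by positivity) (by positivity),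
    Real.mul_rpow (x := 3 * ballVol) (by positivity) (by positivity),
    ← Real.rpow_mul (by positivity), ← Real.rpow_mul (by positivity)]
  have u1 : (a / b) ^ (4 / 9 * (1 / (4 / 3)) : ℝ) * b = a ^ (1 / 3 : ℝ) * b ^ (2 / 3 : ℝ) := by
    have : b = b ^ (1 : ℝ) := (Real.rpow_one b).symm
    nth_rw 2 [this]
    rw [Real.div_rpow hap.le hbp.le, div_mul_eq_mul_div, mul_div_assoc, ← Real.rpow_sub hbp]
    norm_num
  have u2 : (a / b) ^ (-(4 / 3) * (1 / 2) : ℝ) * a = a ^ (1 / 3 : ℝ) * b ^ (2 / 3 : ℝ) := by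
    have : a = a ^ (1 : ℝ) := (Real.rpow_one a).symm
    nth_rw 2 [this]
    rw [Real.div_rpow hap.le hbp.le, div_mul_eq_mul_div, ← Real.rpow_add hap,
      div_eq_mul_inv, ← Real.rpow_neg hbp.le]
    norm_num
  rw [mul_assoc, u1, mul_assoc, u2]
  norm_num; ring

/-- The convolution with `|x|⁻²` maps `L² ∩ L^q` to bounded functions when `q > 3`. -/
lemma exists_riesz_bound {q : ℝ≥0∞} (hq : 3 < q) (hq' : q ≠ ⊤) :
    ∃ C : ℝ≥0, ∀ f : E3 → ℝ, AEStronglyMeasurable f volume →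
    ∀ x, ∫⁻ y, ENNReal.ofReal (‖x - y‖ ^ (-2 : ℝ)) * ‖f y‖ₑ
      ≤ C * (eLpNorm f 2 volume + eLpNorm f q volume) := by
  have hq3 : 3 < q.toReal := by
    have := (ENNReal.toReal_lt_toReal (by simp) hq').2 hq
    simpa using this
  have hq0 : q ≠ 0 := by rintro rfl; simp at hq
  have hc := (Real.HolderConjugate.conjExponent (by linarith : 1 < q.toReal)).symm
  set p' := Real.conjExponent q.toReal
  set A := ENNReal.ofReal (3 * ballVol * ((1 : ℝ) ^ (3 - 2 * p') / (3 - 2 * p'))) ^ (1 / p')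
  set B := ENNReal.ofReal (3 * ballVol * (1 : ℝ)⁻¹) ^ (1 / 2 : ℝ)
  have hp' := hc.pos
  have hA : A ≠ ⊤ := ENNReal.rpow_ne_top_of_nonneg (by positivity) ENNReal.ofReal_ne_top
  have hB : B ≠ ⊤ := ENNReal.rpow_ne_top_of_nonneg (by positivity) ENNReal.ofReal_ne_top
  refine ⟨(A + B).toNNReal, fun f hf x => ?_⟩
  rw [ENNReal.coe_toNNReal (by simp [hA, hB])]
  refine (lintegral_riesz_le hc hq3 one_pos hf x).trans ?_
  have e2 : (∫⁻ y, ‖f y‖ₑ ^ (2 : ℝ)) ^ (1 / 2 : ℝ) = eLpNorm f 2 volume := by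
    rw [eLpNorm_eq_lintegral_rpow_enorm_toReal (by simp) (by simp)]; simp
  rw [e2, ← eLpNorm_eq_lintegral_rpow_enorm_toReal hq0 hq']
  change A * _ + B * _ ≤ _
  rw [mul_add]
  rw [add_comm]
  gcongr
  · exact le_add_self
  · exact le_self_add

/-! ### Sobolev's inequality -/

lemma norm_clm_le_sum (A : E3 →L[ℝ] ℝ) : ‖A‖ ≤ ∑ i, |A (basisVec i)| := by
  refine A.opNorm_le_bound (Finset.sum_nonneg fun i _ => abs_nonneg _) fun x => ?_
  have hx : x = ∑ i, x i • basisVec i := by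
    ext j
    simp [Finset.sum_apply, Pi.single_apply]
  have h1 : A x = ∑ i, x i * A (basisVec i) := by
    conv_lhs => rw [hx]
    simp [map_sum]
  rw [h1, Finset.sum_mul]
  refine (norm_sum_le _ _).trans (Finset.sum_le_sum fun i _ => ?_)
  rw [norm_mul, mul_comm]
  exact mul_le_mul_of_nonneg_left (PiLp.norm_apply_le x i) (abs_nonneg _)

lemma eLpNorm_mollify_le (n : ℕ) {f : E3 → ℝ} (hf : AEStronglyMeasurable f volume) :
    eLpNorm (mollify n f) 2 volume ≤ eLpNorm f 2 volume := by
  rw [mollify_eq_cv]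
  have hm : Continuous ((moll n).normed (volume : Measure E3)) :=
    ((moll n).contDiff_normed (n := 0)).continuous
  refine (eLpNorm_cv_le (p := 2) (by norm_num) (by simp) hm.measurable hf).trans ?_
  have : eLpNorm ((moll n).normed (volume : Measure E3)) 1 volume = 1 := by
    rw [eLpNorm_one_eq_lintegral_enorm]
    have h1 := ofReal_integral_eq_lintegral_ofReal ((moll n).integrable_normed (μ := volume))
      (.of_forall fun x => (moll n).nonneg_normed x)
    rw [(moll n).integral_normed] at h1
    rw [← ENNReal.ofReal_one, h1]
    congr 1; ext x
    rw [Real.enorm_eq_ofReal ((moll n).nonneg_normed x)]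
  rw [this, one_mul]

lemma isWeakPartial_cutoff (i : Fin 3) (n : ℕ) : IsWeakPartial i (cutoff n) (cutoffDeriv i n) :=
  isWeakPartial_of_hasLineDerivAt (contDiff_cutoff n).continuous (continuous_cutoffDeriv i n)
    fun x => ((contDiff_cutoff n).differentiable (by simp) x).hasFDerivAt.hasLineDerivAt _

/-- The constant in Sobolev's inequality. -/
noncomputable def sobConst : ℝ≥0 := SNormLESNormFDerivOfEqConst ℝ (volume : Measure E3) 2

/-- The mollifications are smooth with compact support, so the classical inequality applies to them.
Their gradients are mollified gradients, bounded in L² by Young's inequality, and Fatou's lemma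
passes to the limit. -/
lemma eLpNorm_le_of_compact_support {f : E3 → ℝ} {G : Fin 3 → E3 → ℝ}
    (h : ∀ i, IsWeakPartial i f (G i)) (hc : HasCompactSupport f) :
    eLpNorm f 6 volume ≤ sobConst * ∑ i, eLpNorm (G i) 2 volume := by
  have key : ∀ m, eLpNorm (mollify m f) 6 volume ≤ sobConst * ∑ i, eLpNorm (G i) 2 volume := by
    intro m
    have hs := contDiff_mollify m (h 0).1
    have hmc : HasCompactSupport (mollify m f) :=
      HasCompactSupport.convolution _ (moll m).hasCompactSupport_normed hc
    have h1 := eLpNorm_le_eLpNorm_fderiv_of_eq (volume : Measure E3) (hs.of_le (by simp)) hmc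
      (p := 2) (p' := 6) (by norm_num) (by simp) (by simp; norm_num)
    refine h1.trans ?_
    change (sobConst : ℝ≥0∞) * _ ≤ _
    gcongr
    calc eLpNorm (fderiv ℝ (mollify m f)) 2 volume
        ≤ eLpNorm (∑ i, fun x => |mollify m (G i) x|) 2 volume := by
          refine eLpNorm_mono_real fun x => ?_
          refine (norm_clm_le_sum _).trans (le_of_eq ?_)
          simp [Finset.sum_apply, (h _).fderiv_mollify]
      _ ≤ ∑ i, eLpNorm (fun x => |mollify m (G i) x|) 2 volume :=
          eLpNorm_sum_le (fun i _ =>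
            (contDiff_mollify m (h i).2.1).continuous.abs.aestronglyMeasurable) (by norm_num)
      _ ≤ _ := by
          refine Finset.sum_le_sum fun i _ => ?_
          exact (eLpNorm_norm (mollify m (G i))).trans_le
            (eLpNorm_mollify_le m (h i).2.1.aestronglyMeasurable)
  refine (Lp.eLpNorm_lim_le_liminf_eLpNorm (f := fun m => mollify m f) (fun m =>
    (contDiff_mollify m (h 0).1).continuous.aestronglyMeasurable) f
    (ae_tendsto_mollify (h 0).1)).trans ?_
  refine (liminf_le_liminf (.of_forall key)).trans (by simp)

/-- Sobolev's inequality for weak gradients, under a decay condition at infinity. -/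
lemma eLpNorm_six_le_of_tendsto {f : E3 → ℝ} {G : Fin 3 → E3 → ℝ}
    (h : ∀ i, IsWeakPartial i f (G i))
    (ht : ∀ i, Tendsto (fun n => eLpNorm (fun x => cutoffDeriv i n x * f x) 2 volume)
      atTop (𝓝 0)) :
    eLpNorm f 6 volume ≤ sobConst * ∑ i, eLpNorm (G i) 2 volume := by
  have hfm := (h 0).1.aestronglyMeasurable
  have key : ∀ n, eLpNorm (fun x => cutoff n x * f x) 6 volume
      ≤ sobConst * ∑ i, (eLpNorm (G i) 2 volume
        + eLpNorm (fun x => cutoffDeriv i n x * f x) 2 volume) := by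
    intro n
    have b1 : MemLp (cutoff n) ⊤ volume :=
      (contDiff_cutoff n).continuous.memLp_top_of_hasCompactSupport (hasCompactSupport_cutoff n) _
    have b2 : ∀ i, MemLp (cutoffDeriv i n) ⊤ volume := by
      intro i
      obtain ⟨C, -, hC⟩ := exists_bound_cutoffDeriv i
      exact memLp_top_of_bound (continuous_cutoffDeriv i n).aestronglyMeasurable _
        (.of_forall (hC n))
    -- The product rule with one Lipschitz factor is used because `f` need not be bounded.
    have hw : ∀ i, IsWeakPartial i (fun x => cutoff n x * f x)
        (fun x => G i x * cutoff n x + f x * cutoffDeriv i n x) := by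
      intro i
      have := (h i).mul_of_lipschitz (isWeakPartial_cutoff i n) b1 (b2 i)
      simpa only [mul_comm (f _) (cutoff n _)] using this
    refine (eLpNorm_le_of_compact_support hw (hasCompactSupport_cutoff n).mul_right).trans ?_
    gcongr with i
    refine (eLpNorm_add_le ((h i).2.1.aestronglyMeasurable.mul b1.1)
      (hfm.mul (b2 i).1) (by norm_num)).trans ?_
    gcongr
    · refine eLpNorm_mono fun x => ?_
      rw [Pi.mul_apply, norm_mul, Real.norm_of_nonneg (cutoff_mem n x).1]
      exact mul_le_of_le_one_right (norm_nonneg _) (cutoff_mem n x).2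
    · refine le_of_eq (congrArg (fun F => eLpNorm F 2 volume) ?_)
      ext x; exact mul_comm _ _
  have hlim : Tendsto (fun n => (sobConst : ℝ≥0∞) * ∑ i, (eLpNorm (G i) 2 volume
        + eLpNorm (fun x => cutoffDeriv i n x * f x) 2 volume)) atTop
      (𝓝 (sobConst * ∑ i, eLpNorm (G i) 2 volume)) := by
    refine ENNReal.Tendsto.const_mul (tendsto_finsetSum _ fun i _ => ?_) (.inr (by simp))
    simpa using (ht i).const_add (eLpNorm (G i) 2 volume)
  refine (Lp.eLpNorm_lim_le_liminf_eLpNorm (f := fun n x => cutoff n x * f x) (fun n =>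
    (contDiff_cutoff n).continuous.aestronglyMeasurable.mul hfm) f
    (.of_forall fun x => ?_)).trans ?_
  · simpa using (tendsto_cutoff x).mul_const (f x)
  · rw [← hlim.liminf_eq]
    exact liminf_le_liminf (.of_forall key)

lemma holderTriple_of_toReal {p q r : ℝ≥0∞} (hp : p ≠ 0) (hq : q ≠ 0) (hr : r ≠ 0)
    (h : p.toReal⁻¹ + q.toReal⁻¹ = r.toReal⁻¹) : ENNReal.HolderTriple p q r := ⟨by
  rw [← ENNReal.toReal_eq_toReal_iff' (by simp [hp, hq]) (by simp [hr]),
    ENNReal.toReal_add (by simp [hp]) (by simp [hq])]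
  simpa only [ENNReal.toReal_inv] using h⟩

instance holderTriple_three_six_two : ENNReal.HolderTriple 3 6 2 :=
  holderTriple_of_toReal (by simp) (by simp) (by simp) (by norm_num)

/-- Sobolev's inequality for functions in `L⁶`. -/
lemma eLpNorm_six_le {f : E3 → ℝ} {G : Fin 3 → E3 → ℝ}
    (h : ∀ i, IsWeakPartial i f (G i)) (hf : MemLp f 6 volume) :
    eLpNorm f 6 volume ≤ sobConst * ∑ i, eLpNorm (G i) 2 volume :=
  eLpNorm_six_le_of_tendsto h fun i =>
    tendsto_eLpNorm_cutoffDeriv_mul (p := 6) (r := 2) i (by simp) (by simp) hf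

/-- Sobolev's embedding for functions in `L²`. -/
lemma eLpNorm_six_le_of_two {f : E3 → ℝ} {G : Fin 3 → E3 → ℝ}
    (h : ∀ i, IsWeakPartial i f (G i)) (hf : MemLp f 2 volume) :
    eLpNorm f 6 volume ≤ sobConst * ∑ i, eLpNorm (G i) 2 volume := by
  refine eLpNorm_six_le_of_tendsto h fun i => ?_
  obtain ⟨C, hC0, hC⟩ := exists_bound_cutoffDeriv i
  have t : Tendsto (fun n : ℕ => ENNReal.ofReal (C * ((n : ℝ) + 1)⁻¹) * eLpNorm f 2 volume)
      atTop (𝓝 0) := by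
    have h1 := (tendsto_one_div_add_atTop_nhds_zero_nat (𝕜 := ℝ)).const_mul C
    have h2 := ENNReal.Tendsto.mul_const (b := eLpNorm f 2 volume)
      (ENNReal.tendsto_ofReal h1) (.inr hf.2.ne)
    simpa using h2
  refine tendsto_of_tendsto_of_tendsto_of_le_of_le tendsto_const_nhds t (fun n => zero_le)
    fun n => ?_
  refine eLpNorm_le_mul_eLpNorm_of_ae_le_mul (.of_forall fun x => ?_) 2
  rw [norm_mul]
  exact mul_le_mul_of_nonneg_right (hC n x) (norm_nonneg _)


lemma six_fifths_ne_zero : (6 / 5 : ℝ≥0∞) ≠ 0 := ENNReal.div_ne_zero.2 (by simp)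

lemma six_fifths_ne_top : (6 / 5 : ℝ≥0∞) ≠ ⊤ := ENNReal.div_ne_top (by simp) (by simp)

lemma three_halves_ne_zero : (3 / 2 : ℝ≥0∞) ≠ 0 := ENNReal.div_ne_zero.2 (by simp)

lemma one_lt_six_fifths : (1 : ℝ≥0∞) < 6 / 5 := by
  rw [← ENNReal.toReal_lt_toReal (by simp) six_fifths_ne_top]; norm_num

instance holderTriple_two_six : ENNReal.HolderTriple 2 6 (3 / 2) :=
  holderTriple_of_toReal (by simp) (by simp) three_halves_ne_zero (by norm_num)
instance holderTriple_six_two : ENNReal.HolderTriple 6 2 (3 / 2) :=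
  holderTriple_of_toReal (by simp) (by simp) three_halves_ne_zero (by norm_num)
instance holderTriple_six_fifths_six : ENNReal.HolderTriple (6 / 5) 6 1 :=
  holderTriple_of_toReal six_fifths_ne_zero (by simp) (by simp) (by norm_num)
instance holderTriple_six_six_fifths : ENNReal.HolderTriple 6 (6 / 5) 1 :=
  holderTriple_of_toReal (by simp) six_fifths_ne_zero (by simp) (by norm_num)

lemma memLp_comp_sub_left {f : E3 → ℝ} {p : ℝ≥0∞} (hf : MemLp f p volume) (x : E3) :
    MemLp (fun y => f (x - y)) p volume :=
  hf.comp_measurePreserving (Measure.measurePreserving_sub_left volume x)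

/-- The sup norm is controlled by the `L² ∩ L^q` norm of the gradient, `q > 3`. -/
lemma exists_sup_bound {q : ℝ≥0∞} (hq : 3 < q) (hq' : q ≠ ⊤) :
    ∃ C : ℝ≥0, ∀ (f : E3 → ℝ) (G : Fin 3 → E3 → ℝ), (∀ i, IsWeakPartial i f (G i)) →
      (MemLp f 2 volume ∨ MemLp f 6 volume) → (∀ i, MemLp (G i) 2 volume) →
      (∀ i, MemLp (G i) q volume) →
      eLpNorm f ⊤ volume ≤ C * ∑ i, (eLpNorm (G i) 2 volume + eLpNorm (G i) q volume) := by
  obtain ⟨C, hC⟩ := exists_riesz_bound hq hq'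
  refine ⟨Real.toNNReal etaMass⁻¹ * C, fun f G h hf h2 hqG => ?_⟩
  set S : ℝ≥0∞ := ∑ i, (eLpNorm (G i) 2 volume + eLpNorm (G i) q volume) with hS
  have hSt : S ≠ ⊤ := by
    rw [hS, ENNReal.sum_ne_top]
    exact fun i _ => ENNReal.add_ne_top.2 ⟨(h2 i).2.ne, (hqG i).2.ne⟩
  have hp : ∀ ε, 0 < ε → ε ≤ 1 → ∀ i x, cv (ker2 ε i i) f x = cv (ker1 ε i) (G i) x ∧
      Integrable (fun y => ker2 ε i i (x - y) * f y) volume := by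
    intro ε hε h1 i x
    have k2 : MemLp (fun y => ker1 ε i (x - y)) 2 volume :=
      memLp_comp_sub_left (memLp_ker1 hε h1 (by simp) (by norm_num) i) x
    have i2 : Integrable (fun y => ker1 ε i (x - y) * G i y) volume := k2.integrable_mul (h2 i)
    -- For `f` in L² the product of the gradient kernel with `f` is integrable. For `f` in L⁶ it is
    -- only in L^{3/2}, and the Hessian kernel is used in L^{6/5}.
    rcases hf with hf | hf
    · have i1 : Integrable (fun y => ker2 ε i i (x - y) * f y) volume :=
        (memLp_comp_sub_left (memLp_ker2 hε h1 (p := 2) (by simp) (by norm_num) i i) x).integrable_mul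
          hf
      exact ⟨cv_partial (isWeakPartial_ker1 hε i i) (continuous_ker1 hε i) (continuous_ker2 hε i i)
        (abs_ker1_le' hε i) (abs_ker2_le' hε i i) (h i) x (.inl (k2.integrable_mul hf)) i1 i2, i1⟩
    · have i1 : Integrable (fun y => ker2 ε i i (x - y) * f y) volume :=
        (memLp_comp_sub_left (memLp_ker2 hε h1 (p := 6 / 5) six_fifths_ne_top (by norm_num) i i)
          x).integrable_mul hf
      exact ⟨cv_partial (isWeakPartial_ker1 hε i i) (continuous_ker1 hε i) (continuous_ker2 hε i i)
        (abs_ker1_le' hε i) (abs_ker2_le' hε i i) (h i) x (.inr (hf.mul k2)) i1 i2, i1⟩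
  have hM : ∀ n x, |cv (eta (scale n)) f x| ≤ (C * S).toReal := by
    intro n x
    have hε := scale_pos n
    -- The representation η_ε ∗ f = Σᵢ ∂ᵢ∂ᵢK ∗ f = Σᵢ ∂ᵢK ∗ ∂ᵢf bounds the regularisations
    -- uniformly, since |∂ᵢK| ≤ |x|⁻².
    have e : cv (eta (scale n)) f x = ∑ i, cv (ker1 (scale n) i) (G i) x := by
      have : cv (eta (scale n)) f x = ∑ i, cv (ker2 (scale n) i i) f x := by
        simp only [cv]
        rw [← integral_finsetSum _ fun i _ => (hp _ hε (scale_le n) i x).2]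
        simp only [← Finset.sum_mul, sum_ker2 hε]
      rw [this]
      exact Finset.sum_congr rfl fun i _ => (hp _ hε (scale_le n) i x).1
    have h1 : ‖cv (eta (scale n)) f x‖ₑ ≤ C * S := by
      rw [e, hS, Finset.mul_sum]
      refine (enorm_sum_le _ _).trans (Finset.sum_le_sum fun i _ => ?_)
      exact (enorm_cv_ker1_le hε i _ x).trans (hC _ (h2 i).1 x)
    have := ENNReal.toReal_mono (ENNReal.mul_ne_top (by simp) hSt) h1
    rwa [toReal_enorm] at this
  have hae : ∀ᵐ x, |f x| ≤ etaMass⁻¹ * (C * S).toReal := by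
    rcases hf with hf | hf
    · exact ae_abs_le_of_cv_eta (by norm_num) (by simp) hf hM
    · exact ae_abs_le_of_cv_eta (by norm_num) (by simp) hf hM
  rw [eLpNorm_exponent_top]
  refine (eLpNormEssSup_le_of_ae_bound hae).trans (le_of_eq ?_)
  rw [ENNReal.ofReal_mul (inv_pos.2 etaMass_pos).le, ENNReal.ofReal_toReal
    (ENNReal.mul_ne_top (by simp) hSt), ENNReal.coe_mul, mul_assoc]
  rfl

/-! ### `L²` bounds for the derivatives of the potential -/

lemma eLpNorm_two_sq {f : E3 → ℝ} (hf : MemLp f 2 volume) :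
    eLpNorm f 2 volume ^ 2 = ENNReal.ofReal (∫ x, f x * f x) := by
  have hi : Integrable (fun x => f x * f x) volume := hf.integrable_mul hf
  rw [ofReal_integral_eq_lintegral_ofReal hi (.of_forall fun x => mul_self_nonneg _),
    eLpNorm_eq_lintegral_rpow_enorm_toReal (by simp) (by simp), ← ENNReal.rpow_natCast,
    ← ENNReal.rpow_mul]
  simp only [ENNReal.toReal_ofNat, Nat.cast_ofNat, one_div, ne_eq, OfNat.ofNat_ne_zero,
    not_false_eq_true, inv_mul_cancel₀, ENNReal.rpow_one]
  congr 1; ext x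
  rw [← Real.enorm_eq_ofReal (mul_self_nonneg _), enorm_mul, ← sq, ← ENNReal.rpow_natCast]
  simp

lemma ker3_comm' {ε : ℝ} (i j k : Fin 3) : ker3 ε i j k = ker3 ε i k j := by
  ext x
  simp only [ker3, kron, eq_comm (a := k) (b := i), eq_comm (a := k) (b := j),
    eq_comm (a := j) (b := i)]; ring

lemma memLp_cv_ker1 {ε : ℝ} (hε : 0 < ε) (h1 : ε ≤ 1) {g : E3 → ℝ} (hg : Integrable g volume)
    {p : ℝ≥0∞} (hp : 1 < p) (hp' : p ≠ ⊤) (hp3 : 3 < 2 * p.toReal) (i : Fin 3) :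
    MemLp (cv (ker1 ε i) g) p volume :=
  memLp_cv hp hp' (continuous_ker1 hε i) (abs_ker1_le' hε i) (memLp_ker1 hε h1 hp' hp3 i) hg

lemma memLp_cv_ker2 {ε : ℝ} (hε : 0 < ε) (h1 : ε ≤ 1) {g : E3 → ℝ} (hg : Integrable g volume)
    {p : ℝ≥0∞} (hp : 1 < p) (hp' : p ≠ ⊤) (i j : Fin 3) :
    MemLp (cv (ker2 ε i j) g) p volume :=
  memLp_cv hp hp' (continuous_ker2 hε i j) (abs_ker2_le' hε i j) (memLp_ker2 hε h1 hp' (by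
    rw [← ENNReal.toReal_one]; exact (ENNReal.toReal_lt_toReal (by simp) hp').2 hp) i j) hg

lemma memLp_cv_ker3 {ε : ℝ} (hε : 0 < ε) (h1 : ε ≤ 1) {g : E3 → ℝ} (hg : Integrable g volume)
    {p : ℝ≥0∞} (hp : 1 < p) (hp' : p ≠ ⊤) (i j k : Fin 3) :
    MemLp (cv (ker3 ε i j k) g) p volume :=
  memLp_cv hp hp' (continuous_ker3 hε i j k) (abs_ker3_le' hε i j k)
    (memLp_ker3 hε h1 hp' (by
      rw [← ENNReal.toReal_one]; exact (ENNReal.toReal_le_toReal (by simp) hp').2 hp.le) i j k) hg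

lemma memLp_top_cv_ker1 {ε : ℝ} (hε : 0 < ε) {g : E3 → ℝ} (hg : Integrable g volume)
    (i : Fin 3) : MemLp (cv (ker1 ε i) g) ⊤ volume :=
  memLp_top_cv (continuous_ker1 hε i) (abs_ker1_le' hε i) hg

lemma memLp_top_cv_ker2 {ε : ℝ} (hε : 0 < ε) {g : E3 → ℝ} (hg : Integrable g volume)
    (i j : Fin 3) : MemLp (cv (ker2 ε i j) g) ⊤ volume :=
  memLp_top_cv (continuous_ker2 hε i j) (abs_ker2_le' hε i j) hg

lemma isWeakPartial_cv_ker0 {ε : ℝ} (hε : 0 < ε) {g : E3 → ℝ} (hg : Integrable g volume)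
    (i : Fin 3) : IsWeakPartial i (cv (ker0 ε) g) (cv (ker1 ε i) g) :=
  isWeakPartial_cv (isWeakPartial_ker0 hε i) (continuous_ker0 hε) (continuous_ker1 hε i)
    (abs_ker0_le' hε) (abs_ker1_le' hε i) hg

lemma isWeakPartial_cv_ker1 {ε : ℝ} (hε : 0 < ε) {g : E3 → ℝ} (hg : Integrable g volume)
    (i j : Fin 3) : IsWeakPartial j (cv (ker1 ε i) g) (cv (ker2 ε i j) g) :=
  isWeakPartial_cv (isWeakPartial_ker1 hε i j) (continuous_ker1 hε i) (continuous_ker2 hε i j)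
    (abs_ker1_le' hε i) (abs_ker2_le' hε i j) hg

lemma isWeakPartial_cv_ker2 {ε : ℝ} (hε : 0 < ε) {g : E3 → ℝ} (hg : Integrable g volume)
    (i j k : Fin 3) : IsWeakPartial k (cv (ker2 ε i j) g) (cv (ker3 ε i j k) g) :=
  isWeakPartial_cv (isWeakPartial_ker2 hε i j k) (continuous_ker2 hε i j) (continuous_ker3 hε i j k)
    (abs_ker2_le' hε i j) (abs_ker3_le' hε i j k) hg

lemma sum_cv_ker2 {ε : ℝ} (hε : 0 < ε) {g : E3 → ℝ} (hg : Integrable g volume) (x : E3) :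
    ∑ i, cv (ker2 ε i i) g x = cv (eta ε) g x := by
  simp only [cv]
  rw [← integral_finsetSum _ fun i _ => ?_]
  · simp only [← Finset.sum_mul, sum_ker2 hε]
  · exact hg.bdd_mul (c := 4 * (ε ^ 2) ^ (-(3 / 2) : ℝ))
      ((continuous_ker2 hε i i).comp (continuous_const.sub continuous_id)).aestronglyMeasurable
      (.of_forall fun y => abs_ker2_le' hε i i _)

/-- Both sides equal −∫ ∂ᵢΦ ∂ᵢ∂ⱼ∂ⱼΦ. This follows by integrating ∂ⱼ(∂ᵢΦ ∂ᵢ∂ⱼΦ) and ∂ᵢ(∂ᵢΦ ∂ⱼ∂ⱼΦ) and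
using the symmetry of third derivatives. -/
lemma integral_cv_ker2_sq {ε : ℝ} (hε : 0 < ε) (h1 : ε ≤ 1) {g : E3 → ℝ}
    (hg : Integrable g volume) (i j : Fin 3) :
    ∫ x, cv (ker2 ε i j) g x * cv (ker2 ε i j) g x
      = ∫ x, cv (ker2 ε i i) g x * cv (ker2 ε j j) g x := by
  have w2 : ∀ i, MemLp (cv (ker1 ε i) g) 2 volume := fun i =>
    memLp_cv_ker1 hε h1 hg (by norm_num) (by simp) (by norm_num) i
  have W2 : ∀ i j, MemLp (cv (ker2 ε i j) g) 2 volume := fun i j =>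
    memLp_cv_ker2 hε h1 hg (by norm_num) (by simp) i j
  have Z2 : ∀ i j k, MemLp (cv (ker3 ε i j k) g) 2 volume :=
    memLp_cv_ker3 hε h1 hg (by norm_num) (by simp)
  have int : ∀ {a b : E3 → ℝ}, MemLp a 2 volume → MemLp b 2 volume →
      Integrable (fun x => a x * b x) volume := fun ha hb => ha.integrable_mul hb
  have A := ((isWeakPartial_cv_ker1 hε hg i j).mul (isWeakPartial_cv_ker2 hε hg j i j)
    (memLp_top_cv_ker1 hε hg i) (memLp_top_cv_ker2 hε hg j i)).integral_eq_zero
    (int (w2 i) (W2 j i)) ((int (W2 i j) (W2 j i)).add (int (w2 i) (Z2 j i j)))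
  have B := ((isWeakPartial_cv_ker1 hε hg i i).mul (isWeakPartial_cv_ker2 hε hg j j i)
    (memLp_top_cv_ker1 hε hg i) (memLp_top_cv_ker2 hε hg j j)).integral_eq_zero
    (int (w2 i) (W2 j j)) ((int (W2 i i) (W2 j j)).add (int (w2 i) (Z2 j j i)))
  rw [integral_add (int (W2 i j) (W2 j i)) (int (w2 i) (Z2 j i j)), ker2_comm j i] at A
  rw [integral_add (int (W2 i i) (W2 j j)) (int (w2 i) (Z2 j j i)), ker3_comm' j j i] at B
  linarith

/-- The Hessian of the potential is bounded in `L²`. -/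
lemma eLpNorm_cv_ker2_le {ε : ℝ} (hε : 0 < ε) (h1 : ε ≤ 1) {g : E3 → ℝ}
    (hg : Integrable g volume) (i j : Fin 3) :
    eLpNorm (cv (ker2 ε i j) g) 2 volume ≤ ENNReal.ofReal etaMass * eLpNorm g 2 volume := by
  have W2 : ∀ i j, MemLp (cv (ker2 ε i j) g) 2 volume := fun i j =>
    memLp_cv_ker2 hε h1 hg (by norm_num) (by simp) i j
  have int : ∀ {a b : E3 → ℝ}, MemLp a 2 volume → MemLp b 2 volume →
      Integrable (fun x => a x * b x) volume := fun ha hb => ha.integrable_mul hb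
  have hy : eLpNorm (cv (eta ε) g) 2 volume ≤ ENNReal.ofReal etaMass * eLpNorm g 2 volume := by
    rw [← eLpNorm_eta hε h1]
    exact eLpNorm_cv_le (by norm_num) (by simp) (continuous_eta hε).measurable hg.1
  have he : cv (eta ε) g = fun x => ∑ i, cv (ker2 ε i i) g x := by
    ext x; rw [sum_cv_ker2 hε hg]
  have e2 : MemLp (cv (eta ε) g) 2 volume := by
    rw [he]; exact memLp_finsetSum _ fun i _ => W2 i i
  -- Summed over all indices the identity says ∫|∇²Φ|² = ∫(ΔΦ)². Each entry is thus bounded by η_ε ∗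
  -- g, hence by Young's inequality by ‖g‖₂.
  have hsum : ∑ i, ∑ j, ∫ x, cv (ker2 ε i j) g x * cv (ker2 ε i j) g x
      = ∫ x, cv (eta ε) g x * cv (eta ε) g x := by
    simp only [he, Finset.sum_mul_sum]
    rw [integral_finsetSum _ fun i _ => integrable_finsetSum _ fun j _ => int (W2 i i) (W2 j j)]
    refine Finset.sum_congr rfl fun i _ => ?_
    rw [integral_finsetSum _ fun j _ => int (W2 i i) (W2 j j)]
    exact Finset.sum_congr rfl fun j _ => integral_cv_ker2_sq hε h1 hg i j
  have hle : ∫ x, cv (ker2 ε i j) g x * cv (ker2 ε i j) g x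
      ≤ ∫ x, cv (eta ε) g x * cv (eta ε) g x := by
    have hn : ∀ i j, 0 ≤ ∫ x, cv (ker2 ε i j) g x * cv (ker2 ε i j) g x := fun i j =>
      integral_nonneg fun x => mul_self_nonneg _
    rw [← hsum]
    refine le_trans ?_ (Finset.single_le_sum (f := fun i => ∑ j, ∫ x, cv (ker2 ε i j) g x *
      cv (ker2 ε i j) g x) (fun i _ => Finset.sum_nonneg fun j _ => hn i j) (Finset.mem_univ i))
    exact Finset.single_le_sum (f := fun j => ∫ x, cv (ker2 ε i j) g x * cv (ker2 ε i j) g x)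
      (fun j _ => hn i j) (Finset.mem_univ j)
  refine le_trans ?_ hy
  have h2 := ENNReal.ofReal_le_ofReal hle
  rw [← eLpNorm_two_sq (W2 i j), ← eLpNorm_two_sq e2] at h2
  exact (ENNReal.pow_le_pow_left_iff (by norm_num)).1 h2

/-- The gradient of the potential is bounded from `L^{6/5}` to `L²`. -/
lemma eLpNorm_cv_ker1_le {ε : ℝ} (hε : 0 < ε) (h1 : ε ≤ 1) {h : E3 → ℝ}
    (hi : Integrable h volume) (h65 : MemLp h (6 / 5) volume) (i : Fin 3) :
    eLpNorm (cv (ker1 ε i) h) 2 volume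
      ≤ 3 * sobConst * ENNReal.ofReal etaMass * eLpNorm h (6 / 5) volume := by
  have V2 : ∀ i, MemLp (cv (ker1 ε i) h) 2 volume := fun i =>
    memLp_cv_ker1 hε h1 hi (by norm_num) (by simp) (by norm_num) i
  have W65 : ∀ i j, MemLp (cv (ker2 ε i j) h) (6 / 5) volume := fun i j =>
    memLp_cv_ker2 hε h1 hi one_lt_six_fifths six_fifths_ne_top i j
  have P6 : MemLp (cv (ker0 ε) h) 6 volume :=
    memLp_cv (by norm_num) (by simp) (continuous_ker0 hε) (abs_ker0_le' hε)
      (memLp_ker0 hε h1 (by simp) (by norm_num)) hi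
  have Pt : MemLp (cv (ker0 ε) h) ⊤ volume :=
    memLp_top_cv (continuous_ker0 hε) (abs_ker0_le' hε) hi
  have i1 : ∀ i, Integrable (fun x => cv (ker1 ε i) h x * cv (ker1 ε i) h x) volume := fun i =>
    (V2 i).integrable_mul (V2 i)
  have i2 : ∀ i, Integrable (fun x => cv (ker0 ε) h x * cv (ker2 ε i i) h x) volume := fun i =>
    P6.integrable_mul (W65 i i)
  -- This is the energy identity ∫|∂ᵢΦ|² = −∫ Φ ∂ᵢ∂ᵢΦ. The potential is taken only in L⁶, so the
  -- boundary term is removed through Φ ∂ᵢΦ ∈ L^{3/2}.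
  have key : ∀ i, ∫ x, cv (ker1 ε i) h x * cv (ker1 ε i) h x
      = - ∫ x, cv (ker0 ε) h x * cv (ker2 ε i i) h x := by
    intro i
    have A := ((isWeakPartial_cv_ker0 hε hi i).mul (isWeakPartial_cv_ker1 hε hi i i)
      Pt (memLp_top_cv_ker1 hε hi i)).integral_eq_zero' ((V2 i).mul P6) ((i1 i).add (i2 i))
    rw [integral_add (i1 i) (i2 i)] at A
    linarith
  set v : Fin 3 → ℝ := fun i => (eLpNorm (cv (ker1 ε i) h) 2 volume).toReal with hv
  have hv0 : ∀ i, 0 ≤ v i := fun i => ENNReal.toReal_nonneg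
  have ev : ∀ i, eLpNorm (cv (ker1 ε i) h) 2 volume = ENNReal.ofReal (v i) := fun i =>
    (ENNReal.ofReal_toReal (V2 i).2.ne).symm
  have hvsq : ∀ i, v i ^ 2 = ∫ x, cv (ker1 ε i) h x * cv (ker1 ε i) h x := by
    intro i
    have := eLpNorm_two_sq (V2 i)
    rw [ev, ← ENNReal.ofReal_pow (hv0 i)] at this
    exact (ENNReal.ofReal_eq_ofReal_iff (by positivity)
      (integral_nonneg fun x => mul_self_nonneg _)).1 this
  set H := (eLpNorm h (6 / 5) volume).toReal with hH
  have eH : eLpNorm h (6 / 5) volume = ENNReal.ofReal H := (ENNReal.ofReal_toReal h65.2.ne).symm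
  have hsum : ∑ i, v i ^ 2 = - ∫ x, cv (ker0 ε) h x * cv (eta ε) h x := by
    simp only [hvsq, key, Finset.sum_neg_distrib]
    rw [← integral_finsetSum _ fun i _ => i2 i]
    simp only [← Finset.mul_sum, sum_cv_ker2 hε hi]
  -- The right side of the energy identity is a pairing of L⁶ with L^{6/5}: Sobolev bounds ‖Φ‖₆ by
  -- the gradient itself, and Young bounds η_ε ∗ h by ‖h‖_{6/5}.
  have hle : ∑ i, v i ^ 2 ≤ (sobConst : ℝ) * (∑ i, v i) * (etaMass * H) := by
    have b1 : ‖∫ x, cv (ker0 ε) h x * cv (eta ε) h x‖ₑ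
        ≤ (sobConst * ∑ i, eLpNorm (cv (ker1 ε i) h) 2 volume)
          * (ENNReal.ofReal etaMass * eLpNorm h (6 / 5) volume) := by
      refine (enorm_integral_mul_le (p := 6) (q := 6 / 5) P6.1 ?_).trans ?_
      · have : cv (eta ε) h = fun x => ∑ i, cv (ker2 ε i i) h x := by
          ext x; rw [sum_cv_ker2 hε hi]
        rw [this]; exact (memLp_finsetSum _ fun i _ => W65 i i).1
      · gcongr
        · exact eLpNorm_six_le (isWeakPartial_cv_ker0 hε hi) P6
        · rw [← eLpNorm_eta hε h1]
          exact eLpNorm_cv_le one_lt_six_fifths six_fifths_ne_top (continuous_eta hε).measurable hi.1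
    simp only [ev, eH] at b1
    rw [← ENNReal.ofReal_sum_of_nonneg fun i _ => hv0 i, ← ENNReal.ofReal_coe_nnreal,
      ← ENNReal.ofReal_mul (by positivity), ← ENNReal.ofReal_mul etaMass_pos.le,
      ← ENNReal.ofReal_mul (mul_nonneg (by positivity) (Finset.sum_nonneg fun i _ => hv0 i)),
      ← ofReal_norm, ENNReal.ofReal_le_ofReal_iff (mul_nonneg (mul_nonneg (by positivity)
        (Finset.sum_nonneg fun i _ => hv0 i)) (mul_nonneg etaMass_pos.le ENNReal.toReal_nonneg))]
      at b1
    rw [hsum]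
    exact (neg_le_abs _).trans b1
  have hfin : v i ≤ 3 * sobConst * etaMass * H := by
    simp only [Fin.sum_univ_three] at hle
    have hi1 : v i ≤ v 0 + v 1 + v 2 := by
      fin_cases i <;> simp <;> linarith [hv0 0, hv0 1, hv0 2]
    refine hi1.trans ?_
    set s := v 0 + v 1 + v 2 with hs
    have hs0 : 0 ≤ s := by have := hv0 0; have := hv0 1; have := hv0 2; positivity
    -- Since the estimate for the sum of squares is linear in s, Cauchy–Schwarz for three terms lets
    -- one factor s be cancelled; this is the source of the constant 3.
    have h3 : s ^ 2 ≤ 3 * (v 0 ^ 2 + v 1 ^ 2 + v 2 ^ 2) := by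
      rw [hs]; nlinarith [sq_nonneg (v 0 - v 1), sq_nonneg (v 1 - v 2), sq_nonneg (v 0 - v 2)]
    rcases hs0.eq_or_lt with h0 | h0
    · rw [← h0]
      have := etaMass_pos; have : 0 ≤ H := ENNReal.toReal_nonneg
      positivity
    · have h4 : s * s ≤ s * (3 * sobConst * etaMass * H) := by nlinarith
      exact le_of_mul_le_mul_left h4 h0
  have := ENNReal.ofReal_le_ofReal hfin
  rw [ev, eH]
  refine this.trans (le_of_eq ?_)
  have h3 : (3 : ℝ≥0∞) = ENNReal.ofReal 3 := by simp
  rw [h3, ← ENNReal.ofReal_coe_nnreal, ← ENNReal.ofReal_mul (by norm_num),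
    ← ENNReal.ofReal_mul (by positivity), ← ENNReal.ofReal_mul]
  exact mul_nonneg (by positivity) etaMass_pos.le


/-! ### Identities at a fixed time -/

lemma memLp_of_two_top {f : E3 → ℝ} (h2 : MemLp f 2 volume) (ht : MemLp f ⊤ volume) {p : ℝ≥0∞}
    (hp : 2 ≤ p) (hp' : p ≠ ⊤) : MemLp f p volume := by
  have hp0 : p ≠ 0 := by rintro rfl; simp at hp
  have hpr : 2 ≤ p.toReal := by
    have := (ENNReal.toReal_le_toReal (by simp) hp').2 hp
    simpa using this
  obtain ⟨M, hM0, hM⟩ := memLp_top_bound ht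
  rw [← integrable_norm_rpow_iff h2.1 hp0 hp']
  have hi : Integrable (fun x => M ^ (p.toReal - 2) * (f x * f x)) volume :=
    (h2.integrable_mul h2).const_mul _
  refine hi.mono' ((h2.1.norm.aemeasurable.pow_const _).aestronglyMeasurable) ?_
  filter_upwards [hM] with x hx
  rw [Real.norm_of_nonneg (by positivity)]
  have e : ‖f x‖ ^ p.toReal = ‖f x‖ ^ (p.toReal - 2) * (f x * f x) := by
    have : f x * f x = ‖f x‖ ^ (2 : ℝ) := by
      rw [Real.rpow_two, Real.norm_eq_abs, sq_abs, sq]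
    rw [this, ← Real.rpow_add_of_nonneg (norm_nonneg _) (by linarith) (by norm_num)]
    congr 1; ring
  rw [e]
  exact mul_le_mul_of_nonneg_right (Real.rpow_le_rpow (norm_nonneg _) hx (by linarith))
    (mul_self_nonneg _)

lemma memLp_mul {p q r : ℝ≥0∞} [ENNReal.HolderTriple p q r] {f g : E3 → ℝ}
    (hf : MemLp f p volume) (hg : MemLp g q volume) : MemLp (fun x => f x * g x) r volume :=
  hg.mul hf

lemma integrable_mul_two {f g : E3 → ℝ} (hf : MemLp f 2 volume) (hg : MemLp g 2 volume) :
    Integrable (fun x => f x * g x) volume := hf.integrable_mul hg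

lemma integrable_mul_top {f g : E3 → ℝ} (hf : Integrable f volume) (hg : MemLp g ⊤ volume) :
    Integrable (fun x => f x * g x) volume :=
  memLp_one_iff_integrable.1 (memLp_mul (p := 1) (q := ⊤) (memLp_one_iff_integrable.2 hf) hg)

lemma integral_neg_sum_sub {f : Fin 3 → E3 → ℝ} {g : E3 → ℝ} (hf : ∀ i, Integrable (f i) volume)
    (hg : Integrable g volume) :
    ∫ x, (-∑ i, f i x - 2 * g x) = -∑ i, (∫ x, f i x) - 2 * ∫ x, g x := by
  have h1 : Integrable (fun x => ∑ i, f i x) volume := integrable_finsetSum _ fun i _ => hf i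
  have h2 : Integrable (fun x => -∑ i, f i x) volume := h1.neg
  rw [integral_sub h2 (hg.const_mul 2), integral_neg, integral_finsetSum _ fun i _ => hf i,
    integral_const_mul]

/-- Density and velocity at a fixed time, with their first derivatives. -/
structure Slice (r : E3 → ℝ) (Dr : Fin 3 → E3 → ℝ) (v : Fin 3 → E3 → ℝ)
    (Dv : Fin 3 → Fin 3 → E3 → ℝ) : Prop where
  r_two : MemLp r 2 volume
  r_top : MemLp r ⊤ volume
  Dr_two : ∀ i, MemLp (Dr i) 2 volume
  r_partial : ∀ i, IsWeakPartial i r (Dr i)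
  v_six : ∀ j, MemLp (v j) 6 volume
  v_top : ∀ j, MemLp (v j) ⊤ volume
  Dv_two : ∀ i j, MemLp (Dv i j) 2 volume
  v_partial : ∀ i j, IsWeakPartial i (v j) (Dv i j)

namespace Slice

variable {r : E3 → ℝ} {Dr : Fin 3 → E3 → ℝ} {v : Fin 3 → E3 → ℝ} {Dv : Fin 3 → Fin 3 → E3 → ℝ}

lemma sq_integrable (S : Slice r Dr v Dv) : Integrable (fun x => r x * r x) volume :=
  integrable_mul_two S.r_two S.r_two

lemma cube_integrable (S : Slice r Dr v Dv) : Integrable (fun x => r x ^ 3) volume := by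
  have := integrable_mul_top S.sq_integrable S.r_top
  refine this.congr (.of_forall fun x => ?_); simp only; ring

lemma sq_two (S : Slice r Dr v Dv) : MemLp (fun x => r x * r x) 2 volume :=
  memLp_mul (p := 2) (q := ⊤) S.r_two S.r_top

lemma sq_top (S : Slice r Dr v Dv) : MemLp (fun x => r x * r x) ⊤ volume :=
  memLp_mul (p := ⊤) (q := ⊤) S.r_top S.r_top

lemma cube_top (S : Slice r Dr v Dv) : MemLp (fun x => r x ^ 3) ⊤ volume := by
  have h : MemLp (fun x => r x * r x * r x) ⊤ volume := memLp_mul (p := ⊤) (q := ⊤) S.sq_top S.r_top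
  have e : (fun x => r x ^ 3) = fun x => r x * r x * r x := by ext x; ring
  rwa [e]

lemma cube_two (S : Slice r Dr v Dv) : MemLp (fun x => r x ^ 3) 2 volume := by
  have h : MemLp (fun x => r x * r x * r x) 2 volume := memLp_mul (p := 2) (q := ⊤) S.sq_two S.r_top
  have e : (fun x => r x ^ 3) = fun x => r x * r x * r x := by ext x; ring
  rwa [e]

lemma cube_partial (S : Slice r Dr v Dv) (i : Fin 3) :
    IsWeakPartial i (fun x => r x ^ 3) (fun x => 3 * r x ^ 2 * Dr i x) := by
  have h := ((S.r_partial i).mul (S.r_partial i) S.r_top S.r_top).mul (S.r_partial i) S.sq_top S.r_top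
  have e1 : (fun x => r x ^ 3) = fun x => r x * r x * r x := by ext x; ring
  have e2 : (fun x => 3 * r x ^ 2 * Dr i x)
      = fun x => (Dr i x * r x + r x * Dr i x) * r x + r x * r x * Dr i x := by ext x; ring
  rw [e1, e2]; exact h

lemma cube_mul_partial (S : Slice r Dr v Dv) (i j : Fin 3) :
    IsWeakPartial i (fun x => r x ^ 3 * v j x)
      (fun x => 3 * r x ^ 2 * Dr i x * v j x + r x ^ 3 * Dv i j x) :=
  (S.cube_partial i).mul (S.v_partial i j) S.cube_top (S.v_top j)

lemma cube_mul_integrable (S : Slice r Dr v Dv) (j : Fin 3) :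
    Integrable (fun x => r x ^ 3 * v j x) volume := integrable_mul_top S.cube_integrable (S.v_top j)

lemma cube_Dv_integrable (S : Slice r Dr v Dv) (i j : Fin 3) :
    Integrable (fun x => r x ^ 3 * Dv i j x) volume := integrable_mul_two S.cube_two (S.Dv_two i j)

lemma sq_Dr_v_integrable (S : Slice r Dr v Dv) (i j : Fin 3) :
    Integrable (fun x => 3 * r x ^ 2 * Dr i x * v j x) volume := by
  have := (integrable_mul_top (integrable_mul_two S.sq_two (S.Dr_two i)) (S.v_top j)).const_mul 3
  refine this.congr (.of_forall fun x => ?_); simp only; ring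

lemma cube_div_integrable (S : Slice r Dr v Dv) :
    Integrable (fun x => r x ^ 3 * ∑ i, Dv i i x) volume := by
  simp only [Finset.mul_sum]
  exact integrable_finsetSum _ fun i _ => S.cube_Dv_integrable i i

lemma mul_v_two (S : Slice r Dr v Dv) (j : Fin 3) : MemLp (fun x => r x * v j x) 2 volume :=
  memLp_mul (p := 2) (q := ⊤) S.r_two (S.v_top j)

/-- The continuity equation in the form used for `r³`. -/
lemma cube_transport {rt : E3 → ℝ}
    (hc : ∀ᵐ x, rt x + (∑ i, v i x * Dr i x + r x * ∑ i, Dv i i x) = 0) :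
    ∀ᵐ x, 3 * r x ^ 2 * rt x
      = -∑ i, (3 * r x ^ 2 * Dr i x * v i x + r x ^ 3 * Dv i i x)
        - 2 * (r x ^ 3 * ∑ i, Dv i i x) := by
  filter_upwards [hc] with x hx
  have : rt x = -(∑ i, v i x * Dr i x + r x * ∑ i, Dv i i x) := by linarith
  rw [this]
  simp only [Fin.sum_univ_three]; ring

/-- Evolution of the integral of `r³`. -/
lemma integral_cube_transport (S : Slice r Dr v Dv) {rt : E3 → ℝ}
    (hc : ∀ᵐ x, rt x + (∑ i, v i x * Dr i x + r x * ∑ i, Dv i i x) = 0) :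
    ∫ x, 3 * r x ^ 2 * rt x = - 2 * ∫ x, r x ^ 3 * ∑ i, Dv i i x := by
  have hi : ∀ i, Integrable (fun x => 3 * r x ^ 2 * Dr i x * v i x + r x ^ 3 * Dv i i x) volume :=
    fun i => (S.sq_Dr_v_integrable i i).add (S.cube_Dv_integrable i i)
  -- These are the terms ∂ᵢ(r³vᵢ), total derivatives of integrable functions. Only −2r³ div v
  -- survives.
  have h0 : ∀ i, ∫ x, (3 * r x ^ 2 * Dr i x * v i x + r x ^ 3 * Dv i i x) = 0 := fun i =>
    (S.cube_mul_partial i i).integral_eq_zero (S.cube_mul_integrable i) (hi i)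
  rw [integral_congr_ae (cube_transport hc), integral_neg_sum_sub hi S.cube_div_integrable]
  simp only [h0]; simp

lemma integrable_ker_mul {k g : E3 → ℝ} {M : ℝ} (hk : Continuous k) (hM : ∀ x, |k x| ≤ M)
    (hg : Integrable g volume) (x : E3) : Integrable (fun y => k (x - y) * g y) volume :=
  hg.bdd_mul (c := M) (hk.comp (continuous_const.sub continuous_id)).aestronglyMeasurable
    (.of_forall fun _ => hM _)

/-- The time derivative of the potential, rewritten with the continuity equation. -/
lemma cv_cube_transport (S : Slice r Dr v Dv) {rt : E3 → ℝ}
    (hc : ∀ᵐ x, rt x + (∑ i, v i x * Dr i x + r x * ∑ i, Dv i i x) = 0)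
    {ε : ℝ} (hε : 0 < ε) (j : Fin 3) (x : E3) :
    cv (ker1 ε j) (fun y => 3 * r y ^ 2 * rt y) x
      = -∑ i, cv (ker2 ε j i) (fun y => r y ^ 3 * v i y) x
        - 2 * cv (ker1 ε j) (fun y => r y ^ 3 * ∑ i, Dv i i y) x := by
  have hi : ∀ i, Integrable (fun x => 3 * r x ^ 2 * Dr i x * v i x + r x ^ 3 * Dv i i x) volume :=
    fun i => (S.sq_Dr_v_integrable i i).add (S.cube_Dv_integrable i i)
  -- The divergence div(r³v) is moved onto the kernel, so that no derivative of the density remains.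
  have e1 : ∀ i, cv (ker2 ε j i) (fun y => r y ^ 3 * v i y) x
      = cv (ker1 ε j) (fun x => 3 * r x ^ 2 * Dr i x * v i x + r x ^ 3 * Dv i i x) x := fun i =>
    cv_partial (isWeakPartial_ker1 hε j i) (continuous_ker1 hε j) (continuous_ker2 hε j i)
      (abs_ker1_le' hε j) (abs_ker2_le' hε j i) (S.cube_mul_partial i i) x
      (.inl (integrable_ker_mul (continuous_ker1 hε j) (abs_ker1_le' hε j) (S.cube_mul_integrable i) x))
      (integrable_ker_mul (continuous_ker2 hε j i) (abs_ker2_le' hε j i) (S.cube_mul_integrable i) x)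
      (integrable_ker_mul (continuous_ker1 hε j) (abs_ker1_le' hε j) (hi i) x)
  have hk := fun {g : E3 → ℝ} (hg : Integrable g volume) =>
    integrable_ker_mul (continuous_ker1 hε j) (abs_ker1_le' hε j) hg x
  simp only [e1]
  have e2 : cv (ker1 ε j) (fun y => 3 * r y ^ 2 * rt y) x
      = ∫ y, (-∑ i, ker1 ε j (x - y) * (3 * r y ^ 2 * Dr i y * v i y + r y ^ 3 * Dv i i y)
        - 2 * (ker1 ε j (x - y) * (r y ^ 3 * ∑ i, Dv i i y))) := by
    refine integral_congr_ae ?_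
    filter_upwards [cube_transport hc] with y hy
    rw [hy, mul_sub, mul_neg, Finset.mul_sum]; ring
  rw [e2, integral_neg_sum_sub (fun i => hk (hi i)) (hk S.cube_div_integrable)]
  rfl

/-- The contribution of the time derivative of the test field. -/
lemma integral_test_deriv (S : Slice r Dr v Dv) {rt : E3 → ℝ}
    (hc : ∀ᵐ x, rt x + (∑ i, v i x * Dr i x + r x * ∑ i, Dv i i x) = 0)
    {ε : ℝ} (hε : 0 < ε) (h1 : ε ≤ 1) (j : Fin 3) :
    ∫ x, r x * v j x * cv (ker1 ε j) (fun y => 3 * r y ^ 2 * rt y) x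
      = -∑ i, (∫ x, r x * v j x * cv (ker2 ε j i) (fun y => r y ^ 3 * v i y) x)
        - 2 * ∫ x, r x * v j x * cv (ker1 ε j) (fun y => r y ^ 3 * ∑ i, Dv i i y) x := by
  have i1 : ∀ i, Integrable
      (fun x => r x * v j x * cv (ker2 ε j i) (fun y => r y ^ 3 * v i y) x) volume := fun i =>
    integrable_mul_two (S.mul_v_two j)
      (memLp_cv_ker2 hε h1 (S.cube_mul_integrable i) (by norm_num) (by simp) j i)
  have i2 : Integrable
      (fun x => r x * v j x * cv (ker1 ε j) (fun y => r y ^ 3 * ∑ i, Dv i i y) x) volume :=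
    integrable_mul_two (S.mul_v_two j)
      (memLp_cv_ker1 hε h1 S.cube_div_integrable (by norm_num) (by simp) (by norm_num) j)
  rw [← integral_neg_sum_sub i1 i2]
  refine integral_congr_ae (.of_forall fun x => ?_)
  simp only [S.cv_cube_transport hc hε j x]
  rw [mul_sub, mul_neg, Finset.mul_sum]; ring

/-- Integration by parts in the convective term. -/
lemma integral_convect (S : Slice r Dr v Dv) {rt : E3 → ℝ}
    (hc : ∀ᵐ x, rt x + (∑ i, v i x * Dr i x + r x * ∑ i, Dv i i x) = 0)
    {ε : ℝ} (hε : 0 < ε) (h1 : ε ≤ 1) {g : E3 → ℝ} (hg : Integrable g volume) (j : Fin 3) :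
    ∑ i, (∫ x, r x * v i x * Dv i j x * cv (ker1 ε j) g x)
      = (∫ x, rt x * v j x * cv (ker1 ε j) g x)
        - ∑ i, ∫ x, r x * v i x * v j x * cv (ker2 ε j i) g x := by
  have w2 : MemLp (cv (ker1 ε j) g) 2 volume :=
    memLp_cv_ker1 hε h1 hg (by norm_num) (by simp) (by norm_num) j
  have wt := memLp_top_cv_ker1 hε hg j
  have W2 : ∀ i, MemLp (cv (ker2 ε j i) g) 2 volume := fun i =>
    memLp_cv_ker2 hε h1 hg (by norm_num) (by simp) j i
  have rv_top : ∀ i, MemLp (fun x => r x * v i x) ⊤ volume := fun i =>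
    memLp_mul (p := ⊤) (q := ⊤) S.r_top (S.v_top i)
  have rvv_top : ∀ i, MemLp (fun x => r x * v i x * v j x) ⊤ volume := fun i =>
    memLp_mul (p := ⊤) (q := ⊤) (rv_top i) (S.v_top j)
  have rvv_two : ∀ i, MemLp (fun x => r x * v i x * v j x) 2 volume := fun i =>
    memLp_mul (p := 2) (q := ⊤) (S.mul_v_two i) (S.v_top j)
  have iA : ∀ i, Integrable (fun x => Dr i x * v i x * v j x * cv (ker1 ε j) g x) volume := fun i =>
    integrable_mul_two (memLp_mul (p := 2) (q := ⊤) (memLp_mul (p := 2) (q := ⊤) (S.Dr_two i)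
      (S.v_top i)) (S.v_top j)) w2
  have iB : ∀ i, Integrable (fun x => r x * Dv i i x * v j x * cv (ker1 ε j) g x) volume := fun i =>
    integrable_mul_top (integrable_mul_top (integrable_mul_two S.r_two (S.Dv_two i i)) (S.v_top j)) wt
  have iC : ∀ i, Integrable (fun x => r x * v i x * Dv i j x * cv (ker1 ε j) g x) volume := fun i =>
    integrable_mul_top (integrable_mul_two (S.mul_v_two i) (S.Dv_two i j)) wt
  have iD : ∀ i, Integrable (fun x => r x * v i x * v j x * cv (ker2 ε j i) g x) volume := fun i =>
    integrable_mul_two (rvv_two i) (W2 i)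
  have key : ∀ i, (∫ x, Dr i x * v i x * v j x * cv (ker1 ε j) g x)
      + (∫ x, r x * Dv i i x * v j x * cv (ker1 ε j) g x)
      + (∫ x, r x * v i x * Dv i j x * cv (ker1 ε j) g x)
      + (∫ x, r x * v i x * v j x * cv (ker2 ε j i) g x) = 0 := by
    intro i
    -- The function differentiated is r vᵢ vⱼ ∂ⱼΦ. Its derivative in xᵢ is integrable and has
    -- integral zero.
    have hw := ((((S.r_partial i).mul (S.v_partial i i) S.r_top (S.v_top i)).mul (S.v_partial i j)
      (rv_top i) (S.v_top j)).mul (isWeakPartial_cv_ker1 hε hg j i) (rvv_top i) wt)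
    have e : (fun x => ((Dr i x * v i x + r x * Dv i i x) * v j x + r x * v i x * Dv i j x)
          * cv (ker1 ε j) g x + r x * v i x * v j x * cv (ker2 ε j i) g x)
        = fun x => Dr i x * v i x * v j x * cv (ker1 ε j) g x
          + r x * Dv i i x * v j x * cv (ker1 ε j) g x
          + r x * v i x * Dv i j x * cv (ker1 ε j) g x
          + r x * v i x * v j x * cv (ker2 ε j i) g x := by ext x; ring
    rw [e] at hw
    have h0 := hw.integral_eq_zero (integrable_mul_two (rvv_two i) w2)
      ((((iA i).add (iB i)).add (iC i)).add (iD i))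
    have iAB : Integrable (fun x => Dr i x * v i x * v j x * cv (ker1 ε j) g x
        + r x * Dv i i x * v j x * cv (ker1 ε j) g x) volume := (iA i).add (iB i)
    have iABC : Integrable (fun x => Dr i x * v i x * v j x * cv (ker1 ε j) g x
        + r x * Dv i i x * v j x * cv (ker1 ε j) g x
        + r x * v i x * Dv i j x * cv (ker1 ε j) g x) volume := iAB.add (iC i)
    rwa [integral_add iABC (iD i), integral_add iAB (iC i), integral_add (iA i) (iB i)] at h0
  -- The terms where the derivative falls on r vᵢ add up over i to −∂ₜr, by the continuity equation.
  have hrt : ∫ x, rt x * v j x * cv (ker1 ε j) g x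
      = -∑ i, ((∫ x, Dr i x * v i x * v j x * cv (ker1 ε j) g x)
        + ∫ x, r x * Dv i i x * v j x * cv (ker1 ε j) g x) := by
    have e : ∀ i, (∫ x, Dr i x * v i x * v j x * cv (ker1 ε j) g x)
        + (∫ x, r x * Dv i i x * v j x * cv (ker1 ε j) g x)
        = ∫ x, (Dr i x * v i x * v j x * cv (ker1 ε j) g x
          + r x * Dv i i x * v j x * cv (ker1 ε j) g x) := fun i =>
      (integral_add (iA i) (iB i)).symm
    have iAB : ∀ i, Integrable (fun x => Dr i x * v i x * v j x * cv (ker1 ε j) g x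
        + r x * Dv i i x * v j x * cv (ker1 ε j) g x) volume := fun i => (iA i).add (iB i)
    simp only [e]
    rw [← integral_finsetSum _ fun i _ => iAB i, ← integral_neg]
    refine integral_congr_ae ?_
    filter_upwards [hc] with x hx
    have : rt x = -(∑ i, v i x * Dr i x + r x * ∑ i, Dv i i x) := by linarith
    rw [this]
    simp only [Fin.sum_univ_three]; ring
  rw [hrt, ← Finset.sum_neg_distrib, ← Finset.sum_sub_distrib]
  refine Finset.sum_congr rfl fun i _ => ?_
  linarith [key i]

/-- The viscous terms tested with a gradient field. -/
lemma integral_viscous (S : Slice r Dr v Dv) {D2v : Fin 3 → Fin 3 → Fin 3 → E3 → ℝ}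
    (hD2 : ∀ k i j, MemLp (D2v k i j) 2 volume)
    (hw2 : ∀ k i j, IsWeakPartial k (Dv i j) (D2v k i j))
    {ε : ℝ} (hε : 0 < ε) (h1 : ε ≤ 1) {g : E3 → ℝ} (hg : Integrable g volume) (i j : Fin 3) :
    (∫ x, D2v i i j x * cv (ker1 ε j) g x) = - (∫ x, Dv j j x * cv (ker2 ε i i) g x) ∧
    (∫ x, D2v j i i x * cv (ker1 ε j) g x) = - (∫ x, Dv i i x * cv (ker2 ε j j) g x) := by
  have w2 : ∀ j, MemLp (cv (ker1 ε j) g) 2 volume := fun j =>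
    memLp_cv_ker1 hε h1 hg (by norm_num) (by simp) (by norm_num) j
  have wt := memLp_top_cv_ker1 hε hg
  have W2 : ∀ j i, MemLp (cv (ker2 ε j i) g) 2 volume := fun j i =>
    memLp_cv_ker2 hε h1 hg (by norm_num) (by simp) j i
  have Wt := memLp_top_cv_ker2 hε hg
  have Z65 : ∀ i j k, MemLp (cv (ker3 ε i j k) g) (6 / 5) volume :=
    memLp_cv_ker3 hε h1 hg one_lt_six_fifths six_fifths_ne_top
  have A : ∀ k i j m, (∫ x, D2v k i j x * cv (ker1 ε m) g x)
      = - ∫ x, Dv i j x * cv (ker2 ε m k) g x := by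
    intro k i j m
    have h0 := ((hw2 k i j).mul_of_lipschitz (isWeakPartial_cv_ker1 hε hg m k) (wt m)
      (Wt m k)).integral_eq_zero (integrable_mul_two (S.Dv_two i j) (w2 m))
      ((integrable_mul_two (hD2 k i j) (w2 m)).add (integrable_mul_two (S.Dv_two i j) (W2 m k)))
    rw [integral_add (integrable_mul_two (hD2 k i j) (w2 m))
      (integrable_mul_two (S.Dv_two i j) (W2 m k))] at h0
    linarith
  -- A second integration by parts puts all derivatives on Φ. Here v is only in L⁶, so the boundary
  -- term is handled in L^{3/2}.
  have B : ∀ k j m l, (∫ x, Dv k j x * cv (ker2 ε m l) g x)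
      = - ∫ x, v j x * cv (ker3 ε m l k) g x := by
    intro k j m l
    have i1 := integrable_mul_two (S.Dv_two k j) (W2 m l)
    have i2 : Integrable (fun x => v j x * cv (ker3 ε m l k) g x) volume :=
      (S.v_six j).integrable_mul (Z65 m l k)
    have h0 := ((S.v_partial k j).mul (isWeakPartial_cv_ker2 hε hg m l k) (S.v_top j)
      (Wt m l)).integral_eq_zero' (memLp_mul (S.v_six j) (W2 m l)) (i1.add i2)
    rw [integral_add i1 i2] at h0
    linarith
  refine ⟨?_, A j i i j⟩
  -- Symmetry of ∂ⱼ∂ᵢ∂ᵢΦ exchanges the indices: −∫∂ᵢvⱼ ∂ᵢ∂ⱼΦ = ∫vⱼ ∂ᵢ∂ᵢ∂ⱼΦ = −∫∂ⱼvⱼ ∂ᵢ∂ᵢΦ. So the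
  -- Laplacian also sees only div v.
  rw [A i i j j, B i j j i, B j j i i, ker3_comm j i i]

/-- The pressure term tested with the gradient field. -/
lemma integral_pressure (S : Slice r Dr v Dv) {th : E3 → ℝ} {Dth : Fin 3 → E3 → ℝ}
    (ht : MemLp th ⊤ volume) (hDt : ∀ j, MemLp (Dth j) 2 volume)
    (hwt : ∀ j, IsWeakPartial j th (Dth j))
    {ε : ℝ} (hε : 0 < ε) (h1 : ε ≤ 1) {g : E3 → ℝ} (hg : Integrable g volume) (j : Fin 3) :
    (∫ x, (th x * Dr j x + r x * Dth j x) * cv (ker1 ε j) g x)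
      = - ∫ x, r x * th x * cv (ker2 ε j j) g x := by
  have w2 : MemLp (cv (ker1 ε j) g) 2 volume :=
    memLp_cv_ker1 hε h1 hg (by norm_num) (by simp) (by norm_num) j
  have wt := memLp_top_cv_ker1 hε hg j
  have W2 : MemLp (cv (ker2 ε j j) g) 2 volume :=
    memLp_cv_ker2 hε h1 hg (by norm_num) (by simp) j j
  have rt2 : MemLp (fun x => r x * th x) 2 volume := memLp_mul (p := 2) (q := ⊤) S.r_two ht
  have i1 : Integrable (fun x => (Dr j x * th x + r x * Dth j x) * cv (ker1 ε j) g x) volume := by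
    simp only [add_mul]
    exact (integrable_mul_two (memLp_mul (p := 2) (q := ⊤) (S.Dr_two j) ht) w2).add
      (integrable_mul_top (integrable_mul_two S.r_two (hDt j)) wt)
  have i2 := integrable_mul_two rt2 W2
  have h0 := ((((S.r_partial j).mul (hwt j) S.r_top ht).mul (isWeakPartial_cv_ker1 hε hg j j)
    (memLp_mul (p := ⊤) (q := ⊤) S.r_top ht) wt)).integral_eq_zero (integrable_mul_two rt2 w2)
    (i1.add i2)
  rw [integral_add i1 i2] at h0
  have e : ∀ x, (th x * Dr j x + r x * Dth j x) * cv (ker1 ε j) g x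
      = (Dr j x * th x + r x * Dth j x) * cv (ker1 ε j) g x := fun x => by ring
  simp only [e]; linarith

end Slice


/-! ### The tested momentum equation and the estimates at a fixed time -/

instance holderTriple_three_halves_three_one : ENNReal.HolderTriple (3 / 2) 3 1 :=
  holderTriple_of_toReal (by simp) (by simp) (by simp) (by norm_num)

instance holderTriple_six_three_two : ENNReal.HolderTriple 6 3 2 :=
  holderTriple_of_toReal (by simp) (by simp) (by simp) (by norm_num)

instance holderTriple_six_six_three : ENNReal.HolderTriple 6 6 3 :=
  holderTriple_of_toReal (by simp) (by simp) (by simp) (by norm_num)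

instance holderTriple_three_two_six_fifths : ENNReal.HolderTriple 3 2 (6 / 5) :=
  holderTriple_of_toReal (by simp) (by simp) (by simp) (by norm_num)

lemma eLpNorm_mul_le' {p q r : ℝ≥0∞} [ENNReal.HolderTriple p q r] {f g : E3 → ℝ}
    (hf : AEStronglyMeasurable f volume) (hg : AEStronglyMeasurable g volume) :
    eLpNorm (fun x => f x * g x) r volume ≤ eLpNorm f p volume * eLpNorm g q volume := by
  have h := eLpNorm_smul_le_mul_eLpNorm (p := p) (q := q) (r := r) hg hf
  rwa [show f • g = fun x => f x * g x from rfl] at h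

namespace Slice

variable {r : E3 → ℝ} {Dr : Fin 3 → E3 → ℝ} {v : Fin 3 → E3 → ℝ} {Dv : Fin 3 → Fin 3 → E3 → ℝ}

/-- The momentum equation tested with the regularised gradient of the Newtonian potential. -/
lemma integral_momentum (S : Slice r Dr v Dv) {rt : E3 → ℝ}
    (hc : ∀ᵐ x, rt x + (∑ i, v i x * Dr i x + r x * ∑ i, Dv i i x) = 0)
    {D2v : Fin 3 → Fin 3 → Fin 3 → E3 → ℝ} (hD2 : ∀ k i j, MemLp (D2v k i j) 2 volume)
    (hw2 : ∀ k i j, IsWeakPartial k (Dv i j) (D2v k i j))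
    {th : E3 → ℝ} {Dth : Fin 3 → E3 → ℝ}
    (ht : MemLp th ⊤ volume) (hDt : ∀ j, MemLp (Dth j) 2 volume)
    (hwt : ∀ j, IsWeakPartial j th (Dth j))
    {a : Fin 3 → E3 → ℝ} (ha : ∀ j, MemLp (a j) 6 volume) {R μ lam : ℝ}
    (hm : ∀ᵐ x, ∀ j, r x * (a j x + ∑ i, v i x * Dv i j x) - μ * ∑ i, D2v i i j x
      - (μ + lam) * ∑ i, D2v j i i x + R * (th x * Dr j x + r x * Dth j x) = 0)
    {ε : ℝ} (hε : 0 < ε) (h1 : ε ≤ 1) {g : E3 → ℝ} (hg : Integrable g volume) :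
    ∑ j, ((∫ x, r x * a j x * cv (ker1 ε j) g x) + ∫ x, rt x * v j x * cv (ker1 ε j) g x)
      = (∑ j, ∑ i, ∫ x, r x * v i x * v j x * cv (ker2 ε j i) g x)
        + ∫ x, (R * r x * th x - (2 * μ + lam) * ∑ i, Dv i i x) * cv (eta ε) g x := by
  have w2 : ∀ j, MemLp (cv (ker1 ε j) g) 2 volume := fun j =>
    memLp_cv_ker1 hε h1 hg (by norm_num) (by simp) (by norm_num) j
  have w3 : ∀ j, MemLp (cv (ker1 ε j) g) 3 volume := fun j =>
    memLp_cv_ker1 hε h1 hg (by norm_num) (by simp) (by norm_num) j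
  have wt := memLp_top_cv_ker1 hε hg
  have W2 : ∀ j i, MemLp (cv (ker2 ε j i) g) 2 volume := fun j i =>
    memLp_cv_ker2 hε h1 hg (by norm_num) (by simp) j i
  have iA : ∀ j, Integrable (fun x => r x * a j x * cv (ker1 ε j) g x) volume := fun j =>
    (memLp_mul (p := 2) (q := 6) (r := 3 / 2) S.r_two (ha j)).integrable_mul (w3 j)
  have iC : ∀ i j, Integrable (fun x => r x * v i x * Dv i j x * cv (ker1 ε j) g x) volume :=
    fun i j => integrable_mul_top (integrable_mul_two (S.mul_v_two i) (S.Dv_two i j)) (wt j)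
  have iV : ∀ k i j m, Integrable (fun x => D2v k i j x * cv (ker1 ε m) g x) volume :=
    fun k i j m => integrable_mul_two (hD2 k i j) (w2 m)
  have iP : ∀ j, Integrable (fun x => (th x * Dr j x + r x * Dth j x) * cv (ker1 ε j) g x)
      volume := by
    intro j
    have := (integrable_mul_two (memLp_mul (p := 2) (q := ⊤) (S.Dr_two j) ht) (w2 j)).add
      (integrable_mul_top (integrable_mul_two S.r_two (hDt j)) (wt j))
    refine this.congr (.of_forall fun x => ?_)
    simp only [Pi.add_apply]; ring
  have key : ∀ j, (∫ x, r x * a j x * cv (ker1 ε j) g x)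
      + (∑ i, ∫ x, r x * v i x * Dv i j x * cv (ker1 ε j) g x)
      - μ * (∑ i, ∫ x, D2v i i j x * cv (ker1 ε j) g x)
      - (μ + lam) * (∑ i, ∫ x, D2v j i i x * cv (ker1 ε j) g x)
      + R * (∫ x, (th x * Dr j x + r x * Dth j x) * cv (ker1 ε j) g x) = 0 := by
    intro j
    have I1 : Integrable (fun x => ∑ i, r x * v i x * Dv i j x * cv (ker1 ε j) g x) volume :=
      integrable_finsetSum _ fun i _ => iC i j
    have I2 : Integrable (fun x => ∑ i, D2v i i j x * cv (ker1 ε j) g x) volume :=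
      integrable_finsetSum _ fun i _ => iV i i j j
    have I3 : Integrable (fun x => ∑ i, D2v j i i x * cv (ker1 ε j) g x) volume :=
      integrable_finsetSum _ fun i _ => iV j i i j
    have J1 : Integrable (fun x => r x * a j x * cv (ker1 ε j) g x
        + ∑ i, r x * v i x * Dv i j x * cv (ker1 ε j) g x) volume := (iA j).add I1
    have J2 : Integrable (fun x => r x * a j x * cv (ker1 ε j) g x
        + (∑ i, r x * v i x * Dv i j x * cv (ker1 ε j) g x)
        - μ * ∑ i, D2v i i j x * cv (ker1 ε j) g x) volume := J1.sub (I2.const_mul μ)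
    have J3 : Integrable (fun x => r x * a j x * cv (ker1 ε j) g x
        + (∑ i, r x * v i x * Dv i j x * cv (ker1 ε j) g x)
        - μ * (∑ i, D2v i i j x * cv (ker1 ε j) g x)
        - (μ + lam) * ∑ i, D2v j i i x * cv (ker1 ε j) g x) volume := J2.sub (I3.const_mul _)
    rw [← integral_finsetSum _ fun i _ => iC i j, ← integral_finsetSum _ fun i _ => iV i i j j,
      ← integral_finsetSum _ fun i _ => iV j i i j, ← integral_const_mul, ← integral_const_mul,
      ← integral_const_mul, ← integral_add (iA j) I1, ← integral_sub J1 (I2.const_mul μ),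
      ← integral_sub J2 (I3.const_mul _), ← integral_add J3 ((iP j).const_mul R)]
    refine integral_eq_zero_of_ae ?_
    filter_upwards [hm] with x hx
    have := congrArg (fun s => s * cv (ker1 ε j) g x) (hx j)
    simp only [zero_mul] at this
    rw [Pi.zero_apply, ← this]
    simp only [Fin.sum_univ_three]; ring
  have hvis := fun i j => S.integral_viscous hD2 hw2 hε h1 hg i j
  have hcon := fun j => S.integral_convect hc hε h1 hg j
  have hpr := fun j => S.integral_pressure ht hDt hwt hε h1 hg j
  have iDW : ∀ k i, Integrable (fun x => Dv k k x * cv (ker2 ε i i) g x) volume := fun k i =>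
    integrable_mul_two (S.Dv_two k k) (W2 i i)
  have iRW : ∀ i, Integrable (fun x => r x * th x * cv (ker2 ε i i) g x) volume := fun i =>
    integrable_mul_two (memLp_mul (p := 2) (q := ⊤) S.r_two ht) (W2 i i)
  -- Here `eta` is split as the trace of the Hessian kernel, to match the componentwise identities.
  have hlast : ∫ x, (R * r x * th x - (2 * μ + lam) * ∑ i, Dv i i x) * cv (eta ε) g x
      = R * (∑ i, ∫ x, r x * th x * cv (ker2 ε i i) g x)
        - (2 * μ + lam) * ∑ k, ∑ i, ∫ x, Dv k k x * cv (ker2 ε i i) g x := by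
    have I1 : Integrable (fun x => ∑ i, r x * th x * cv (ker2 ε i i) g x) volume :=
      integrable_finsetSum _ fun i _ => iRW i
    have I2 : ∀ k, Integrable (fun x => ∑ i, Dv k k x * cv (ker2 ε i i) g x) volume := fun k =>
      integrable_finsetSum _ fun i _ => iDW k i
    have I3 : Integrable (fun x => ∑ k, ∑ i, Dv k k x * cv (ker2 ε i i) g x) volume :=
      integrable_finsetSum _ fun k _ => I2 k
    simp only [← integral_finsetSum _ fun i _ => iDW _ i]
    rw [← integral_finsetSum _ fun i _ => iRW i, ← integral_finsetSum _ fun k _ => I2 k,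
      ← integral_const_mul, ← integral_const_mul,
      ← integral_sub (I1.const_mul R) (I3.const_mul _)]
    refine integral_congr_ae (.of_forall fun x => ?_)
    simp only [← sum_cv_ker2 hε hg x, Fin.sum_univ_three]; ring
  rw [hlast]
  have k0 := key 0
  have k1 := key 1
  have k2 := key 2
  rw [hcon, hpr] at k0 k1 k2
  -- The Laplacian contributes μ and ∇div contributes μ + λ, both against div v ΔΦ; their sum is the
  -- coefficient 2μ + λ.
  simp only [fun i j => (hvis i j).1, fun i j => (hvis i j).2, Fin.sum_univ_three] at k0 k1 k2 ⊢
  linarith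

/-! ### Bounds for the defect -/

/-- Here ‖r‖₆² = ‖r²‖₃, and one factor of r² goes into the sup norm. -/
lemma eLpNorm_six_sq (S : Slice r Dr v Dv) :
    eLpNorm r 6 volume * eLpNorm r 6 volume ≤ eLpNorm r ⊤ volume * eLpNorm r 3 volume := by
  have h := eLpNorm_norm_rpow (p := 3) (μ := (volume : Measure E3)) r (q := 2) (by norm_num)
  have e : (3 : ℝ≥0∞) * ENNReal.ofReal 2 = 6 := by rw [ENNReal.ofReal_ofNat]; norm_num
  rw [e, ENNReal.rpow_two, sq] at h
  rw [← h]
  have e2 : (fun x => ‖r x‖ ^ (2 : ℝ)) = fun x => r x * r x := by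
    ext x; rw [Real.rpow_two, Real.norm_eq_abs, sq_abs, sq]
  rw [e2]
  exact eLpNorm_mul_le' (p := ⊤) (q := 3) S.r_two.1 S.r_two.1

/-- The factor ‖r‖₆ is kept on purpose: in the convective term it meets a second one, and the square
is then interpolated by `eLpNorm_six_sq`. -/
lemma eLpNorm_cube_two (S : Slice r Dr v Dv) :
    eLpNorm (fun x => r x ^ 3) 2 volume
      ≤ eLpNorm r 6 volume * (eLpNorm r ⊤ volume * eLpNorm r 3 volume) := by
  have e : (fun x => r x ^ 3) = fun x => r x * (r x * r x) := by ext x; ring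
  rw [e]
  refine (eLpNorm_mul_le' (p := 6) (q := 3) S.r_two.1 (S.r_two.1.mul S.r_two.1)).trans ?_
  gcongr
  exact eLpNorm_mul_le' (p := ⊤) (q := 3) S.r_two.1 S.r_two.1

lemma eLpNorm_v_six (S : Slice r Dr v Dv) (j : Fin 3) :
    eLpNorm (v j) 6 volume ≤ sobConst * ∑ i, ∑ j, eLpNorm (Dv i j) 2 volume := by
  refine (eLpNorm_six_le (fun i => S.v_partial i j) (S.v_six j)).trans ?_
  gcongr with i
  exact Finset.single_le_sum (f := fun j => eLpNorm (Dv i j) 2 volume) (fun _ _ => zero_le)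
    (Finset.mem_univ j)

lemma eLpNorm_mul_v_two (S : Slice r Dr v Dv) (j : Fin 3) :
    eLpNorm (fun x => r x * v j x) 2 volume
      ≤ eLpNorm r 3 volume * (sobConst * ∑ i, ∑ j, eLpNorm (Dv i j) 2 volume) := by
  refine (eLpNorm_mul_le' (p := 3) (q := 6) S.r_two.1 (S.v_six j).1).trans ?_
  gcongr
  exact S.eLpNorm_v_six j

/-- The terms of the tested equation that are controlled by the dissipation. -/
noncomputable def defect (r : E3 → ℝ) (v : Fin 3 → E3 → ℝ) (Dv : Fin 3 → Fin 3 → E3 → ℝ)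
    (ε : ℝ) : ℝ :=
  (∑ j, ∑ i, ∫ x, r x * v i x * v j x * cv (ker2 ε j i) (fun y => r y ^ 3) x)
    + ∑ j, (-∑ i, (∫ x, r x * v j x * cv (ker2 ε j i) (fun y => r y ^ 3 * v i y) x)
        - 2 * ∫ x, r x * v j x * cv (ker1 ε j) (fun y => r y ^ 3 * ∑ i, Dv i i y) x)

/-- Every term is a pairing in L² × L². The convective one is ‖r v v‖₂ ≤ ‖r‖₆‖v‖₆² against the
Hessian potential of r³. In the others ‖r v‖₂ ≤ ‖r‖₃‖v‖₆ meets the Hessian potential of r³v, bounded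
on L², or the gradient potential of r³ div v, bounded by ‖r³ div v‖_{6/5} ≤ ‖r³‖₃‖div v‖₂. Sobolev
replaces ‖v‖₆ by the gradient, and all three come out with the same powers. -/
lemma enorm_defect_le (S : Slice r Dr v Dv) {ε : ℝ} (hε : 0 < ε) (h1 : ε ≤ 1) :
    ‖defect r v Dv ε‖ₑ ≤ 36 * sobConst ^ 2 * ENNReal.ofReal etaMass
      * (eLpNorm r ⊤ volume ^ 2 * eLpNorm r 3 volume ^ 2
        * (∑ i, ∑ j, eLpNorm (Dv i j) 2 volume) ^ 2) := by
  set V := ∑ i, ∑ j, eLpNorm (Dv i j) 2 volume with hV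
  set m := eLpNorm r ⊤ volume with hm
  set n := eLpNorm r 3 volume with hn
  set c := ENNReal.ofReal etaMass
  set s : ℝ≥0∞ := (sobConst : ℝ≥0∞)
  have W2 : ∀ {g : E3 → ℝ}, Integrable g volume → ∀ j i, MemLp (cv (ker2 ε j i) g) 2 volume :=
    fun hg j i => memLp_cv_ker2 hε h1 hg (by norm_num) (by simp) j i
  have T1 : ∀ j i, ‖∫ x, r x * v i x * v j x * cv (ker2 ε j i) (fun y => r y ^ 3) x‖ₑ
      ≤ s ^ 2 * c * (m ^ 2 * n ^ 2 * V ^ 2) := by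
    intro j i
    refine (enorm_integral_mul_le (p := 2) (q := 2)
      ((S.r_two.1.mul (S.v_six i).1).mul (S.v_six j).1) (W2 S.cube_integrable j i).1).trans ?_
    have b1 : eLpNorm (fun x => r x * v i x * v j x) 2 volume
        ≤ eLpNorm r 6 volume * ((s * V) * (s * V)) := by
      have e : (fun x => r x * v i x * v j x) = fun x => r x * (v i x * v j x) := by ext x; ring
      rw [e]
      refine (eLpNorm_mul_le' (p := 6) (q := 3) S.r_two.1
        ((S.v_six i).1.mul (S.v_six j).1)).trans ?_
      gcongr
      refine (eLpNorm_mul_le' (p := 6) (q := 6) (S.v_six i).1 (S.v_six j).1).trans ?_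
      exact mul_le_mul' (S.eLpNorm_v_six i) (S.eLpNorm_v_six j)
    have b2 : eLpNorm (cv (ker2 ε j i) (fun y => r y ^ 3)) 2 volume
        ≤ c * (eLpNorm r 6 volume * (m * n)) := by
      refine (eLpNorm_cv_ker2_le hε h1 S.cube_integrable j i).trans ?_
      gcongr
      exact S.eLpNorm_cube_two
    calc _ ≤ eLpNorm r 6 volume * ((s * V) * (s * V)) * (c * (eLpNorm r 6 volume * (m * n))) :=
          mul_le_mul' b1 b2
      _ = s ^ 2 * c * ((eLpNorm r 6 volume * eLpNorm r 6 volume) * (m * n) * V ^ 2) := by ring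
      _ ≤ s ^ 2 * c * ((m * n) * (m * n) * V ^ 2) :=
          mul_le_mul_right (mul_le_mul_left (mul_le_mul_left S.eLpNorm_six_sq _) _) _
      _ = _ := by ring
  have T2 : ∀ j i, ‖∫ x, r x * v j x * cv (ker2 ε j i) (fun y => r y ^ 3 * v i y) x‖ₑ
      ≤ s ^ 2 * c * (m ^ 2 * n ^ 2 * V ^ 2) := by
    intro j i
    refine (enorm_integral_mul_le (p := 2) (q := 2) (S.mul_v_two j).1
      (W2 (S.cube_mul_integrable i) j i).1).trans ?_
    have b2 : eLpNorm (cv (ker2 ε j i) (fun y => r y ^ 3 * v i y)) 2 volume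
        ≤ c * (m * m * (n * (s * V))) := by
      refine (eLpNorm_cv_ker2_le hε h1 (S.cube_mul_integrable i) j i).trans ?_
      gcongr
      have e : (fun x => r x ^ 3 * v i x) = fun x => (r x * r x) * (r x * v i x) := by
        ext x; ring
      rw [e]
      refine (eLpNorm_mul_le' (p := ⊤) (q := 2) S.sq_two.1 (S.mul_v_two i).1).trans ?_
      gcongr
      · exact eLpNorm_mul_le' (p := ⊤) (q := ⊤) S.r_two.1 S.r_two.1
      · exact S.eLpNorm_mul_v_two i
    calc _ ≤ n * (s * V) * (c * (m * m * (n * (s * V)))) := mul_le_mul' (S.eLpNorm_mul_v_two j) b2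
      _ = _ := by ring
  have T3 : ∀ j, ‖∫ x, r x * v j x * cv (ker1 ε j) (fun y => r y ^ 3 * ∑ i, Dv i i y) x‖ₑ
      ≤ 3 * (s ^ 2 * c * (m ^ 2 * n ^ 2 * V ^ 2)) := by
    intro j
    have hdv : MemLp (fun x => ∑ i, Dv i i x) 2 volume :=
      memLp_finsetSum _ fun i _ => S.Dv_two i i
    have c3 : MemLp (fun x => r x ^ 3) 3 volume :=
      memLp_of_two_top S.cube_two S.cube_top (by norm_num) (by simp)
    refine (enorm_integral_mul_le (p := 2) (q := 2) (S.mul_v_two j).1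
      (memLp_cv_ker1 (p := 2) hε h1 S.cube_div_integrable (by norm_num) (by simp) (by norm_num)
        j).1).trans ?_
    have b2 : eLpNorm (cv (ker1 ε j) (fun y => r y ^ 3 * ∑ i, Dv i i y)) 2 volume
        ≤ 3 * s * c * (m * m * n * V) := by
      refine (eLpNorm_cv_ker1_le hε h1 S.cube_div_integrable
        (memLp_mul (p := 3) (q := 2) c3 hdv) j).trans ?_
      gcongr
      refine (eLpNorm_mul_le' (p := 3) (q := 2) c3.1 hdv.1).trans ?_
      gcongr
      · have e : (fun x => r x ^ 3) = fun x => (r x * r x) * r x := by ext x; ring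
        rw [e]
        refine (eLpNorm_mul_le' (p := ⊤) (q := 3) S.sq_two.1 S.r_two.1).trans ?_
        gcongr
        exact eLpNorm_mul_le' (p := ⊤) (q := ⊤) S.r_two.1 S.r_two.1
      · have e : (fun x => ∑ i, Dv i i x) = ∑ i, Dv i i := by ext x; simp
        rw [e]
        refine (eLpNorm_sum_le (fun i _ => (S.Dv_two i i).1) (by norm_num)).trans ?_
        rw [hV]
        gcongr with i
        exact Finset.single_le_sum (f := fun j => eLpNorm (Dv i j) 2 volume) (fun _ _ => zero_le)
          (Finset.mem_univ i)
    calc _ ≤ n * (s * V) * (3 * s * c * (m * m * n * V)) := mul_le_mul' (S.eLpNorm_mul_v_two j) b2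
      _ = _ := by ring
  set Z := s ^ 2 * c * (m ^ 2 * n ^ 2 * V ^ 2) with hZ
  have esum : ∀ f : Fin 3 → ℝ, ‖∑ i, f i‖ₑ ≤ ∑ i, ‖f i‖ₑ := fun f => enorm_sum_le _ _
  have B1 : ‖∑ j, ∑ i, ∫ x, r x * v i x * v j x * cv (ker2 ε j i) (fun y => r y ^ 3) x‖ₑ
      ≤ 9 * Z := by
    refine (esum _).trans ((Finset.sum_le_sum fun j _ => (esum _).trans
      (Finset.sum_le_sum fun i _ => T1 j i)).trans (le_of_eq ?_))
    simp; ring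
  have B2 : ∀ j, ‖-∑ i, (∫ x, r x * v j x * cv (ker2 ε j i) (fun y => r y ^ 3 * v i y) x)
        - 2 * ∫ x, r x * v j x * cv (ker1 ε j) (fun y => r y ^ 3 * ∑ i, Dv i i y) x‖ₑ
      ≤ 9 * Z := by
    intro j
    refine (enorm_sub_le).trans ?_
    rw [enorm_neg, enorm_mul]
    have e2 : ‖(2 : ℝ)‖ₑ = 2 := by rw [Real.enorm_eq_ofReal (by norm_num)]; simp
    rw [e2]
    calc _ ≤ 3 * Z + 2 * (3 * Z) := by
          gcongr
          · refine (esum _).trans ((Finset.sum_le_sum fun i _ => T2 j i).trans (le_of_eq ?_))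
            simp
          · exact T3 j
      _ = 9 * Z := by ring
  refine (enorm_add_le _ _).trans ?_
  -- There are nine convective terms, and for each of the three j a contribution 3Z + 2·3Z from the
  -- potential of ∂ₜr³.
  calc _ ≤ 9 * Z + 27 * Z := by
        gcongr
        refine (esum _).trans ((Finset.sum_le_sum fun j _ => B2 j).trans (le_of_eq ?_))
        simp; ring
    _ = _ := by rw [hZ]; ring

end Slice

/-! ### Bound for the pairing of momentum and potential -/

lemma eLpNorm_cube_one (r : E3 → ℝ) : ∫⁻ x, ‖r x ^ 3‖ₑ = eLpNorm r 3 volume ^ 3 := by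
  rw [eLpNorm_eq_lintegral_rpow_enorm_toReal (by simp) (by simp), ← ENNReal.rpow_natCast,
    ← ENNReal.rpow_mul]
  simp

lemma exists_ae_nnnorm_le {r : E3 → ℝ} (h : MemLp r ⊤ volume) :
    ∃ M : ℝ≥0, (M : ℝ≥0∞) = eLpNorm r ⊤ volume ∧ ∀ᵐ x, |r x| ≤ M := by
  refine ⟨(eLpNorm r ⊤ volume).toNNReal, ENNReal.coe_toNNReal h.2.ne, ?_⟩
  have := ae_le_eLpNormEssSup (f := r) (μ := (volume : Measure E3))
  filter_upwards [this] with x hx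
  rw [← eLpNorm_exponent_top, ← ENNReal.coe_toNNReal h.2.ne] at hx
  rw [← Real.norm_eq_abs, ← coe_nnnorm]
  exact_mod_cast hx

lemma eLpNorm_le_mul_of_ae {M : ℝ≥0} {f : E3 → ℝ} {F : Type*} [NormedAddCommGroup F] {g : E3 → F}
    {p : ℝ≥0∞} (h : ∀ᵐ x, ‖f x‖ ≤ M * ‖g x‖) :
    eLpNorm f p volume ≤ M * eLpNorm g p volume := by
  have := eLpNorm_le_nnreal_smul_eLpNorm_of_ae_le_mul (c := M) (f := f) (g := g)
    (μ := (volume : Measure E3)) (by filter_upwards [h] with x hx; exact_mod_cast hx) p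
  simpa [ENNReal.smul_def] using this

/-- The momentum paired with the potential is bounded by weighted norms of the velocity. -/
lemma exists_pairing_bound : ∃ C : ℝ≥0, ∀ (r : E3 → ℝ) (U : E3 → E3), MemLp r 2 volume →
    MemLp r ⊤ volume → (∀ᵐ x, 0 ≤ r x) →
    (∀ j, MemLp (fun x => U x j) ⊤ volume) → ∀ ε, 0 < ε → ε ≤ 1 → ∀ j,
    ‖∫ x, r x * U x j * cv (ker1 ε j) (fun y => r y ^ 3) x‖ₑ
      ≤ C * (eLpNorm r ⊤ volume ^ (2 / 3 : ℝ)
        * eLpNorm (fun x => Real.sqrt (r x) • U x) 2 volume ^ (1 / 3 : ℝ)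
        * eLpNorm (fun x => Real.sqrt (r x) * ‖U x‖ ^ 2) 2 volume ^ (1 / 3 : ℝ)
        * eLpNorm r 3 volume ^ 3) := by
  obtain ⟨C, hC⟩ := exists_riesz_interp
  refine ⟨C, fun r U h2 ht h0 hU ε hε h1 j => ?_⟩
  obtain ⟨M, hM, hMb⟩ := exists_ae_nnnorm_le ht
  set f : E3 → ℝ := fun x => r x * U x j with hf
  have f2 : MemLp f 2 volume := memLp_mul (p := 2) (q := ⊤) h2 (hU j)
  have f4 : MemLp f 4 volume := memLp_of_two_top f2 (memLp_mul (p := ⊤) (q := ⊤) ht (hU j))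
    (by norm_num) (by simp)
  -- From r|U| = √r · √r|U|.
  have fA : eLpNorm f 2 volume
      ≤ (M ^ (1 / 2 : ℝ) : ℝ≥0) * eLpNorm (fun x => Real.sqrt (r x) • U x) 2 volume := by
    refine eLpNorm_le_mul_of_ae ?_
    filter_upwards [h0, hMb] with x hx hxM
    rw [abs_of_nonneg hx] at hxM
    have hu : ‖U x j‖ ≤ ‖U x‖ := PiLp.norm_apply_le _ _
    rw [norm_mul, norm_smul, Real.norm_of_nonneg hx, Real.norm_of_nonneg (Real.sqrt_nonneg _),
      NNReal.coe_rpow, ← Real.sqrt_eq_rpow]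
    calc r x * ‖U x j‖ = Real.sqrt (r x) * (Real.sqrt (r x) * ‖U x j‖) := by
          rw [← mul_assoc, Real.mul_self_sqrt hx]
      _ ≤ Real.sqrt M * (Real.sqrt (r x) * ‖U x‖) := by gcongr
  -- From r|U| = r^{3/4} (√r|U|²)^{1/2}; the L⁴ norm of the square root is the square root of the L²
  -- norm.
  have fB : eLpNorm f 4 volume ≤ (M ^ (3 / 4 : ℝ) : ℝ≥0)
      * eLpNorm (fun x => Real.sqrt (r x) * ‖U x‖ ^ 2) 2 volume ^ (1 / 2 : ℝ) := by
    have hn := eLpNorm_norm_rpow (p := 4) (μ := (volume : Measure E3))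
      (fun x => Real.sqrt (r x) * ‖U x‖ ^ 2) (q := 1 / 2) (by norm_num)
    have e : (4 : ℝ≥0∞) * ENNReal.ofReal (1 / 2) = 2 := by
      rw [← ENNReal.ofReal_ofNat, ← ENNReal.ofReal_mul (by norm_num)]; norm_num
    rw [e] at hn
    rw [← hn]
    refine eLpNorm_le_mul_of_ae ?_
    filter_upwards [h0, hMb] with x hx hxM
    rw [abs_of_nonneg hx] at hxM
    have hu : ‖U x j‖ ≤ ‖U x‖ := PiLp.norm_apply_le _ _
    have hs := Real.sqrt_nonneg (r x)
    rw [norm_mul, Real.norm_of_nonneg hx, NNReal.coe_rpow]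
    have en : ‖‖Real.sqrt (r x) * ‖U x‖ ^ 2‖ ^ (1 / 2 : ℝ)‖
        = (Real.sqrt (r x) * ‖U x‖ ^ 2) ^ (1 / 2 : ℝ) := by
      rw [Real.norm_of_nonneg (by positivity), Real.norm_of_nonneg (by positivity)]
    rw [en, Real.mul_rpow hs (by positivity), ← Real.rpow_natCast ‖U x‖ 2,
      ← Real.rpow_mul (norm_nonneg _), Real.sqrt_eq_rpow, ← Real.rpow_mul hx]
    norm_num
    have e3 : r x = r x ^ (3 / 4 : ℝ) * r x ^ (1 / 4 : ℝ) := by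
      rw [← Real.rpow_add_of_nonneg hx (by norm_num) (by norm_num)]; norm_num
    calc r x * |U x j| = r x ^ (3 / 4 : ℝ) * (r x ^ (1 / 4 : ℝ) * |U x j|) := by
          rw [← mul_assoc, ← e3]
      _ ≤ (M : ℝ) ^ (3 / 4 : ℝ) * (r x ^ (1 / 4 : ℝ) * ‖U x‖) := by
          gcongr
          exact hu
  set A := eLpNorm (fun x => Real.sqrt (r x) • U x) 2 volume
  set B := eLpNorm (fun x => Real.sqrt (r x) * ‖U x‖ ^ 2) 2 volume
  have hAB : eLpNorm f 2 volume ^ (1 / 3 : ℝ) * eLpNorm f 4 volume ^ (2 / 3 : ℝ)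
      ≤ eLpNorm r ⊤ volume ^ (2 / 3 : ℝ) * A ^ (1 / 3 : ℝ) * B ^ (1 / 3 : ℝ) := by
    calc _ ≤ ((M ^ (1 / 2 : ℝ) : ℝ≥0) * A) ^ (1 / 3 : ℝ)
          * ((M ^ (3 / 4 : ℝ) : ℝ≥0) * B ^ (1 / 2 : ℝ)) ^ (2 / 3 : ℝ) := by gcongr
      _ = (M : ℝ≥0∞) ^ (2 / 3 : ℝ) * A ^ (1 / 3 : ℝ) * B ^ (1 / 3 : ℝ) := by
          rw [ENNReal.mul_rpow_of_nonneg _ _ (by norm_num),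
            ENNReal.mul_rpow_of_nonneg _ _ (by norm_num), ← ENNReal.rpow_mul,
            ENNReal.coe_rpow_of_nonneg _ (by norm_num), ENNReal.coe_rpow_of_nonneg _ (by norm_num),
            ← ENNReal.rpow_mul, ← ENNReal.rpow_mul]
          -- The exponent of the sup norm is 2/3 = ½·⅓ + ¾·⅔.
          have : (M : ℝ≥0∞) ^ (2 / 3 : ℝ)
              = (M : ℝ≥0∞) ^ (1 / 2 * (1 / 3) : ℝ) * (M : ℝ≥0∞) ^ (3 / 4 * (2 / 3) : ℝ) := by
            rw [← ENNReal.rpow_add_of_nonneg _ _ (by norm_num) (by norm_num)]; norm_num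
          rw [this]
          norm_num
          ring
      _ = _ := by rw [hM]
  -- The kernel is symmetric, so it can be moved onto the momentum. Its potential is bounded in sup
  -- norm, and the density then enters only through ∫ r³.
  have hswap : ∫⁻ x, ‖f x‖ₑ * ∫⁻ y, ENNReal.ofReal (‖x - y‖ ^ (-2 : ℝ)) * ‖r y ^ 3‖ₑ
      = ∫⁻ y, (∫⁻ x, ENNReal.ofReal (‖y - x‖ ^ (-2 : ℝ)) * ‖f x‖ₑ) * ‖r y ^ 3‖ₑ := by
    have mr : AEMeasurable (fun y => ‖r y ^ 3‖ₑ) volume := (h2.1.pow 3).enorm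
    have mk : Measurable (fun z : E3 × E3 => ENNReal.ofReal (‖z.1 - z.2‖ ^ (-2 : ℝ))) :=
      ((measurable_fst.sub measurable_snd).norm.pow_const _).ennreal_ofReal
    calc _ = ∫⁻ x, ∫⁻ y, ‖f x‖ₑ * (ENNReal.ofReal (‖x - y‖ ^ (-2 : ℝ)) * ‖r y ^ 3‖ₑ) := by
          refine lintegral_congr fun x => (lintegral_const_mul'' _ ?_).symm
          exact (mk.comp measurable_prodMk_left).aemeasurable.mul mr
      _ = ∫⁻ y, ∫⁻ x, ‖f x‖ₑ * (ENNReal.ofReal (‖x - y‖ ^ (-2 : ℝ)) * ‖r y ^ 3‖ₑ) := by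
          refine lintegral_lintegral_swap ?_
          exact (f2.1.enorm.comp_fst).mul (mk.aemeasurable.mul mr.comp_snd)
      _ = _ := by
          refine lintegral_congr fun y => ?_
          rw [← lintegral_mul_const'' _ ?_]
          · refine lintegral_congr fun x => ?_
            rw [norm_sub_rev y x]; ring
          · exact (((measurable_const.sub measurable_id).norm.pow_const _).ennreal_ofReal).aemeasurable.mul
              f2.1.enorm
  calc ‖∫ x, f x * cv (ker1 ε j) (fun y => r y ^ 3) x‖ₑ
      ≤ ∫⁻ x, ‖f x‖ₑ * ∫⁻ y, ENNReal.ofReal (‖x - y‖ ^ (-2 : ℝ)) * ‖r y ^ 3‖ₑ := by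
        refine (enorm_integral_le_lintegral_enorm _).trans (lintegral_mono fun x => ?_)
        rw [enorm_mul]
        gcongr
        exact enorm_cv_ker1_le hε j _ x
    _ = ∫⁻ y, (∫⁻ x, ENNReal.ofReal (‖y - x‖ ^ (-2 : ℝ)) * ‖f x‖ₑ) * ‖r y ^ 3‖ₑ := hswap
    _ ≤ ∫⁻ y, (C * (eLpNorm r ⊤ volume ^ (2 / 3 : ℝ) * A ^ (1 / 3 : ℝ) * B ^ (1 / 3 : ℝ)))
          * ‖r y ^ 3‖ₑ := by
        refine lintegral_mono fun y => ?_
        gcongr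
        refine (hC f f2 f4 y).trans ?_
        gcongr
    _ = _ := by
        have mr : AEMeasurable (fun y => ‖r y ^ 3‖ₑ) volume := (h2.1.pow 3).enorm
        rw [lintegral_const_mul'' _ mr, eLpNorm_cube_one]
        ring


/-! ### Functions that are absolutely continuous in time for almost every space point -/

/-- Integration by parts for absolutely continuous functions, together with the fact that a
primitive has its integrand as derivative almost everywhere. -/
lemma primitive_mul {f g : ℝ → ℝ} {T : ℝ} (hf : IntegrableOn f (Ioo 0 T) volume)
    (hg : IntegrableOn g (Ioo 0 T) volume) (a b : ℝ) {t : ℝ} (ht : t ∈ Icc 0 T) :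
    (a + ∫ s in 0..t, f s) * (b + ∫ s in 0..t, g s)
      = a * b + ∫ s in 0..t, (f s * (b + ∫ τ in 0..s, g τ) + (a + ∫ τ in 0..s, f τ) * g s) := by
  have conv : ∀ {f : ℝ → ℝ}, IntegrableOn f (Ioo 0 T) volume → IntervalIntegrable f volume 0 t := by
    intro f hf
    rw [intervalIntegrable_iff_integrableOn_Ioo_of_le ht.1]
    exact hf.mono_set (Ioo_subset_Ioo_right ht.2)
  have ac : ∀ {f : ℝ → ℝ} (a : ℝ), IntervalIntegrable f volume 0 t →
      AbsolutelyContinuousOnInterval (fun s => a + ∫ τ in 0..s, f τ) 0 t := by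
    intro f a hf
    have h1 := hf.absolutelyContinuousOnInterval_intervalIntegral (c := 0) (by simp)
    have h2 : AbsolutelyContinuousOnInterval (fun _ : ℝ => a) 0 t :=
      (LipschitzWith.const a).lipschitzOnWith.absolutelyContinuousOnInterval
    exact h2.add h1
  have hd : ∀ {f : ℝ → ℝ} (a : ℝ), IntervalIntegrable f volume 0 t →
      ∀ᵐ s, s ∈ uIcc 0 t → deriv (fun s => a + ∫ τ in 0..s, f τ) s = f s := by
    intro f a hf
    filter_upwards [hf.ae_hasDerivAt_integral] with s hs hs'
    exact ((hs hs' 0 (by simp)).const_add a).deriv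
  have key := (ac a (conv hf)).integral_deriv_mul_eq_sub (ac b (conv hg))
  simp only [intervalIntegral.integral_same, add_zero] at key
  rw [← sub_eq_iff_eq_add', ← key]
  refine intervalIntegral.integral_congr_ae ?_
  filter_upwards [hd a (conv hf), hd b (conv hg)] with s h1 h2 hs
  rw [h1 (uIoc_subset_uIcc hs), h2 (uIoc_subset_uIcc hs)]

variable {X Y : Type*} [MeasurableSpace X] [MeasurableSpace Y]

/-- The set where `f` and `g` agree need not be measurable, so the passage from iterated to joint
null sets goes through strongly measurable representatives. -/
lemma ae_prod_eq_of_ae_ae_eq {μ : Measure X} {ν : Measure Y} [SFinite μ] [SFinite ν]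
    {f g : X × Y → ℝ} (hf : AEStronglyMeasurable f (μ.prod ν))
    (hg : AEStronglyMeasurable g (μ.prod ν))
    (h : ∀ᵐ x ∂μ, ∀ᵐ y ∂ν, f (x, y) = g (x, y)) : f =ᵐ[μ.prod ν] g := by
  have e := (Measure.ae_prod_iff_ae_ae (μ := μ) (ν := ν) (p := fun z => hf.mk f z = hg.mk g z)
    (measurableSet_eq_fun hf.stronglyMeasurable_mk.measurable
      hg.stronglyMeasurable_mk.measurable)).2 (by
    filter_upwards [h, Measure.ae_ae_of_ae_prod hf.ae_eq_mk, Measure.ae_ae_of_ae_prod hg.ae_eq_mk]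
      with x hx h1 h2
    filter_upwards [hx, h1, h2] with y hy h1 h2
    rw [← h1, ← h2, hy])
  filter_upwards [e, hf.ae_eq_mk, hg.ae_eq_mk] with z h1 h2 h3
  rw [h2, h3, h1]

lemma ae_ae_swap_of_ae_prod {μ : Measure X} {ν : Measure Y} [SFinite μ] [SFinite ν]
    {p : X × Y → Prop} (h : ∀ᵐ z ∂μ.prod ν, p z) : ∀ᵐ y ∂ν, ∀ᵐ x ∂μ, p (x, y) := by
  have : ∀ᵐ z ∂ν.prod μ, p z.swap := by
    rw [← Measure.prod_swap] at h
    exact ae_of_ae_map measurable_swap.aemeasurable h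
  exact Measure.ae_ae_of_ae_prod this

/-- `f t x = f 0 x + ∫₀ᵗ ft s x ds` on `[0,T]`, for almost every `x`. -/
structure TimeAC (μ : Measure X) (T : ℝ) (f ft : ℝ → X → ℝ) : Prop where
  meas : AEStronglyMeasurable (fun z : ℝ × X => f z.1 z.2) ((volume.restrict (Ioo 0 T)).prod μ)
  meas_t : AEStronglyMeasurable (fun z : ℝ × X => ft z.1 z.2) ((volume.restrict (Ioo 0 T)).prod μ)
  meas_zero : AEStronglyMeasurable (f 0) μ
  int : ∀ᵐ x ∂μ, IntegrableOn (fun s => ft s x) (Ioo 0 T) volume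
  eq : ∀ t ∈ Icc 0 T, ∀ᵐ x ∂μ, f t x = f 0 x + ∫ s in 0..t, ft s x

namespace TimeAC

variable {μ : Measure X} [SFinite μ] {T : ℝ} {f ft g gt : ℝ → X → ℝ}

/-- The primitive is a parameter integral of the function cut off at {s < t}, which is jointly
measurable on the triple product. -/
lemma meas_primitive (h : TimeAC μ T f ft) :
    AEStronglyMeasurable (fun z : ℝ × X => f 0 z.2 + ∫ s in 0..z.1, ft s z.2)
      ((volume.restrict (Ioo 0 T)).prod μ) := by
  refine h.meas_zero.comp_snd.add ?_
  set lam := (volume.restrict (Ioo 0 T) : Measure ℝ)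
  have hq : Measure.QuasiMeasurePreserving (fun w : (ℝ × X) × ℝ => (w.2, w.1.2))
      ((lam.prod μ).prod lam) (lam.prod μ) := by
    have h1 : Measure.QuasiMeasurePreserving (Prod.map (Prod.snd : ℝ × X → X) (id : ℝ → ℝ))
        ((lam.prod μ).prod lam) (μ.prod lam) :=
      MeasureTheory.QuasiMeasurePreserving.prodMap Measure.quasiMeasurePreserving_snd (.id lam)
    have h2 : Measure.QuasiMeasurePreserving (Prod.swap : X × ℝ → ℝ × X) (μ.prod lam)
        (lam.prod μ) := Measure.measurePreserving_swap.quasiMeasurePreserving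
    exact h2.comp h1
  have m1 : AEStronglyMeasurable (fun w : (ℝ × X) × ℝ => ft w.2 w.1.2)
      ((lam.prod μ).prod lam) := h.meas_t.comp_quasiMeasurePreserving hq
  have m2 : AEStronglyMeasurable
      ({w : (ℝ × X) × ℝ | w.2 < w.1.1}.indicator fun w => ft w.2 w.1.2)
      ((lam.prod μ).prod lam) :=
    m1.indicator (measurableSet_lt measurable_snd measurable_fst.fst)
  refine m2.integral_prod_right'.congr ?_
  have hz : ∀ᵐ z ∂(lam.prod μ), z.1 ∈ Ioo 0 T :=
    Measure.quasiMeasurePreserving_fst.ae (ae_restrict_mem measurableSet_Ioo)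
  filter_upwards [hz] with z hz
  rw [intervalIntegral.integral_of_le hz.1.le, integral_Ioc_eq_integral_Ioo]
  have e : ∀ s, ({w : (ℝ × X) × ℝ | w.2 < w.1.1}.indicator (fun w => ft w.2 w.1.2)) (z, s)
      = (Iio z.1).indicator (fun s => ft s z.2) s := by
    intro s
    simp only [indicator, mem_ofPred_eq, mem_Iio]
  simp only [e]
  rw [integral_indicator measurableSet_Iio, Measure.restrict_restrict measurableSet_Iio]
  congr 2
  ext s
  simp only [mem_inter_iff, mem_Iio, mem_Ioo]
  exact ⟨fun h => ⟨h.2.1, h.1⟩, fun h => ⟨h.2, h.1, h.2.trans hz.2⟩⟩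

/-- The exceptional null set in `TimeAC.eq` depends on the time. Fubini exchanges the order, so that
for almost every x the identity holds at almost all times and can be used under time integrals. -/
lemma ae_eq (h : TimeAC μ T f ft) :
    ∀ᵐ x ∂μ, ∀ᵐ s ∂(volume.restrict (Ioo 0 T)), f s x = f 0 x + ∫ τ in 0..s, ft τ x := by
  refine ae_ae_swap_of_ae_prod (p := fun z => f z.1 z.2 = f 0 z.2 + ∫ τ in 0..z.1, ft τ z.2) ?_
  refine ae_prod_eq_of_ae_ae_eq h.meas h.meas_primitive ?_
  filter_upwards [ae_restrict_mem measurableSet_Ioo] with s hs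
  exact h.eq s ⟨hs.1.le, hs.2.le⟩

lemma integrableOn_mul_primitive {u w : ℝ → ℝ} {T : ℝ} (hu : IntegrableOn u (Ioo 0 T) volume)
    (hw : IntegrableOn w (Ioo 0 T) volume) (b : ℝ) :
    IntegrableOn (fun s => u s * (b + ∫ τ in 0..s, w τ)) (Ioo 0 T) volume := by
  rcases le_or_gt T 0 with hT | hT
  · simp [Ioo_eq_empty_of_le hT]
  rw [← integrableOn_Icc_iff_integrableOn_Ioo] at hu hw ⊢
  refine hu.mul_continuousOn ?_ isCompact_Icc
  refine continuousOn_const.add ?_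
  rw [← uIcc_of_le hT.le] at hw ⊢
  exact intervalIntegral.continuousOn_primitive_interval hw

/-- For almost every x both factors are primitives, so the product rule in one variable applies;
under the integral the primitives are replaced by the functions, with which they agree at almost all
times. -/
lemma mul (hf : TimeAC μ T f ft) (hg : TimeAC μ T g gt) :
    TimeAC μ T (fun t x => f t x * g t x) (fun t x => ft t x * g t x + f t x * gt t x) where
  meas := hf.meas.mul hg.meas
  meas_t := (hf.meas_t.mul hg.meas).add (hf.meas.mul hg.meas_t)
  meas_zero := hf.meas_zero.mul hg.meas_zero
  int := by
    filter_upwards [hf.int, hg.int, hf.ae_eq, hg.ae_eq] with x h1 h2 h3 h4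
    have := (integrableOn_mul_primitive h1 h2 (g 0 x)).add
      (integrableOn_mul_primitive h2 h1 (f 0 x))
    refine this.congr ?_
    filter_upwards [h3, h4] with s h3 h4
    simp only [Pi.add_apply, ← h3, ← h4]; ring
  eq := by
    intro t ht
    filter_upwards [hf.int, hg.int, hf.ae_eq, hg.ae_eq, hf.eq t ht, hg.eq t ht]
      with x h1 h2 h3 h4 h5 h6
    rw [h5, h6, primitive_mul h1 h2 _ _ ht]
    congr 1
    refine intervalIntegral.integral_congr_ae ?_
    rw [ae_restrict_iff' measurableSet_Ioo] at h3 h4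
    -- The interval integral includes its right endpoint, whereas the identities are known on the
    -- open interval only.
    have hne : ∀ᵐ s : ℝ, s ≠ T := by simp [ae_iff, measure_singleton]
    filter_upwards [h3, h4, hne] with s h3 h4 hne hs
    rw [uIoc_of_le ht.1] at hs
    have hs' : s ∈ Ioo 0 T := ⟨hs.1, lt_of_le_of_ne (hs.2.trans ht.2) hne⟩
    rw [h3 hs', h4 hs']

/-- Used with the two projections of ℝ³ × ℝ³, to treat products of a function of x and a function of
y. -/
lemma comp {ν : Measure Y} [SFinite ν] {π : Y → X} (hπ : Measure.QuasiMeasurePreserving π ν μ)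
    (hf : TimeAC μ T f ft) : TimeAC ν T (fun t y => f t (π y)) (fun t y => ft t (π y)) := by
  have hq : Measure.QuasiMeasurePreserving (Prod.map (id : ℝ → ℝ) π)
      ((volume.restrict (Ioo 0 T)).prod ν) ((volume.restrict (Ioo 0 T)).prod μ) :=
    MeasureTheory.QuasiMeasurePreserving.prodMap (.id _) hπ
  exact ⟨hf.meas.comp_quasiMeasurePreserving hq, hf.meas_t.comp_quasiMeasurePreserving hq,
    hf.meas_zero.comp_quasiMeasurePreserving hπ, hπ.ae hf.int, fun t ht => hπ.ae (hf.eq t ht)⟩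

/-- Integration against a weight. -/
lemma integral_eq (hf : TimeAC μ T f ft) (k : X → ℝ) {t : ℝ} (ht : t ∈ Icc 0 T)
    (h0 : Integrable (fun x => k x * f 0 x) μ)
    (hi : Integrable (fun z : ℝ × X => k z.2 * ft z.1 z.2) ((volume.restrict (Ioo 0 T)).prod μ)) :
    ∫ x, k x * f t x ∂μ = (∫ x, k x * f 0 x ∂μ) + ∫ s in 0..t, ∫ x, k x * ft s x ∂μ := by
  have hle : (volume.restrict (Ioo 0 t) : Measure ℝ) ≤ volume.restrict (Ioo 0 T) :=
    Measure.restrict_mono (Ioo_subset_Ioo_right ht.2) le_rfl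
  have hi' : Integrable (fun z : ℝ × X => k z.2 * ft z.1 z.2)
      ((volume.restrict (Ioo 0 t)).prod μ) := hi.mono_measure (Measure.prod_mono hle le_rfl)
  have e : ∀ᵐ x ∂μ, k x * f t x = k x * f 0 x + ∫ s in Ioo 0 t, k x * ft s x := by
    filter_upwards [hf.eq t ht] with x hx
    rw [hx, mul_add, intervalIntegral.integral_of_le ht.1, integral_Ioc_eq_integral_Ioo,
      integral_const_mul]
  rw [integral_congr_ae e, integral_add h0 hi'.integral_prod_right,
    intervalIntegral.integral_of_le ht.1, integral_Ioc_eq_integral_Ioo]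
  congr 1
  exact (integral_integral_swap hi').symm

end TimeAC


/-! ### Weak time derivatives -/

lemma exists_Icc_of_compact_subset {T : ℝ} (hT : 0 < T) {K : Set ℝ} (hK : IsCompact K)
    (h : K ⊆ Ioo 0 T) : ∃ α β, α ∈ Ioo 0 T ∧ β ∈ Ioo 0 T ∧ K ⊆ Icc α β := by
  -- The midpoint is inserted so that extreme points exist even if `K` is empty.
  have hK' : IsCompact (insert (T / 2) K) := hK.insert _
  have hs : insert (T / 2) K ⊆ Ioo 0 T := insert_subset ⟨by linarith, by linarith⟩ h
  obtain ⟨α, hα⟩ := hK'.exists_isLeast ⟨_, mem_insert _ _⟩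
  obtain ⟨β, hβ⟩ := hK'.exists_isGreatest ⟨_, mem_insert _ _⟩
  exact ⟨α, β, hs hα.1, hs hβ.1, fun x hx =>
    ⟨hα.2 (mem_insert_of_mem _ hx), hβ.2 (mem_insert_of_mem _ hx)⟩⟩

/-- A test function on an interval with vanishing integral has a primitive that is a test
function. -/
lemma exists_primitive_test {T : ℝ} (hT : 0 < T) {g : ℝ → ℝ} (hg : ContDiff ℝ ∞ g)
    (hc : HasCompactSupport g) (hs : tsupport g ⊆ Ioo 0 T) (h0 : ∫ t, g t = 0) :
    ∃ φ : ℝ → ℝ, ContDiff ℝ ∞ φ ∧ HasCompactSupport φ ∧ tsupport φ ⊆ Ioo 0 T ∧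
      ∀ t, deriv φ t = g t := by
  obtain ⟨α, β, hα, hβ, hK⟩ := exists_Icc_of_compact_subset hT hc hs
  have hz : ∀ t, t ∉ Icc α β → g t = 0 := fun t ht =>
    image_eq_zero_of_notMem_tsupport fun h => ht (hK h)
  have hd : ∀ t, HasDerivAt (fun t => ∫ s in 0..t, g s) (g t) t := fun t =>
    intervalIntegral.integral_hasDerivAt_right (hg.continuous.intervalIntegrable _ _)
      (hg.continuous.stronglyMeasurableAtFilter _ _) hg.continuous.continuousAt
  have hder : deriv (fun t => ∫ s in 0..t, g s) = g := funext fun t => (hd t).deriv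
  have hsupp : ∀ t, t ∉ Icc α β → ∫ s in 0..t, g s = 0 := by
    intro t ht
    rcases lt_or_ge t α with h | h
    · refine (intervalIntegral.integral_congr (g := fun _ => 0) fun s hs => ?_).trans (by simp)
      refine hz s fun hs' => ?_
      have h2 : s ≤ max 0 t := hs.2
      exact absurd (hs'.1.trans h2) (not_le.2 (max_lt hα.1 h))
    · have hβt : β < t := by
        by_contra h'
        exact ht ⟨h, not_lt.1 h'⟩
      rw [intervalIntegral.integral_of_le (hβ.1.trans hβt).le]
      refine Eq.trans ?_ h0
      refine setIntegral_eq_integral_of_forall_compl_eq_zero fun s hs => hz s fun hs' => hs ?_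
      exact ⟨hα.1.trans_le hs'.1, hs'.2.trans hβt.le⟩
  have hts : tsupport (fun t => ∫ s in 0..t, g s) ⊆ Icc α β :=
    closure_minimal (fun t ht => by by_contra h; exact ht (hsupp t h)) isClosed_Icc
  refine ⟨fun t => ∫ s in 0..t, g s, ?_, HasCompactSupport.of_support_subset_isCompact
    isCompact_Icc (subset_closure.trans hts), hts.trans fun t ht =>
      ⟨hα.1.trans_le ht.1, ht.2.trans_lt hβ.2⟩, fun t => (hd t).deriv⟩
  rw [contDiff_infty_iff_deriv, hder]
  exact ⟨fun t => (hd t).differentiableAt, hg⟩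

/-- The du Bois-Reymond argument: `h` minus the primitive of `H` has zero weak derivative, hence is
constant. Continuity on the closed interval extends this to the endpoints, so the value at time 0 is
available. -/
lemma eq_primitive_of_weak {T : ℝ} (hT : 0 < T) {h H : ℝ → ℝ} (hh : ContinuousOn h (Icc 0 T))
    (hH : IntegrableOn H (Ioo 0 T) volume)
    (hw : ∀ φ : ℝ → ℝ, ContDiff ℝ ∞ φ → HasCompactSupport φ → tsupport φ ⊆ Ioo 0 T →
      ∫ t in Ioo 0 T, deriv φ t * h t = - ∫ t in Ioo 0 T, φ t * H t) :
    ∀ t ∈ Icc 0 T, h t = h 0 + ∫ s in 0..t, H s := by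
  set k : ℝ → ℝ := fun t => h t - ∫ s in 0..t, H s with hk
  have hprim : ContinuousOn (fun t => ∫ s in 0..t, H s) (Icc 0 T) := by
    have hH' := hH
    rw [← integrableOn_Icc_iff_integrableOn_Ioo, ← uIcc_of_le hT.le] at hH'
    rw [← uIcc_of_le hT.le]
    exact intervalIntegral.continuousOn_primitive_interval hH'
  have hkc : ContinuousOn k (Icc 0 T) := hh.sub hprim
  have hint : ∀ {g m : ℝ → ℝ}, Continuous g → ContinuousOn m (Icc 0 T) →
      IntegrableOn (fun t => g t * m t) (Ioo 0 T) volume := fun hg hm =>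
    ((hg.continuousOn.mul hm).integrableOn_Icc).mono_set Ioo_subset_Icc_self
  have hzero : ∀ {φ : ℝ → ℝ}, tsupport φ ⊆ Ioo 0 T → φ 0 = 0 ∧ φ T = 0 := fun hφ =>
    ⟨image_eq_zero_of_notMem_tsupport fun h => lt_irrefl _ (hφ h).1,
      image_eq_zero_of_notMem_tsupport fun h => lt_irrefl _ (hφ h).2⟩
  have hk0 : ∀ φ : ℝ → ℝ, ContDiff ℝ ∞ φ → HasCompactSupport φ → tsupport φ ⊆ Ioo 0 T →
      ∫ t in Ioo 0 T, deriv φ t * k t = 0 := by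
    intro φ h1 h2 h3
    have hdc : Continuous (deriv φ) := h1.continuous_deriv (by simp)
    have hftc : ∀ t, ∫ s in 0..t, deriv φ s = φ t := by
      intro t
      rw [intervalIntegral.integral_deriv_eq_sub (fun x _ => h1.differentiable (by simp) x)
        (hdc.intervalIntegrable _ _), (hzero h3).1, sub_zero]
    have hp := primitive_mul (f := deriv φ) (g := H) (T := T)
      (hdc.continuousOn.integrableOn_Icc.mono_set Ioo_subset_Icc_self) hH 0 0
      (right_mem_Icc.2 hT.le)
    simp only [hftc, zero_add, (hzero h3).2, zero_mul] at hp
    rw [intervalIntegral.integral_of_le hT.le, integral_Ioc_eq_integral_Ioo] at hp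
    have i1 : IntegrableOn (fun t => deriv φ t * ∫ s in 0..t, H s) (Ioo 0 T) volume :=
      hint hdc hprim
    have i2 : IntegrableOn (fun t => φ t * H t) (Ioo 0 T) volume := by
      rw [← integrableOn_Icc_iff_integrableOn_Ioo] at hH ⊢
      exact hH.continuousOn_mul h1.continuous.continuousOn isCompact_Icc
    rw [integral_add i1 i2] at hp
    simp only [hk, mul_sub]
    rw [integral_sub (hint hdc hh) i1, hw φ h1 h2 h3]
    linarith
  -- A fixed test function of integral one; the constant value of `k` will be its average against
  -- `b`.
  obtain ⟨b, hb1, hb2, hb3, hb4⟩ : ∃ b : ℝ → ℝ, ContDiff ℝ ∞ b ∧ HasCompactSupport b ∧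
      tsupport b ⊆ Ioo 0 T ∧ ∫ t, b t = 1 := by
    let B : ContDiffBump (T / 2) := ⟨T / 8, T / 4, by positivity, by linarith⟩
    refine ⟨B.normed volume, B.contDiff_normed, B.hasCompactSupport_normed, ?_, B.integral_normed⟩
    rw [B.tsupport_normed_eq, Real.closedBall_eq_Icc]
    intro t ht
    exact ⟨by have := ht.1; simp only [B] at this; linarith,
      by have := ht.2; simp only [B] at this; linarith⟩
  set c := ∫ t in Ioo 0 T, b t * k t with hc
  have hae : ∀ᵐ t, t ∈ Ioo 0 T → k t - c = 0 := by
    refine isOpen_Ioo.ae_eq_zero_of_integral_contDiff_smul_eq_zero ?_ fun g hg1 hg2 hg3 => ?_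
    · exact ((hkc.sub continuousOn_const).integrableOn_Icc.mono_set
        Ioo_subset_Icc_self).locallyIntegrableOn
    have hgi : Integrable g volume := hg1.continuous.integrable_of_hasCompactSupport hg2
    have hbi : Integrable b volume := hb1.continuous.integrable_of_hasCompactSupport hb2
    have hcs : HasCompactSupport (fun t => g t - (∫ s, g s) * b t) :=
      hg2.sub (hb2.mul_left)
    -- Subtracting (∫g) b from `g` makes the integral vanish, which is exactly the condition for
    -- being the derivative of a test function.
    obtain ⟨φ, hφ1, hφ2, hφ3, hφ4⟩ := exists_primitive_test hT (g := fun t => g t - (∫ s, g s) * b t)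
      (hg1.sub (contDiff_const.mul hb1)) hcs (by
        have h1 : tsupport (fun t => g t - (∫ s, g s) * b t) ⊆ tsupport g ∪ tsupport b := by
          refine closure_minimal (fun t ht => ?_)
            ((isClosed_tsupport g).union (isClosed_tsupport b))
          by_contra hcon
          rw [mem_union, not_or] at hcon
          apply ht
          simp [image_eq_zero_of_notMem_tsupport hcon.1, image_eq_zero_of_notMem_tsupport hcon.2]
        exact h1.trans (union_subset hg3 hb3)) (by
        rw [integral_sub hgi (hbi.const_mul _), integral_const_mul, hb4, mul_one, sub_self])
    have h0 := hk0 φ hφ1 hφ2 hφ3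
    simp only [hφ4, sub_mul] at h0
    have j1 := hint hg1.continuous hkc
    have j2 : IntegrableOn (fun t => (∫ s, g s) * b t * k t) (Ioo 0 T) volume :=
      hint (continuous_const.mul hb1.continuous) hkc
    rw [integral_sub j1 j2] at h0
    have e1 : ∫ t in Ioo 0 T, (∫ s, g s) * b t * k t = (∫ s, g s) * c := by
      simp only [mul_assoc]; rw [integral_const_mul]
    have e2 : ∫ t, g t • (k t - c) = ∫ t in Ioo 0 T, (g t * k t - g t * c) := by
      rw [← setIntegral_eq_integral_of_forall_compl_eq_zero (s := Ioo 0 T)]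
      · simp only [smul_eq_mul, mul_sub]
      · intro t ht
        rw [image_eq_zero_of_notMem_tsupport fun h => ht (hg3 h), zero_smul]
    have e3 : ∫ t in Ioo 0 T, g t = ∫ t, g t :=
      setIntegral_eq_integral_of_forall_compl_eq_zero fun t ht =>
        image_eq_zero_of_notMem_tsupport fun h => ht (hg3 h)
    rw [e2, integral_sub j1 (hgi.integrableOn.mul_const c), integral_mul_const, e3]
    rw [e1] at h0
    exact h0
  have hall : EqOn k (fun _ => c) (Icc 0 T) := by
    refine Measure.eqOn_Icc_of_ae_eq volume hT.ne ?_ hkc continuousOn_const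
    rw [← restrict_Ioo_eq_restrict_Icc]
    rw [EventuallyEq, ae_restrict_iff' measurableSet_Ioo]
    filter_upwards [hae] with t ht ht'
    linarith [ht ht']
  intro t ht
  have h1 : k t = c := hall ht
  have h2 : k 0 = c := hall (left_mem_Icc.2 hT.le)
  simp only [hk, intervalIntegral.integral_same] at h1 h2
  linarith

lemma spaceTime_eq (T : ℝ) :
    spaceTime T = (volume.restrict (Ioo 0 T)).prod (volume : Measure E3) := by
  rw [spaceTime, Measure.volume_eq_prod, ← Measure.prod_restrict, Measure.restrict_univ]

/-- On a compact set the L^p norm controls the L¹ norm, so integrability of the norm in time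
suffices. This makes Fubini available against compactly supported test functions. -/
lemma integrable_prod_compact {T : ℝ} {f : ℝ → E3 → ℝ} {p : ℝ≥0∞} (hp : 1 ≤ p)
    (hm : JointMeas T f) (hf : ∫⁻ t in Ioo 0 T, eLpNorm (f t) p volume < ⊤) {K : Set E3}
    (hK : IsCompact K) :
    Integrable (fun z : ℝ × E3 => f z.1 z.2)
      ((volume.restrict (Ioo 0 T)).prod (volume.restrict K)) := by
  have hm' : AEStronglyMeasurable (fun z : ℝ × E3 => f z.1 z.2)
      ((volume.restrict (Ioo 0 T)).prod volume) := by
    rw [← spaceTime_eq]; exact hm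
  have hmK : AEStronglyMeasurable (fun z : ℝ × E3 => f z.1 z.2)
      ((volume.restrict (Ioo 0 T)).prod (volume.restrict K)) :=
    hm'.mono_measure (Measure.prod_mono le_rfl Measure.restrict_le_self)
  refine ⟨hmK, ?_⟩
  rw [HasFiniteIntegral, lintegral_prod _ hmK.enorm]
  set c := (volume K) ^ (1 / (1 : ℝ≥0∞).toReal - 1 / p.toReal) with hc
  have hct : c < ⊤ := by
    refine ENNReal.rpow_lt_top_of_nonneg ?_ hK.measure_lt_top.ne
    rcases eq_or_ne p ⊤ with rfl | hpt
    · simp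
    · have h1 : 1 ≤ p.toReal := by
        rw [← ENNReal.toReal_one]; exact (ENNReal.toReal_le_toReal (by simp) hpt).2 hp
      have := div_le_one_of_le₀ h1 (zero_le_one.trans h1)
      simp only [ENNReal.toReal_one, div_one]
      linarith
  calc _ ≤ ∫⁻ t in Ioo 0 T, eLpNorm (f t) p volume * c := by
        refine lintegral_mono_ae ?_
        filter_upwards [hm'.prodMk_left] with t ht
        have := eLpNorm_le_eLpNorm_mul_rpow_measure_univ (p := 1) (q := p)
          (μ := volume.restrict K) hp ht.restrict
        rw [eLpNorm_one_eq_lintegral_enorm, Measure.restrict_apply_univ] at this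
        refine this.trans ?_
        gcongr
        exact Measure.restrict_le_self
    _ = (∫⁻ t in Ioo 0 T, eLpNorm (f t) p volume) * c := lintegral_mul_const' _ _ hct.ne
    _ < ⊤ := ENNReal.mul_lt_top hf hct

/-- Test functions φ(t)ψ(x) give, for each ψ, a one-dimensional weak equation for t ↦ ∫ψ f(t). This
function is continuous because f ∈ C([0,T]; L^p), so it is a primitive at every t. With t fixed,
varying ψ identifies f(t) almost everywhere. -/
lemma timeAC_of_weak {T : ℝ} (hT : 0 < T) {f ft : ℝ → E3 → ℝ} {p p' p₁ : ℝ≥0∞}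
    [ENNReal.HolderTriple p' p 1] (hp1 : 1 ≤ p) (hp₁ : 1 ≤ p₁)
    (hm : JointMeas T f) (hmt : JointMeas T ft) (hc : ContInLp T p f)
    (hi : ∫⁻ t in Ioo 0 T, eLpNorm (f t) p volume < ⊤)
    (hit : ∫⁻ t in Ioo 0 T, eLpNorm (ft t) p₁ volume < ⊤)
    (hw : ∀ φ : ℝ × E3 → ℝ, ContDiff ℝ ∞ φ → HasCompactSupport φ → tsupport φ ⊆ Ioo 0 T ×ˢ univ →
      ∫ z, fderiv ℝ φ z (1, 0) * f z.1 z.2 = - ∫ z, φ z * ft z.1 z.2) :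
    TimeAC volume T f ft := by
  have h0T : (0 : ℝ) ∈ Icc 0 T := left_mem_Icc.2 hT.le
  have hK := fun {K : Set E3} (hK : IsCompact K) => integrable_prod_compact hp1 hm hi hK
  have hKt := fun {K : Set E3} (hK : IsCompact K) => integrable_prod_compact hp₁ hmt hit hK
  have hψ : ∀ {F : ℝ → E3 → ℝ} {ψ : E3 → ℝ}, (∀ {K : Set E3}, IsCompact K →
      Integrable (fun z : ℝ × E3 => F z.1 z.2)
        ((volume.restrict (Ioo 0 T)).prod (volume.restrict K))) →
      Continuous ψ → HasCompactSupport ψ →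
      Integrable (fun z : ℝ × E3 => ψ z.2 * F z.1 z.2)
        ((volume.restrict (Ioo 0 T)).prod volume) := by
    intro F ψ hF h1 h2
    obtain ⟨C, hC⟩ := h1.bounded_above_of_compact_support h2
    have h3 : Integrable (fun z : ℝ × E3 => ψ z.2 * F z.1 z.2)
        ((volume.restrict (Ioo 0 T)).prod (volume.restrict (tsupport ψ))) :=
      (hF h2).bdd_mul (c := C) (h1.comp continuous_snd).aestronglyMeasurable
        (.of_forall fun z => hC _)
    have e : (volume.restrict (Ioo 0 T)).prod (volume.restrict (tsupport ψ))
        = ((volume.restrict (Ioo 0 T)).prod (volume : Measure E3)).restrict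
          (univ ×ˢ tsupport ψ) := by
      rw [← Measure.prod_restrict, Measure.restrict_univ]
    rw [e] at h3
    have hsub : Function.support (fun z : ℝ × E3 => ψ z.2 * F z.1 z.2) ⊆ univ ×ˢ tsupport ψ :=
      fun z hz => ⟨mem_univ _, subset_tsupport _ (left_ne_zero_of_mul hz)⟩
    exact (integrableOn_iff_integrable_of_support_subset hsub).1 h3
  have hprod : ∀ {F : ℝ → E3 → ℝ} {φ : ℝ → ℝ} {ψ : E3 → ℝ}, (∀ {K : Set E3}, IsCompact K →
      Integrable (fun z : ℝ × E3 => F z.1 z.2)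
        ((volume.restrict (Ioo 0 T)).prod (volume.restrict K))) →
      Continuous φ → HasCompactSupport φ → (∀ t ∉ Ioo 0 T, φ t = 0) →
      Continuous ψ → HasCompactSupport ψ →
      ∫ z : ℝ × E3, φ z.1 * ψ z.2 * F z.1 z.2 = ∫ t in Ioo 0 T, φ t * ∫ x, ψ x * F t x := by
    intro F φ ψ hF a1 a2 a3 b1 b2
    obtain ⟨C, hC⟩ := a1.bounded_above_of_compact_support a2
    have h3 : Integrable (fun z : ℝ × E3 => φ z.1 * (ψ z.2 * F z.1 z.2))
        ((volume.restrict (Ioo 0 T)).prod volume) :=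
      (hψ hF b1 b2).bdd_mul (c := C) (a1.comp continuous_fst).aestronglyMeasurable
        (.of_forall fun z => hC _)
    have e : ∫ z : ℝ × E3, φ z.1 * ψ z.2 * F z.1 z.2
        = ∫ z, φ z.1 * (ψ z.2 * F z.1 z.2) ∂((volume.restrict (Ioo 0 T)).prod volume) := by
      rw [← spaceTime_eq, spaceTime]
      simp only [← mul_assoc]
      refine (setIntegral_eq_integral_of_forall_compl_eq_zero fun z hz => ?_).symm
      rw [a3 z.1 fun h => hz ⟨h, mem_univ _⟩]; simp
    rw [e, integral_prod _ h3]
    simp only [integral_const_mul]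
  have hloc : ∀ t ∈ Icc 0 T, LocallyIntegrable (f t) volume := fun t ht =>
    (hc.1 t ht).locallyIntegrable hp1
  have hψf : ∀ {ψ : E3 → ℝ}, Continuous ψ → HasCompactSupport ψ → ∀ t ∈ Icc 0 T,
      Integrable (fun x => ψ x * f t x) volume := fun h1 h2 t ht =>
    (hloc t ht).integrable_smul_left_of_hasCompactSupport h1 h2
  have key : ∀ ψ : E3 → ℝ, ContDiff ℝ ∞ ψ → HasCompactSupport ψ → ∀ t ∈ Icc 0 T,
      ∫ x, ψ x * f t x = (∫ x, ψ x * f 0 x) + ∫ s in 0..t, ∫ x, ψ x * ft s x := by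
    intro ψ h1 h2
    refine eq_primitive_of_weak hT (h := fun t => ∫ x, ψ x * f t x) ?_
      (hψ hKt h1.continuous h2).integral_prod_left ?_
    · intro s hs
      rw [ContinuousWithinAt, tendsto_iff_edist_tendsto_0]
      have hψp : MemLp ψ p' volume := h1.continuous.memLp_of_hasCompactSupport h2
      have hb : Tendsto (fun t => eLpNorm ψ p' volume * eLpNorm (f t - f s) p volume)
          (𝓝[Icc 0 T] s) (𝓝 0) := by
        have := ENNReal.Tendsto.const_mul (a := eLpNorm ψ p' volume) (hc.2 s hs)
          (.inr hψp.2.ne)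
        simpa using this
      refine tendsto_of_tendsto_of_tendsto_of_le_of_le' tendsto_const_nhds hb
        (.of_forall fun _ => zero_le) ?_
      filter_upwards [self_mem_nhdsWithin] with t ht
      rw [edist_eq_enorm_sub, ← integral_sub (hψf h1.continuous h2 t ht)
        (hψf h1.continuous h2 s hs)]
      simp only [← mul_sub]
      exact enorm_integral_mul_le hψp.1 ((hc.1 t ht).1.sub (hc.1 s hs).1)
    · intro φ a1 a2 a3
      have hout : ∀ t ∉ Ioo 0 T, φ t = 0 := fun t ht =>
        image_eq_zero_of_notMem_tsupport fun h => ht (a3 h)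
      have hout' : ∀ t ∉ Ioo 0 T, deriv φ t = 0 := fun t ht =>
        image_eq_zero_of_notMem_tsupport fun h => ht (a3 (tsupport_deriv_subset h))
      have hsub : Function.support (fun z : ℝ × E3 => φ z.1 * ψ z.2)
          ⊆ tsupport φ ×ˢ tsupport ψ := fun z hz =>
        ⟨subset_tsupport _ (left_ne_zero_of_mul hz), subset_tsupport _ (right_ne_zero_of_mul hz)⟩
      have hw' := hw (fun z => φ z.1 * ψ z.2)
        ((a1.comp contDiff_fst).mul (h1.comp contDiff_snd))
        (HasCompactSupport.of_support_subset_isCompact (a2.prod h2) hsub)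
        ((closure_minimal hsub ((isClosed_tsupport φ).prod (isClosed_tsupport ψ))).trans
          fun z hz => ⟨a3 hz.1, mem_univ _⟩)
      have hfd : ∀ z : ℝ × E3, fderiv ℝ (fun z : ℝ × E3 => φ z.1 * ψ z.2) z (1, 0)
          = deriv φ z.1 * ψ z.2 := by
        intro z
        have d1 : HasFDerivAt (fun z : ℝ × E3 => φ z.1)
            ((fderiv ℝ φ z.1).comp (ContinuousLinearMap.fst ℝ ℝ E3)) z :=
          ((a1.differentiable (by simp) z.1).hasFDerivAt).comp z hasFDerivAt_fst
        have d2 : HasFDerivAt (fun z : ℝ × E3 => ψ z.2)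
            ((fderiv ℝ ψ z.2).comp (ContinuousLinearMap.snd ℝ ℝ E3)) z :=
          ((h1.differentiable (by simp) z.2).hasFDerivAt).comp z hasFDerivAt_snd
        rw [(d1.fun_mul d2).fderiv]
        simp [mul_comm]
      simp only [hfd] at hw'
      rw [hprod hK (a1.continuous_deriv (by simp)) a2.deriv hout' h1.continuous h2,
        hprod hKt a1.continuous a2 hout h1.continuous h2] at hw'
      exact hw'
  have hm' : AEStronglyMeasurable (fun z : ℝ × E3 => f z.1 z.2)
      ((volume.restrict (Ioo 0 T)).prod volume) := by
    rw [← spaceTime_eq]; exact hm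
  have hmt' : AEStronglyMeasurable (fun z : ℝ × E3 => ft z.1 z.2)
      ((volume.restrict (Ioo 0 T)).prod volume) := by
    rw [← spaceTime_eq]; exact hmt
  refine ⟨hm', hmt', (hc.1 0 h0T).1, ?_, ?_⟩
  · have h1 : ∀ n : ℕ, ∀ᵐ x, x ∈ Metric.closedBall (0 : E3) n →
        IntegrableOn (fun s => ft s x) (Ioo 0 T) volume := by
      intro n
      rw [← ae_restrict_iff' measurableSet_closedBall]
      exact (hKt (isCompact_closedBall (0 : E3) n)).prod_left_ae
    filter_upwards [ae_all_iff.2 h1] with x hx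
    obtain ⟨n, hn⟩ := exists_nat_ge ‖x‖
    exact hx n (by simpa using hn)
  · intro t ht
    have hle : (volume.restrict (Ioo 0 t) : Measure ℝ) ≤ volume.restrict (Ioo 0 T) :=
      Measure.restrict_mono (Ioo_subset_Ioo_right ht.2) le_rfl
    have hI : ∀ x, ∫ s in 0..t, ft s x = ∫ s in Ioo 0 t, ft s x := fun x => by
      rw [intervalIntegral.integral_of_le ht.1, integral_Ioc_eq_integral_Ioo]
    have hlocI : LocallyIntegrable (fun x => ∫ s in 0..t, ft s x) volume := by
      rw [locallyIntegrable_iff]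
      intro K hKc
      simp only [hI]
      exact ((hKt hKc).mono_measure (Measure.prod_mono hle le_rfl)).integral_prod_right
    have hz := ae_eq_zero_of_integral_contDiff_smul_eq_zero
      (((hloc t ht).sub (hloc 0 h0T)).sub hlocI) (fun ψ h1 h2 => by
        have hs : Integrable (fun z : ℝ × E3 => ψ z.2 * ft z.1 z.2)
            ((volume.restrict (Ioo 0 t)).prod volume) :=
          (hψ hKt h1.continuous h2).mono_measure (Measure.prod_mono hle le_rfl)
        have hs1 : Integrable (fun x => ψ x * ∫ s in 0..t, ft s x) volume :=
          hlocI.integrable_smul_left_of_hasCompactSupport h1.continuous h2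
        have hs2 : ∫ x, ψ x * ∫ s in 0..t, ft s x = ∫ s in 0..t, ∫ x, ψ x * ft s x := by
          rw [intervalIntegral.integral_of_le ht.1, integral_Ioc_eq_integral_Ioo,
            integral_integral_swap hs]
          simp only [hI, integral_const_mul]
        have i1 := hψf h1.continuous h2 t ht
        have i2 := hψf h1.continuous h2 0 h0T
        have i12 : Integrable (fun x => ψ x * f t x - ψ x * f 0 x) volume := i1.sub i2
        simp only [Pi.sub_apply, smul_eq_mul, mul_sub]
        rw [integral_sub i12 hs1, integral_sub i1 i2, hs2, key ψ h1 h2 t ht]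
        ring)
    filter_upwards [hz] with x hx
    simp only [Pi.sub_apply] at hx
    linarith


/-! ### Time-dependent convolution pairings -/

/-- Hölder in x for fixed y: the norm of k(· − y) does not depend on y, and integrability of G
handles the y integral. -/
lemma lintegral_kernel_le {p q : ℝ≥0∞} [ENNReal.HolderTriple p q 1] {k F G : E3 → ℝ}
    (hk : Continuous k) (hF : AEStronglyMeasurable F volume) (hG : AEStronglyMeasurable G volume) :
    ∫⁻ w : E3 × E3, ‖k (w.1 - w.2) * (F w.1 * G w.2)‖ₑ ∂(volume.prod volume)
      ≤ eLpNorm k q volume * (eLpNorm F p volume * eLpNorm G 1 volume) := by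
  have hm : AEMeasurable (fun w : E3 × E3 => ‖k (w.1 - w.2) * (F w.1 * G w.2)‖ₑ)
      (volume.prod volume) :=
    ((hk.comp (continuous_fst.sub continuous_snd)).aestronglyMeasurable.mul
      (hF.comp_fst.mul hG.comp_snd)).enorm
  rw [lintegral_prod_symm _ hm]
  have h1 : ∀ y, ∫⁻ x, ‖k (x - y) * (F x * G y)‖ₑ
      ≤ eLpNorm F p volume * eLpNorm k q volume * ‖G y‖ₑ := by
    intro y
    have e : ∀ x, ‖k (x - y) * (F x * G y)‖ₑ = ‖F x * k (x - y)‖ₑ * ‖G y‖ₑ := fun x => by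
      simp only [enorm_mul]; ring
    have hky : AEStronglyMeasurable (fun x => k (x - y)) volume :=
      (hk.comp (continuous_id.sub continuous_const)).aestronglyMeasurable
    have hm : AEMeasurable (fun x => ‖F x * k (x - y)‖ₑ) volume := (hF.mul hky).enorm
    simp only [e]
    rw [lintegral_mul_const'' _ hm]
    gcongr
    refine (lintegral_mul_le (p := p) (q := q) hF hky).trans (le_of_eq ?_)
    rw [eLpNorm_comp_sub_right k q hk.aestronglyMeasurable y]
  refine (lintegral_mono h1).trans (le_of_eq ?_)
  rw [lintegral_const_mul'' _ hG.enorm, ← eLpNorm_one_eq_lintegral_enorm]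
  ring

lemma integrable_kernel {p q : ℝ≥0∞} [ENNReal.HolderTriple p q 1] {k F G : E3 → ℝ}
    (hk : Continuous k) (hkq : MemLp k q volume) (hF : MemLp F p volume)
    (hG : Integrable G volume) :
    Integrable (fun w : E3 × E3 => k (w.1 - w.2) * (F w.1 * G w.2)) (volume.prod volume) := by
  refine ⟨(hk.comp (continuous_fst.sub continuous_snd)).aestronglyMeasurable.mul
      (hF.1.comp_fst.mul hG.1.comp_snd), ?_⟩
  exact (lintegral_kernel_le (p := p) (q := q) hk hF.1 hG.1).trans_lt (ENNReal.mul_lt_top hkq.2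
    (ENNReal.mul_lt_top hF.2 (memLp_one_iff_integrable.2 hG).2))

/-- Written over pairs (x, y) the kernel is a fixed weight, and time enters only through pointwise
values. This allows differentiation in time without differentiating a convolution. -/
lemma integral_kernel_eq {p q : ℝ≥0∞} [ENNReal.HolderTriple p q 1] {k F G : E3 → ℝ}
    (hk : Continuous k) (hkq : MemLp k q volume) (hF : MemLp F p volume)
    (hG : Integrable G volume) :
    ∫ w : E3 × E3, k (w.1 - w.2) * (F w.1 * G w.2) ∂(volume.prod volume)
      = ∫ x, F x * cv k G x := by
  rw [integral_prod _ (integrable_kernel (p := p) (q := q) hk hkq hF hG)]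
  refine integral_congr_ae (.of_forall fun x => ?_)
  simp only [cv]
  rw [← integral_const_mul]
  refine integral_congr_ae (.of_forall fun y => ?_)
  simp only; ring

lemma integrable_kernel_time {p q : ℝ≥0∞} [ENNReal.HolderTriple p q 1] {T : ℝ} {k : E3 → ℝ}
    {F G : ℝ → E3 → ℝ} (hk : Continuous k) (hkq : MemLp k q volume)
    (hF : AEStronglyMeasurable (fun z : ℝ × E3 => F z.1 z.2) ((volume.restrict (Ioo 0 T)).prod volume))
    (hG : AEStronglyMeasurable (fun z : ℝ × E3 => G z.1 z.2) ((volume.restrict (Ioo 0 T)).prod volume))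
    (hb : ∫⁻ t in Ioo 0 T, eLpNorm (F t) p volume * eLpNorm (G t) 1 volume < ⊤) :
    Integrable (fun z : ℝ × (E3 × E3) => k (z.2.1 - z.2.2) * (F z.1 z.2.1 * G z.1 z.2.2))
      ((volume.restrict (Ioo 0 T)).prod (volume.prod volume)) := by
  have q1 : Measure.QuasiMeasurePreserving (Prod.map (id : ℝ → ℝ) (Prod.fst : E3 × E3 → E3))
      ((volume.restrict (Ioo 0 T)).prod (volume.prod volume))
      ((volume.restrict (Ioo 0 T)).prod volume) :=
    MeasureTheory.QuasiMeasurePreserving.prodMap (.id _) Measure.quasiMeasurePreserving_fst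
  have q2 : Measure.QuasiMeasurePreserving (Prod.map (id : ℝ → ℝ) (Prod.snd : E3 × E3 → E3))
      ((volume.restrict (Ioo 0 T)).prod (volume.prod volume))
      ((volume.restrict (Ioo 0 T)).prod volume) :=
    MeasureTheory.QuasiMeasurePreserving.prodMap (.id _) Measure.quasiMeasurePreserving_snd
  have hm : AEStronglyMeasurable
      (fun z : ℝ × (E3 × E3) => k (z.2.1 - z.2.2) * (F z.1 z.2.1 * G z.1 z.2.2))
      ((volume.restrict (Ioo 0 T)).prod (volume.prod volume)) := by
    have hk' : Continuous (fun z : ℝ × (E3 × E3) => k (z.2.1 - z.2.2)) := by fun_prop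
    exact hk'.aestronglyMeasurable.mul ((hF.comp_quasiMeasurePreserving q1).mul
      (hG.comp_quasiMeasurePreserving q2))
  refine ⟨hm, ?_⟩
  rw [HasFiniteIntegral, lintegral_prod _ hm.enorm]
  calc _ ≤ ∫⁻ t in Ioo 0 T, eLpNorm k q volume
          * (eLpNorm (F t) p volume * eLpNorm (G t) 1 volume) := by
        refine lintegral_mono_ae ?_
        filter_upwards [hF.prodMk_left, hG.prodMk_left] with t h1 h2
        exact lintegral_kernel_le hk h1 h2
    _ = eLpNorm k q volume * ∫⁻ t in Ioo 0 T, eLpNorm (F t) p volume * eLpNorm (G t) 1 volume :=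
        lintegral_const_mul' _ _ hkq.2.ne
    _ < ⊤ := ENNReal.mul_lt_top hkq.2 hb

lemma lintegral_lt_top_of_le {T : ℝ} {g : ℝ → ℝ≥0∞} {C : ℝ≥0∞} (hC : C < ⊤)
    (h : ∀ t ∈ Ioo 0 T, g t ≤ C) : ∫⁻ t in Ioo 0 T, g t < ⊤ := by
  refine (setLIntegral_mono' measurableSet_Ioo h).trans_lt ?_
  rw [setLIntegral_const]
  exact ENNReal.mul_lt_top hC (by simp)

lemma aemeasurable_eLpNorm {T : ℝ} {f : ℝ → E3 → ℝ} {p : ℝ≥0∞}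
    (hf : AEStronglyMeasurable (fun z : ℝ × E3 => f z.1 z.2)
      ((volume.restrict (Ioo 0 T)).prod volume)) (hp : p ≠ 0) (hp' : p ≠ ⊤) :
    AEMeasurable (fun t => eLpNorm (f t) p volume) (volume.restrict (Ioo 0 T)) := by
  simp only [eLpNorm_eq_lintegral_rpow_enorm_toReal hp hp']
  exact (AEMeasurable.lintegral_prod_right' (hf.enorm.pow_const p.toReal)).pow_const _

lemma TimeAC.cube {X : Type*} [MeasurableSpace X] {μ : Measure X} [SFinite μ] {T : ℝ}
    {f ft : ℝ → X → ℝ} (h : TimeAC μ T f ft) :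
    TimeAC μ T (fun t x => f t x ^ 3) (fun t x => 3 * f t x ^ 2 * ft t x) := by
  have h3 := (h.mul h).mul h
  have e1 : (fun t x => f t x ^ 3) = fun t x => f t x * f t x * f t x := by ext t x; ring
  have e2 : (fun t x => 3 * f t x ^ 2 * ft t x)
      = fun t x => (ft t x * f t x + f t x * ft t x) * f t x + f t x * f t x * ft t x := by
    ext t x; ring
  rw [e1, e2]; exact h3

/-! ### The scalar form of a strong solution -/

/-- The components of density, velocity and temperature, with the regularity used below. -/
structure Flow (T R μ lam : ℝ) (r rt th : ℝ → E3 → ℝ) (Dr Dth v a : Fin 3 → ℝ → E3 → ℝ)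
    (Dv : Fin 3 → Fin 3 → ℝ → E3 → ℝ) (D2v : Fin 3 → Fin 3 → Fin 3 → ℝ → E3 → ℝ) (M : ℝ≥0) :
    Prop where
  pos : 0 < T
  slice : ∀ t ∈ Icc 0 T, Slice (r t) (fun i => Dr i t) (fun j => v j t) (fun i j => Dv i j t)
  nonneg : ∀ t ∈ Icc 0 T, ∀ᵐ x, 0 ≤ r t x
  th_nonneg : ∀ t ∈ Icc 0 T, ∀ᵐ x, 0 ≤ th t x
  th_top : ∀ t ∈ Icc 0 T, MemLp (th t) ⊤ volume
  Dth_two : ∀ t ∈ Icc 0 T, ∀ j, MemLp (Dth j t) 2 volume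
  th_partial : ∀ t ∈ Icc 0 T, ∀ j, IsWeakPartial j (th t) (Dth j t)
  D2v_two : ∀ t ∈ Icc 0 T, ∀ k i j, MemLp (D2v k i j t) 2 volume
  Dv_partial : ∀ t ∈ Icc 0 T, ∀ k i j, IsWeakPartial k (Dv i j t) (D2v k i j t)
  rt_two : ∀ t ∈ Icc 0 T, MemLp (rt t) 2 volume
  bdd_r : ∀ t ∈ Icc 0 T, eLpNorm (r t) 2 volume ≤ M
  bdd_r_top : ∀ t ∈ Icc 0 T, eLpNorm (r t) ⊤ volume ≤ M
  bdd_rt : ∀ t ∈ Icc 0 T, eLpNorm (rt t) 2 volume ≤ M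
  bdd_v : ∀ t ∈ Icc 0 T, ∀ j, eLpNorm (v j t) 6 volume ≤ M
  bdd_Dv : ∀ t ∈ Icc 0 T, ∀ i j, eLpNorm (Dv i j t) 2 volume ≤ M
  bdd_th : ∀ t ∈ Icc 0 T, eLpNorm (th t) ⊤ volume ≤ M
  int_a : ∀ j, ∫⁻ t in Ioo 0 T, eLpNorm (a j t) 6 volume < ⊤
  meas_th : AEStronglyMeasurable (fun z : ℝ × E3 => th z.1 z.2)
    ((volume.restrict (Ioo 0 T)).prod volume)
  meas_Dv : ∀ i j, AEStronglyMeasurable (fun z : ℝ × E3 => Dv i j z.1 z.2)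
    ((volume.restrict (Ioo 0 T)).prod volume)
  ac_r : TimeAC volume T r rt
  ac_v : ∀ j, TimeAC volume T (v j) (a j)
  continuity : ∀ᵐ t ∂(volume.restrict (Ioo 0 T)), ∀ᵐ x,
    rt t x + (∑ i, v i t x * Dr i t x + r t x * ∑ i, Dv i i t x) = 0
  momentum : ∀ᵐ t ∂(volume.restrict (Ioo 0 T)), ∀ᵐ x, ∀ j,
    r t x * (a j t x + ∑ i, v i t x * Dv i j t x) - μ * ∑ i, D2v i i j t x
      - (μ + lam) * ∑ i, D2v j i i t x + R * (th t x * Dr j t x + r t x * Dth j t x) = 0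

namespace Flow

variable {T R μ lam : ℝ} {r rt th : ℝ → E3 → ℝ} {Dr Dth v a : Fin 3 → ℝ → E3 → ℝ}
    {Dv : Fin 3 → Fin 3 → ℝ → E3 → ℝ} {D2v : Fin 3 → Fin 3 → Fin 3 → ℝ → E3 → ℝ} {M : ℝ≥0}

lemma a_six (h : Flow T R μ lam r rt th Dr Dth v a Dv D2v M) :
    ∀ᵐ t ∂(volume.restrict (Ioo 0 T)), ∀ j, MemLp (a j t) 6 volume := by
  rw [ae_all_iff]
  intro j
  have hm := (h.ac_v j).meas_t
  filter_upwards [ae_lt_top' (aemeasurable_eLpNorm hm (by simp) (by simp)) (h.int_a j).ne,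
    hm.prodMk_left] with t h1 h2
  exact ⟨h2, h1⟩

lemma bdd_sq (h : Flow T R μ lam r rt th Dr Dth v a Dv D2v M) {t : ℝ} (ht : t ∈ Icc 0 T) :
    eLpNorm (fun x => r t x * r t x) 2 volume ≤ M * M := by
  have S := h.slice t ht
  exact (eLpNorm_mul_le' (p := 2) (q := ⊤) S.r_two.1 S.r_two.1).trans
    (mul_le_mul' (h.bdd_r t ht) (h.bdd_r_top t ht))

lemma bdd_cube (h : Flow T R μ lam r rt th Dr Dth v a Dv D2v M) {t : ℝ} (ht : t ∈ Icc 0 T) :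
    eLpNorm (fun x => r t x ^ 3) 1 volume ≤ M * M * M := by
  have S := h.slice t ht
  have e : (fun x => r t x ^ 3) = fun x => (r t x * r t x) * r t x := by ext x; ring
  rw [e]
  exact (eLpNorm_mul_le' (p := 2) (q := 2) S.sq_two.1 S.r_two.1).trans
    (mul_le_mul' (h.bdd_sq ht) (h.bdd_r t ht))

lemma bdd_cube_two (h : Flow T R μ lam r rt th Dr Dth v a Dv D2v M) {t : ℝ} (ht : t ∈ Icc 0 T) :
    eLpNorm (fun x => r t x ^ 3) 2 volume ≤ M * M * M := by
  have S := h.slice t ht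
  have e : (fun x => r t x ^ 3) = fun x => (r t x * r t x) * r t x := by ext x; ring
  rw [e]
  exact (eLpNorm_mul_le' (p := 2) (q := ⊤) S.sq_two.1 S.r_two.1).trans
    (mul_le_mul' (h.bdd_sq ht) (h.bdd_r_top t ht))

lemma cube_deriv_integrable (h : Flow T R μ lam r rt th Dr Dth v a Dv D2v M) {t : ℝ}
    (ht : t ∈ Icc 0 T) : Integrable (fun x => 3 * r t x ^ 2 * rt t x) volume := by
  have S := h.slice t ht
  refine ((integrable_mul_two S.sq_two (h.rt_two t ht)).const_mul 3).congr
    (.of_forall fun x => ?_)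
  simp only; ring

lemma bdd_cube_deriv (h : Flow T R μ lam r rt th Dr Dth v a Dv D2v M) {t : ℝ} (ht : t ∈ Icc 0 T) :
    eLpNorm (fun x => 3 * r t x ^ 2 * rt t x) 1 volume ≤ 3 * (M * M * M) := by
  have S := h.slice t ht
  have e : (fun x => 3 * r t x ^ 2 * rt t x) = (3 : ℝ) • fun x => (r t x * r t x) * rt t x := by
    ext x; simp only [Pi.smul_apply, smul_eq_mul]; ring
  rw [e, eLpNorm_const_smul]
  have e3 : ‖(3 : ℝ)‖ₑ = 3 := by rw [Real.enorm_eq_ofReal (by norm_num)]; simp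
  rw [e3]
  gcongr
  exact (eLpNorm_mul_le' (p := 2) (q := 2) S.sq_two.1 (h.rt_two t ht).1).trans
    (mul_le_mul' (h.bdd_sq ht) (h.bdd_rt t ht))

/-! ### Balance laws in time -/

/-- The balance of `∫ r³`. -/
lemma integral_cube (h : Flow T R μ lam r rt th Dr Dth v a Dv D2v M) {t : ℝ} (ht : t ∈ Icc 0 T) :
    ∫ x, r t x ^ 3 = (∫ x, r 0 x ^ 3)
      - 2 * ∫ s in 0..t, ∫ x, r s x ^ 3 * ∑ i, Dv i i s x := by
  have hac := h.ac_r.cube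
  have hint : Integrable (fun z : ℝ × E3 => 3 * r z.1 z.2 ^ 2 * rt z.1 z.2)
      ((volume.restrict (Ioo 0 T)).prod volume) := by
    refine ⟨hac.meas_t, ?_⟩
    rw [HasFiniteIntegral, lintegral_prod _ hac.meas_t.enorm]
    refine lintegral_lt_top_of_le (C := 3 * ((M : ℝ≥0∞) * M * M)) (by finiteness) fun t ht => ?_
    rw [← eLpNorm_one_eq_lintegral_enorm (f := fun x => 3 * r t x ^ 2 * rt t x)]
    exact h.bdd_cube_deriv ⟨ht.1.le, ht.2.le⟩
  have h0 : (0 : ℝ) ∈ Icc 0 T := left_mem_Icc.2 h.pos.le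
  have key := hac.integral_eq (fun _ => 1) ht (by simpa using (h.slice 0 h0).cube_integrable)
    (by simpa using hint)
  simp only [one_mul] at key
  rw [key, sub_eq_add_neg, ← neg_mul, ← intervalIntegral.integral_const_mul]
  congr 1
  refine intervalIntegral.integral_congr_ae ?_
  have hc := h.continuity
  rw [ae_restrict_iff' measurableSet_Ioo] at hc
  have hne : ∀ᵐ s : ℝ, s ≠ T := by simp [ae_iff, measure_singleton]
  filter_upwards [hc, hne] with s hs hne hs'
  rw [uIoc_of_le ht.1] at hs'
  have hs'' : s ∈ Ioo 0 T := ⟨hs'.1, lt_of_le_of_ne (hs'.2.trans ht.2) hne⟩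
  exact (h.slice s ⟨hs''.1.le, hs''.2.le⟩).integral_cube_transport (hs hs'')

/-- The time derivative of the pairing of the momentum with the potential. -/
noncomputable def rate (r rt : ℝ → E3 → ℝ) (v a : Fin 3 → ℝ → E3 → ℝ) (ε : ℝ) (j : Fin 3)
    (s : ℝ) : ℝ :=
  (∫ x, rt s x * v j s x * cv (ker1 ε j) (fun y => r s y ^ 3) x)
    + (∫ x, r s x * a j s x * cv (ker1 ε j) (fun y => r s y ^ 3) x)
    + ∫ x, r s x * v j s x * cv (ker1 ε j) (fun y => 3 * r s y ^ 2 * rt s y) x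

/-- For almost every (x, y) the product (r vⱼ)(x) r³(y) is a primitive in time. Integrating it
against the weight ∂ⱼK(x − y) gives the claim; the kernel in L³ against a momentum in L^{3/2} and r³
in L¹ makes all terms integrable. -/
lemma pairing (h : Flow T R μ lam r rt th Dr Dth v a Dv D2v M) {ε : ℝ} (hε : 0 < ε) (h1 : ε ≤ 1)
    (j : Fin 3) : IntegrableOn (rate r rt v a ε j) (Ioo 0 T) volume ∧ ∀ t ∈ Icc 0 T,
      ∫ x, r t x * v j t x * cv (ker1 ε j) (fun y => r t y ^ 3) x
        = (∫ x, r 0 x * v j 0 x * cv (ker1 ε j) (fun y => r 0 y ^ 3) x)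
          + ∫ s in 0..t, rate r rt v a ε j s := by
  have hk := continuous_ker1 hε j
  have k3 : MemLp (ker1 ε j) 3 volume := memLp_ker1 hε h1 (by simp) (by norm_num) j
  have hac := ((h.ac_r.mul (h.ac_v j)).comp (ν := volume.prod volume)
    (π := (Prod.fst : E3 × E3 → E3)) Measure.quasiMeasurePreserving_fst).mul
    (h.ac_r.cube.comp (ν := volume.prod volume) (π := (Prod.snd : E3 × E3 → E3))
      Measure.quasiMeasurePreserving_snd)
  have m3 : AEStronglyMeasurable (fun z : ℝ × E3 => r z.1 z.2 ^ 3)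
      ((volume.restrict (Ioo 0 T)).prod volume) := h.ac_r.cube.meas
  have m3' : AEStronglyMeasurable (fun z : ℝ × E3 => 3 * r z.1 z.2 ^ 2 * rt z.1 z.2)
      ((volume.restrict (Ioo 0 T)).prod volume) := h.ac_r.cube.meas_t
  have I1 := integrable_kernel_time (p := 3 / 2) (q := 3) (F := fun t x => rt t x * v j t x)
    (G := fun t x => r t x ^ 3) hk k3 (h.ac_r.meas_t.mul (h.ac_v j).meas) m3
    (lintegral_lt_top_of_le (C := (M : ℝ≥0∞) * M * (M * M * M)) (by finiteness) fun t ht => by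
      have ht' : t ∈ Icc 0 T := ⟨ht.1.le, ht.2.le⟩
      refine mul_le_mul' ((eLpNorm_mul_le' (p := 2) (q := 6) (h.rt_two t ht').1
        ((h.slice t ht').v_six j).1).trans
        (mul_le_mul' (h.bdd_rt t ht') (h.bdd_v t ht' j))) (h.bdd_cube ht'))
  have I2 := integrable_kernel_time (p := 3 / 2) (q := 3) (F := fun t x => r t x * a j t x)
    (G := fun t x => r t x ^ 3) hk k3 (h.ac_r.meas.mul (h.ac_v j).meas_t) m3 (by
      -- The acceleration is only integrable in time with values in L⁶, unlike the other factors,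
      -- which are bounded.
      have : ∫⁻ t in Ioo 0 T, (M : ℝ≥0∞) * (M * M * M) * eLpNorm (a j t) 6 volume < ⊤ := by
        rw [lintegral_const_mul' _ _ (by finiteness)]
        exact ENNReal.mul_lt_top (by finiteness) (h.int_a j)
      refine lt_of_le_of_lt (lintegral_mono_ae ?_) this
      filter_upwards [h.a_six, ae_restrict_mem measurableSet_Ioo] with t ha ht
      have ht' : t ∈ Icc 0 T := ⟨ht.1.le, ht.2.le⟩
      calc _ ≤ (M * eLpNorm (a j t) 6 volume) * ((M : ℝ≥0∞) * M * M) :=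
            mul_le_mul' ((eLpNorm_mul_le' (p := 2) (q := 6) (h.slice t ht').r_two.1
              (ha j).1).trans (mul_le_mul' (h.bdd_r t ht') le_rfl)) (h.bdd_cube ht')
        _ = _ := by ring)
  have I3 := integrable_kernel_time (p := 3 / 2) (q := 3) (F := fun t x => r t x * v j t x)
    (G := fun t x => 3 * r t x ^ 2 * rt t x) hk k3 (h.ac_r.meas.mul (h.ac_v j).meas) m3'
    (lintegral_lt_top_of_le (C := (M : ℝ≥0∞) * M * (3 * (M * M * M))) (by finiteness)
      fun t ht => by
      have ht' : t ∈ Icc 0 T := ⟨ht.1.le, ht.2.le⟩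
      refine mul_le_mul' ((eLpNorm_mul_le' (p := 2) (q := 6) (h.slice t ht').r_two.1
        ((h.slice t ht').v_six j).1).trans
        (mul_le_mul' (h.bdd_r t ht') (h.bdd_v t ht' j))) (h.bdd_cube_deriv ht'))
  have I : Integrable (fun z : ℝ × (E3 × E3) => ker1 ε j (z.2.1 - z.2.2)
      * ((rt z.1 z.2.1 * v j z.1 z.2.1 + r z.1 z.2.1 * a j z.1 z.2.1) * r z.1 z.2.2 ^ 3
        + r z.1 z.2.1 * v j z.1 z.2.1 * (3 * r z.1 z.2.2 ^ 2 * rt z.1 z.2.2)))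
      ((volume.restrict (Ioo 0 T)).prod (volume.prod volume)) := by
    refine ((I1.add I2).add I3).congr (.of_forall fun z => ?_)
    simp only [Pi.add_apply]; ring
  have rv : ∀ t ∈ Icc 0 T, MemLp (fun x => r t x * v j t x) (3 / 2) volume := fun t ht =>
    memLp_mul (p := 2) (q := 6) (h.slice t ht).r_two ((h.slice t ht).v_six j)
  have hrate : ∀ᵐ s ∂(volume.restrict (Ioo 0 T)), ∫ w : E3 × E3, ker1 ε j (w.1 - w.2)
      * ((rt s w.1 * v j s w.1 + r s w.1 * a j s w.1) * r s w.2 ^ 3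
        + r s w.1 * v j s w.1 * (3 * r s w.2 ^ 2 * rt s w.2)) ∂(volume.prod volume)
      = rate r rt v a ε j s := by
    filter_upwards [h.a_six, ae_restrict_mem measurableSet_Ioo] with s ha hs
    have hs' : s ∈ Icc 0 T := ⟨hs.1.le, hs.2.le⟩
    have S := h.slice s hs'
    have F1 : MemLp (fun x => rt s x * v j s x) (3 / 2) volume :=
      memLp_mul (p := 2) (q := 6) (h.rt_two s hs') (S.v_six j)
    have F2 : MemLp (fun x => r s x * a j s x) (3 / 2) volume :=
      memLp_mul (p := 2) (q := 6) S.r_two (ha j)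
    have i1 := integrable_kernel (p := 3 / 2) (q := 3) hk k3 F1 S.cube_integrable
    have i2 := integrable_kernel (p := 3 / 2) (q := 3) hk k3 F2 S.cube_integrable
    have i3 := integrable_kernel (p := 3 / 2) (q := 3) hk k3 (rv s hs')
      (h.cube_deriv_integrable hs')
    rw [rate, ← integral_kernel_eq (p := 3 / 2) (q := 3) hk k3 F1 S.cube_integrable,
      ← integral_kernel_eq (p := 3 / 2) (q := 3) hk k3 F2 S.cube_integrable,
      ← integral_kernel_eq (p := 3 / 2) (q := 3) hk k3 (rv s hs') (h.cube_deriv_integrable hs'),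
      ← integral_add i1 i2]
    rw [← integral_add]
    · refine integral_congr_ae (.of_forall fun w => ?_)
      simp only; ring
    · exact i1.add i2
    · exact i3
  have h0 : (0 : ℝ) ∈ Icc 0 T := left_mem_Icc.2 h.pos.le
  refine ⟨I.integral_prod_left.congr hrate, fun t ht => ?_⟩
  have i0 := integrable_kernel (p := 3 / 2) (q := 3) hk k3 (rv 0 h0) (h.slice 0 h0).cube_integrable
  have key := hac.integral_eq (fun w => ker1 ε j (w.1 - w.2)) ht i0 I
  rw [integral_kernel_eq (p := 3 / 2) (q := 3) hk k3 (rv t ht) (h.slice t ht).cube_integrable,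
    integral_kernel_eq (p := 3 / 2) (q := 3) hk k3 (rv 0 h0) (h.slice 0 h0).cube_integrable] at key
  rw [key]
  congr 1
  refine intervalIntegral.integral_congr_ae ?_
  rw [ae_restrict_iff' measurableSet_Ioo] at hrate
  have hne : ∀ᵐ s : ℝ, s ≠ T := by simp [ae_iff, measure_singleton]
  filter_upwards [hrate, hne] with s hs hne hs'
  rw [uIoc_of_le ht.1] at hs'
  exact hs ⟨hs'.1, lt_of_le_of_ne (hs'.2.trans ht.2) hne⟩

end Flow


/-! ### The effective viscous flux and the limit ε → 0 -/

lemma memLp_eta {ε : ℝ} (hε : 0 < ε) (h1 : ε ≤ 1) : MemLp (eta ε) 2 volume := by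
  have e : eta ε = fun x => ∑ i, ker2 ε i i x := by ext x; rw [sum_ker2 hε]
  rw [e]
  exact memLp_finsetSum _ fun i _ => memLp_ker2 hε h1 (by simp) (by norm_num) i i

namespace Flow

variable {T R μ lam : ℝ} {r rt th : ℝ → E3 → ℝ} {Dr Dth v a : Fin 3 → ℝ → E3 → ℝ}
    {Dv : Fin 3 → Fin 3 → ℝ → E3 → ℝ} {D2v : Fin 3 → Fin 3 → Fin 3 → ℝ → E3 → ℝ} {M : ℝ≥0}

/-- The effective viscous flux, up to sign. -/
noncomputable def flux (R μ lam : ℝ) (r th : ℝ → E3 → ℝ) (Dv : Fin 3 → Fin 3 → ℝ → E3 → ℝ)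
    (s : ℝ) (x : E3) : ℝ := R * r s x * th s x - (2 * μ + lam) * ∑ i, Dv i i s x

lemma flux_two (h : Flow T R μ lam r rt th Dr Dth v a Dv D2v M) {s : ℝ} (hs : s ∈ Icc 0 T) :
    MemLp (flux R μ lam r th Dv s) 2 volume := by
  have S := h.slice s hs
  exact (memLp_mul (p := 2) (q := ⊤) (S.r_two.const_mul R) (h.th_top s hs)).sub
    ((memLp_finsetSum _ fun i _ => S.Dv_two i i).const_mul _)

lemma exists_flux_bound (h : Flow T R μ lam r rt th Dr Dth v a Dv D2v M) :
    ∃ B : ℝ≥0, ∀ s ∈ Icc 0 T, eLpNorm (flux R μ lam r th Dv s) 2 volume ≤ B := by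
  refine ⟨‖R‖₊ * M * M + ‖2 * μ + lam‖₊ * (3 * M), fun s hs => ?_⟩
  have S := h.slice s hs
  have hd : MemLp (fun x => ∑ i, Dv i i s x) 2 volume := memLp_finsetSum _ fun i _ => S.Dv_two i i
  refine (eLpNorm_sub_le ((S.r_two.1.const_mul R).mul (h.th_top s hs).1) (hd.1.const_mul _)
    (by norm_num)).trans ?_
  push_cast
  gcongr
  · refine (eLpNorm_mul_le' (p := 2) (q := ⊤) (S.r_two.1.const_mul R) (h.th_top s hs).1).trans ?_
    gcongr
    · have := eLpNorm_const_smul R (r s) 2 (volume : Measure E3)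
      refine (le_of_eq this).trans ?_
      rw [enorm_eq_nnnorm]
      gcongr
      exact h.bdd_r s hs
    · exact h.bdd_th s hs
  · have := eLpNorm_const_smul (2 * μ + lam) (fun x => ∑ i, Dv i i s x) 2 (volume : Measure E3)
    refine (le_of_eq this).trans ?_
    rw [enorm_eq_nnnorm]
    gcongr
    have e : (fun x => ∑ i, Dv i i s x) = ∑ i, Dv i i s := by ext x; simp
    rw [e]
    refine (eLpNorm_sum_le (fun i _ => (S.Dv_two i i).1) (by norm_num)).trans ?_
    refine (Finset.sum_le_sum fun i _ => h.bdd_Dv s hs i i).trans (le_of_eq ?_)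
    simp

lemma meas_flux (h : Flow T R μ lam r rt th Dr Dth v a Dv D2v M) :
    AEStronglyMeasurable (fun z : ℝ × E3 => flux R μ lam r th Dv z.1 z.2)
      ((volume.restrict (Ioo 0 T)).prod volume) := by
  have hd : AEStronglyMeasurable (fun z : ℝ × E3 => ∑ i, Dv i i z.1 z.2)
      ((volume.restrict (Ioo 0 T)).prod volume) :=
    Finset.aestronglyMeasurable_fun_sum _ fun i _ => h.meas_Dv i i
  exact ((h.ac_r.meas.const_mul R).mul h.meas_th).sub (hd.const_mul _)

/-- The effective viscous flux tested with the regularised density power. -/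
noncomputable def smoothFlux (R μ lam : ℝ) (r th : ℝ → E3 → ℝ) (Dv : Fin 3 → Fin 3 → ℝ → E3 → ℝ)
    (ε s : ℝ) : ℝ := ∫ x, flux R μ lam r th Dv s x * cv (eta ε) (fun y => r s y ^ 3) x

lemma integrableOn_smoothFlux (h : Flow T R μ lam r rt th Dr Dth v a Dv D2v M) {ε : ℝ}
    (hε : 0 < ε) (h1 : ε ≤ 1) :
    IntegrableOn (smoothFlux R μ lam r th Dv ε) (Ioo 0 T) volume := by
  obtain ⟨B, hB⟩ := h.exists_flux_bound
  have I := integrable_kernel_time (p := 2) (q := 2) (k := eta ε) (F := flux R μ lam r th Dv)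
    (G := fun t x => r t x ^ 3) (continuous_eta hε) (memLp_eta hε h1) h.meas_flux
    h.ac_r.cube.meas (lintegral_lt_top_of_le (C := (B : ℝ≥0∞) * (M * M * M)) (by finiteness)
      fun t ht => mul_le_mul' (hB t ⟨ht.1.le, ht.2.le⟩) (h.bdd_cube ⟨ht.1.le, ht.2.le⟩))
  refine I.integral_prod_left.congr ?_
  filter_upwards [ae_restrict_mem measurableSet_Ioo] with s hs
  have hs' : s ∈ Icc 0 T := ⟨hs.1.le, hs.2.le⟩
  exact integral_kernel_eq (p := 2) (q := 2) (continuous_eta hε) (memLp_eta hε h1)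
    (h.flux_two hs') (h.slice s hs').cube_integrable

/-- The bound does not depend on ε and supplies the dominating constant for the limit under the time
integral. -/
lemma enorm_smoothFlux_le (h : Flow T R μ lam r rt th Dr Dth v a Dv D2v M) {B : ℝ≥0}
    (hB : ∀ s ∈ Icc 0 T, eLpNorm (flux R μ lam r th Dv s) 2 volume ≤ B) {ε : ℝ}
    (hε : 0 < ε) (h1 : ε ≤ 1) {s : ℝ} (hs : s ∈ Icc 0 T) :
    ‖smoothFlux R μ lam r th Dv ε s‖ₑ ≤ B * (ENNReal.ofReal etaMass * (M * M * M)) := by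
  have S := h.slice s hs
  refine (enorm_integral_mul_le (p := 2) (q := 2) (h.flux_two hs).1
    ?_).trans ?_
  · have e : cv (eta ε) (fun y => r s y ^ 3)
        = fun x => ∑ i, cv (ker2 ε i i) (fun y => r s y ^ 3) x := by
      ext x; rw [sum_cv_ker2 hε S.cube_integrable]
    rw [e]
    exact (memLp_finsetSum _ fun i _ => memLp_cv_ker2 (p := 2) hε h1 S.cube_integrable
      (by norm_num) (by simp) i i).1
  · refine mul_le_mul' (hB s hs) ?_
    rw [← eLpNorm_eta hε h1]
    exact (eLpNorm_cv_le (by norm_num) (by simp) (continuous_eta hε).measurable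
      S.cube_integrable.1).trans (mul_le_mul' le_rfl (h.bdd_cube_two hs))

/-- The tested momentum equation accounts for the two parts of the rate in which time hits the
momentum, and the continuity equation for r³ accounts for the part in which it hits the potential.
-/
lemma rate_eq (h : Flow T R μ lam r rt th Dr Dth v a Dv D2v M) {ε : ℝ}
    (hε : 0 < ε) (h1 : ε ≤ 1) : ∀ᵐ s ∂(volume.restrict (Ioo 0 T)),
      ∑ j, rate r rt v a ε j s = smoothFlux R μ lam r th Dv ε s
        + Slice.defect (r s) (fun j => v j s) (fun i j => Dv i j s) ε := by
  filter_upwards [h.a_six, h.continuity, h.momentum, ae_restrict_mem measurableSet_Ioo]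
    with s ha hc hm hs
  have hs' : s ∈ Icc 0 T := ⟨hs.1.le, hs.2.le⟩
  have S := h.slice s hs'
  have k1 := S.integral_momentum hc (D2v := fun k i j => D2v k i j s) (h.D2v_two s hs')
    (h.Dv_partial s hs') (h.th_top s hs') (h.Dth_two s hs') (h.th_partial s hs')
    (a := fun j => a j s) ha hm hε h1 S.cube_integrable
  have k2 := fun j => S.integral_test_deriv hc hε h1 j
  simp only [rate, Slice.defect]
  rw [Finset.sum_add_distrib, ← Finset.sum_congr rfl fun j _ => k2 j]
  have e : ∑ j, ((∫ x, rt s x * v j s x * cv (ker1 ε j) (fun y => r s y ^ 3) x)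
      + ∫ x, r s x * a j s x * cv (ker1 ε j) (fun y => r s y ^ 3) x)
      = ∑ j, ((∫ x, r s x * a j s x * cv (ker1 ε j) (fun y => r s y ^ 3) x)
      + ∫ x, rt s x * v j s x * cv (ker1 ε j) (fun y => r s y ^ 3) x) :=
    Finset.sum_congr rfl fun j _ => add_comm _ _
  rw [e, k1, smoothFlux]
  simp only [flux]
  ring

/-- The pairing of the momentum with the regularised potential. -/
noncomputable def pair (r : ℝ → E3 → ℝ) (v : Fin 3 → ℝ → E3 → ℝ) (ε t : ℝ) : ℝ :=
  ∑ j, ∫ x, r t x * v j t x * cv (ker1 ε j) (fun y => r t y ^ 3) x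

lemma integral_smoothFlux (h : Flow T R μ lam r rt th Dr Dth v a Dv D2v M) {ε : ℝ}
    (hε : 0 < ε) (h1 : ε ≤ 1) {t : ℝ} (ht : t ∈ Icc 0 T) :
    ∫ s in 0..t, smoothFlux R μ lam r th Dv ε s = pair r v ε t - pair r v ε 0
      - ∫ s in 0..t, Slice.defect (r s) (fun j => v j s) (fun i j => Dv i j s) ε := by
  have conv : ∀ {f : ℝ → ℝ}, IntegrableOn f (Ioo 0 T) volume → IntegrableOn f (Ioo 0 t) volume :=
    fun hf => hf.mono_set (Ioo_subset_Ioo_right ht.2)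
  have hI : ∀ f : ℝ → ℝ, ∫ s in 0..t, f s = ∫ s in Ioo 0 t, f s := fun f => by
    rw [intervalIntegral.integral_of_le ht.1, integral_Ioc_eq_integral_Ioo]
  have hr : ∀ j, IntegrableOn (rate r rt v a ε j) (Ioo 0 t) volume := fun j =>
    conv (h.pairing hε h1 j).1
  have hsr : IntegrableOn (fun s => ∑ j, rate r rt v a ε j s) (Ioo 0 t) volume :=
    integrable_finsetSum _ fun j _ => hr j
  have hf := conv (h.integrableOn_smoothFlux hε h1)
  have hre := ae_restrict_of_ae_restrict_of_subset (Ioo_subset_Ioo_right ht.2) (h.rate_eq hε h1)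
  have hd : ∫ s in Ioo 0 t, Slice.defect (r s) (fun j => v j s) (fun i j => Dv i j s) ε
      = ∫ s in Ioo 0 t, (∑ j, rate r rt v a ε j s - smoothFlux R μ lam r th Dv ε s) := by
    refine integral_congr_ae ?_
    filter_upwards [hre] with s hs
    rw [hs]; ring
  have hp : pair r v ε t = pair r v ε 0 + ∑ j, ∫ s in 0..t, rate r rt v a ε j s := by
    simp only [pair]
    rw [← Finset.sum_add_distrib]
    exact Finset.sum_congr rfl fun j _ => (h.pairing hε h1 j).2 t ht
  simp only [hI] at hp ⊢
  rw [hd, integral_sub hsr hf, hp, integral_finsetSum _ fun j _ => hr j]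
  ring

/-- At each ε the time integral of the smoothed flux is the increment of the pairing minus the
integrated defect, whence 2K for the two endpoints plus the integral of D. Both bounds are
independent of ε, so they pass to the limit, in which η_ε ∗ r³ becomes `etaMass` times r³. -/
lemma enorm_integral_flux_le (h : Flow T R μ lam r rt th Dr Dth v a Dv D2v M) {K : ℝ≥0∞}
    (hK : ∀ ε, 0 < ε → ε ≤ 1 → ∀ t ∈ Icc 0 T, ‖pair r v ε t‖ₑ ≤ K) {D : ℝ → ℝ≥0∞}
    (hD : ∀ ε, 0 < ε → ε ≤ 1 → ∀ t ∈ Icc 0 T,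
      ‖Slice.defect (r t) (fun j => v j t) (fun i j => Dv i j t) ε‖ₑ ≤ D t)
    {t : ℝ} (ht : t ∈ Icc 0 T) :
    ‖∫ s in 0..t, etaMass * ∫ x, flux R μ lam r th Dv s x * r s x ^ 3‖ₑ
      ≤ 2 * K + ∫⁻ s in Ioo 0 T, D s := by
  obtain ⟨B, hB⟩ := h.exists_flux_bound
  have hlim : Tendsto (fun n => ∫ s in 0..t, smoothFlux R μ lam r th Dv (scale n) s) atTop
      (𝓝 (∫ s in 0..t, etaMass * ∫ x, flux R μ lam r th Dv s x * r s x ^ 3)) := by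
    have sub : ∀ s ∈ uIoc 0 t, s ∈ Icc 0 T := fun s hs => by
      rw [uIoc_of_le ht.1] at hs; exact ⟨hs.1.le, hs.2.trans ht.2⟩
    have hfin : (B : ℝ≥0∞) * (ENNReal.ofReal etaMass * (M * M * M)) ≠ ⊤ := by finiteness
    refine intervalIntegral.tendsto_integral_filter_of_dominated_convergence
      (fun _ => ((B : ℝ≥0∞) * (ENNReal.ofReal etaMass * (M * M * M))).toReal) ?_ ?_ ?_ ?_
    · refine .of_forall fun n => ?_
      rw [uIoc_of_le ht.1, ← restrict_Ioo_eq_restrict_Ioc]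
      exact ((h.integrableOn_smoothFlux (scale_pos n) (scale_le n)).mono_set
        (Ioo_subset_Ioo_right ht.2)).1
    · refine .of_forall fun n => .of_forall fun s hs => ?_
      have := ENNReal.toReal_mono hfin
        (h.enorm_smoothFlux_le hB (scale_pos n) (scale_le n) (sub s hs))
      rwa [toReal_enorm] at this
    · exact intervalIntegrable_const
    · refine .of_forall fun s hs => ?_
      -- Weak convergence suffices at each fixed time, as the flux and r³ both lie in L².
      exact tendsto_integral_mul_cv_eta (p := 2) (p' := 2) (by norm_num) (by simp)
        (h.flux_two (sub s hs)) (h.slice s (sub s hs)).cube_two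
  refine le_of_tendsto hlim.enorm (.of_forall fun n => ?_)
  have h0 : (0 : ℝ) ∈ Icc 0 T := left_mem_Icc.2 h.pos.le
  rw [h.integral_smoothFlux (scale_pos n) (scale_le n) ht]
  refine enorm_sub_le.trans (add_le_add (enorm_sub_le.trans ?_) ?_)
  · rw [two_mul]
    exact add_le_add (hK _ (scale_pos n) (scale_le n) t ht) (hK _ (scale_pos n) (scale_le n) 0 h0)
  · rw [intervalIntegral.integral_of_le ht.1, integral_Ioc_eq_integral_Ioo]
    refine (enorm_integral_le_lintegral_enorm _).trans ?_
    refine (lintegral_mono_set (Ioo_subset_Ioo_right ht.2)).trans ?_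
    exact setLIntegral_mono' measurableSet_Ioo fun s hs =>
      hD _ (scale_pos n) (scale_le n) s ⟨hs.1.le, hs.2.le⟩

lemma integrable_prod_mul_two {F G : ℝ → E3 → ℝ} {B B' : ℝ≥0}
    (hF : AEStronglyMeasurable (fun z : ℝ × E3 => F z.1 z.2) ((volume.restrict (Ioo 0 T)).prod volume))
    (hG : AEStronglyMeasurable (fun z : ℝ × E3 => G z.1 z.2) ((volume.restrict (Ioo 0 T)).prod volume))
    (hFb : ∀ t ∈ Icc 0 T, eLpNorm (F t) 2 volume ≤ B)
    (hGb : ∀ t ∈ Icc 0 T, eLpNorm (G t) 2 volume ≤ B') :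
    Integrable (fun z : ℝ × E3 => F z.1 z.2 * G z.1 z.2)
      ((volume.restrict (Ioo 0 T)).prod volume) := by
  refine ⟨hF.mul hG, ?_⟩
  have hm : AEMeasurable (fun z : ℝ × E3 => ‖F z.1 z.2 * G z.1 z.2‖ₑ)
    ((volume.restrict (Ioo 0 T)).prod volume) := (hF.mul hG).enorm
  rw [HasFiniteIntegral, lintegral_prod _ hm]
  have : ∫⁻ _ in Ioo 0 T, (B : ℝ≥0∞) * B' < ⊤ :=
    lintegral_lt_top_of_le (C := (B : ℝ≥0∞) * B') (by finiteness) fun _ _ => le_rfl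
  refine lt_of_le_of_lt (lintegral_mono_ae ?_) this
  filter_upwards [hF.prodMk_left, hG.prodMk_left, ae_restrict_mem measurableSet_Ioo]
    with t h1 h2 ht
  exact (lintegral_mul_le (p := 2) (q := 2) h1 h2).trans
    (mul_le_mul' (hFb t ⟨ht.1.le, ht.2.le⟩) (hGb t ⟨ht.1.le, ht.2.le⟩))

/-- The pressure weighted by the density power, as an integral over space-time. -/
lemma integrable_pressure (h : Flow T R μ lam r rt th Dr Dth v a Dv D2v M) :
    Integrable (fun z : ℝ × E3 => r z.1 z.2 ^ 3 * (R * r z.1 z.2 * th z.1 z.2))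
      ((volume.restrict (Ioo 0 T)).prod volume) := by
  refine integrable_prod_mul_two (F := fun t x => r t x ^ 3)
    (G := fun t x => R * r t x * th t x) (B := M * M * M) (B' := ‖R‖₊ * M * M)
    h.ac_r.cube.meas ((h.ac_r.meas.const_mul R).mul h.meas_th)
    (fun t ht => by push_cast; exact h.bdd_cube_two ht) fun t ht => ?_
  have S := h.slice t ht
  push_cast
  refine (eLpNorm_mul_le' (p := 2) (q := ⊤) (S.r_two.1.const_mul R) (h.th_top t ht).1).trans ?_
  gcongr
  · have := eLpNorm_const_smul R (r t) 2 (volume : Measure E3)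
    refine (le_of_eq this).trans ?_
    rw [enorm_eq_nnnorm]
    gcongr
    exact h.bdd_r t ht
  · exact h.bdd_th t ht

/-- The balance of ∫r³ turns the divergence part of the flux into (2μ+λ)/2 times the increment of
∫r³; the rest is the weighted pressure. -/
lemma integral_flux_eq (h : Flow T R μ lam r rt th Dr Dth v a Dv D2v M) {t : ℝ}
    (ht : t ∈ Icc 0 T) :
    ∫ s in 0..t, etaMass * ∫ x, flux R μ lam r th Dv s x * r s x ^ 3
      = etaMass * ((∫ s in Ioo 0 t, ∫ x, r s x ^ 3 * (R * r s x * th s x))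
        + (2 * μ + lam) / 2 * ((∫ x, r t x ^ 3) - ∫ x, r 0 x ^ 3)) := by
  have hI : ∀ f : ℝ → ℝ, ∫ s in 0..t, f s = ∫ s in Ioo 0 t, f s := fun f => by
    rw [intervalIntegral.integral_of_le ht.1, integral_Ioc_eq_integral_Ioo]
  have iP : IntegrableOn (fun s => ∫ x, r s x ^ 3 * (R * r s x * th s x)) (Ioo 0 t) volume :=
    h.integrable_pressure.integral_prod_left.mono_measure
      (Measure.restrict_mono (Ioo_subset_Ioo_right ht.2) le_rfl)
  have iD : IntegrableOn (fun s => ∫ x, r s x ^ 3 * ∑ i, Dv i i s x) (Ioo 0 t) volume := by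
    have hd : AEStronglyMeasurable (fun z : ℝ × E3 => ∑ i, Dv i i z.1 z.2)
        ((volume.restrict (Ioo 0 T)).prod volume) :=
      Finset.aestronglyMeasurable_fun_sum _ fun i _ => h.meas_Dv i i
    have := integrable_prod_mul_two (F := fun t x => r t x ^ 3) (G := fun t x => ∑ i, Dv i i t x)
      (B := M * M * M) (B' := 3 * M) h.ac_r.cube.meas hd
      (fun t ht => by push_cast; exact h.bdd_cube_two ht) (fun t ht => by
        have S := h.slice t ht
        have e : (fun x => ∑ i, Dv i i t x) = ∑ i, Dv i i t := by ext x; simp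
        rw [e]
        refine (eLpNorm_sum_le (fun i _ => (S.Dv_two i i).1) (by norm_num)).trans ?_
        refine (Finset.sum_le_sum fun i _ => h.bdd_Dv t ht i i).trans (le_of_eq ?_)
        simp)
    exact this.integral_prod_left.mono_measure
      (Measure.restrict_mono (Ioo_subset_Ioo_right ht.2) le_rfl)
  rw [h.integral_cube ht, hI, hI, integral_const_mul]
  have e : ∫ s in Ioo 0 t, ∫ x, flux R μ lam r th Dv s x * r s x ^ 3
      = ∫ s in Ioo 0 t, ((∫ x, r s x ^ 3 * (R * r s x * th s x))
        - (2 * μ + lam) * ∫ x, r s x ^ 3 * ∑ i, Dv i i s x) := by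
    refine setIntegral_congr_fun measurableSet_Ioo fun s hs => ?_
    have hs' : s ∈ Icc 0 T := ⟨hs.1.le, (hs.2.trans_le ht.2).le⟩
    have S := h.slice s hs'
    rw [← integral_const_mul, ← integral_sub]
    · refine integral_congr_ae (.of_forall fun x => ?_)
      simp only [flux]; ring
    · exact integrable_mul_two S.cube_two
        (memLp_mul (p := 2) (q := ⊤) (S.r_two.const_mul R) (h.th_top s hs'))
    · exact S.cube_div_integrable.const_mul _
  rw [e, integral_sub iP (iD.const_mul _), integral_const_mul]
  ring

end Flow


namespace Flow

variable {T R μ lam : ℝ} {r rt th : ℝ → E3 → ℝ} {Dr Dth v a : Fin 3 → ℝ → E3 → ℝ}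
    {Dv : Fin 3 → Fin 3 → ℝ → E3 → ℝ} {D2v : Fin 3 → Fin 3 → Fin 3 → ℝ → E3 → ℝ} {M : ℝ≥0}

lemma ofReal_integral_cube (h : Flow T R μ lam r rt th Dr Dth v a Dv D2v M) {t : ℝ}
    (ht : t ∈ Icc 0 T) : ENNReal.ofReal (∫ x, r t x ^ 3) = eLpNorm (r t) 3 volume ^ 3 := by
  have h0 : 0 ≤ᵐ[volume] fun x => r t x ^ 3 := by
    filter_upwards [h.nonneg t ht] with x hx
    exact pow_nonneg hx 3
  rw [← eLpNorm_cube_one, ofReal_integral_eq_lintegral_ofReal (h.slice t ht).cube_integrable h0]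
  refine lintegral_congr_ae ?_
  filter_upwards [h0] with x hx
  exact (Real.enorm_eq_ofReal hx).symm

lemma pressure_nonneg (h : Flow T R μ lam r rt th Dr Dth v a Dv D2v M) (hR : 0 ≤ R) {s : ℝ}
    (hs : s ∈ Icc 0 T) : 0 ≤ᵐ[volume] fun x => r s x ^ 3 * (R * r s x * th s x) := by
  filter_upwards [h.nonneg s hs, h.th_nonneg s hs] with x h1 h2
  simp only [Pi.zero_apply]
  positivity

lemma ofReal_integral_pressure (h : Flow T R μ lam r rt th Dr Dth v a Dv D2v M) (hR : 0 ≤ R) :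
    ENNReal.ofReal (∫ s in Ioo 0 T, ∫ x, r s x ^ 3 * (R * r s x * th s x))
      = ∫⁻ s in Ioo 0 T, ∫⁻ x, ENNReal.ofReal (r s x ^ 3 * (R * r s x * th s x)) := by
  have hp : ∀ᵐ s ∂(volume.restrict (Ioo 0 T)),
      0 ≤ ∫ x, r s x ^ 3 * (R * r s x * th s x) := by
    filter_upwards [ae_restrict_mem measurableSet_Ioo] with s hs
    exact integral_nonneg_of_ae (h.pressure_nonneg hR ⟨hs.1.le, hs.2.le⟩)
  rw [ofReal_integral_eq_lintegral_ofReal h.integrable_pressure.integral_prod_left hp]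
  refine lintegral_congr_ae ?_
  filter_upwards [ae_restrict_mem measurableSet_Ioo] with s hs
  have hs' : s ∈ Icc 0 T := ⟨hs.1.le, hs.2.le⟩
  have S := h.slice s hs'
  exact ofReal_integral_eq_lintegral_ofReal (integrable_mul_two S.cube_two
    (memLp_mul (p := 2) (q := ⊤) (S.r_two.const_mul R) (h.th_top s hs')))
    (h.pressure_nonneg hR hs')

/-- The density and pressure estimate in terms of the bounds on the pairing and the defect. -/
lemma density_pressure_le (h : Flow T R μ lam r rt th Dr Dth v a Dv D2v M) (hR : 0 ≤ R)
    (hν : 0 < 2 * μ + lam) {K : ℝ≥0∞}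
    (hK : ∀ ε, 0 < ε → ε ≤ 1 → ∀ t ∈ Icc 0 T, ‖pair r v ε t‖ₑ ≤ K) {D : ℝ → ℝ≥0∞}
    (hD : ∀ ε, 0 < ε → ε ≤ 1 → ∀ t ∈ Icc 0 T,
      ‖Slice.defect (r t) (fun j => v j t) (fun i j => Dv i j t) ε‖ₑ ≤ D t) :
    (⨆ t ∈ Icc 0 T, eLpNorm (r t) 3 volume ^ 3)
        + (∫⁻ s in Ioo 0 T, ∫⁻ x, ENNReal.ofReal (r s x ^ 3 * (R * r s x * th s x)))
      ≤ (1 + ENNReal.ofReal ((2 * μ + lam) / 2)) * eLpNorm (r 0) 3 volume ^ 3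
        + ENNReal.ofReal (etaMass⁻¹ * (2 / (2 * μ + lam)) + etaMass⁻¹)
          * (2 * K + ∫⁻ s in Ioo 0 T, D s) := by
  set Z := 2 * K + ∫⁻ s in Ioo 0 T, D s with hZ
  set n := (2 * μ + lam) / 2 with hn
  have hn0 : 0 < n := by positivity
  have hc := etaMass_pos
  have h0 : (0 : ℝ) ∈ Icc 0 T := left_mem_Icc.2 h.pos.le
  set Y : ℝ → ℝ := fun t => ∫ x, r t x ^ 3 with hY
  set P : ℝ → ℝ := fun t => ∫ s in Ioo 0 t, ∫ x, r s x ^ 3 * (R * r s x * th s x) with hP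
  have hYn : ∀ t ∈ Icc 0 T, 0 ≤ Y t := fun t ht => integral_nonneg_of_ae (by
    filter_upwards [h.nonneg t ht] with x hx
    exact pow_nonneg hx 3)
  have hPn : ∀ t ∈ Icc 0 T, 0 ≤ P t := fun t ht =>
    setIntegral_nonneg measurableSet_Ioo fun s hs =>
      integral_nonneg_of_ae (h.pressure_nonneg hR ⟨hs.1.le, (hs.2.trans_le ht.2).le⟩)
  -- The flux integral equals `etaMass` (P + n(Y − Y(0))). Solving for P + nY leaves the initial
  -- datum and the bound Z divided by `etaMass`.
  have key : ∀ t ∈ Icc 0 T, ENNReal.ofReal (P t + n * Y t)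
      ≤ ENNReal.ofReal (n * Y 0) + ENNReal.ofReal etaMass⁻¹ * Z := by
    intro t ht
    have hb := h.enorm_integral_flux_le hK hD ht
    rw [h.integral_flux_eq ht] at hb
    set X := etaMass * (P t + n * (Y t - Y 0)) with hX
    have e : P t + n * Y t = n * Y 0 + etaMass⁻¹ * X := by
      rw [hX, ← mul_assoc, inv_mul_cancel₀ hc.ne']; ring
    rw [e]
    refine ENNReal.ofReal_add_le.trans ?_
    gcongr
    rw [ENNReal.ofReal_mul (inv_pos.2 hc).le]
    gcongr
    refine le_trans ?_ hb
    exact Real.ofReal_le_enorm X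
  -- The nonnegative pressure part is dropped for the supremum; conversely nY is dropped at time T
  -- for the pressure integral. Adding the two gives the coefficients in the statement.
  have hsup : (⨆ t ∈ Icc 0 T, eLpNorm (r t) 3 volume ^ 3)
      ≤ eLpNorm (r 0) 3 volume ^ 3 + ENNReal.ofReal (etaMass⁻¹ * (2 / (2 * μ + lam))) * Z := by
    refine iSup₂_le fun t ht => ?_
    rw [← h.ofReal_integral_cube ht, ← h.ofReal_integral_cube h0]
    have e : (2 / (2 * μ + lam)) = n⁻¹ := by rw [hn, inv_div]
    rw [e]
    have k := mul_le_mul_right (key t ht) (ENNReal.ofReal n⁻¹)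
    have h1 : ENNReal.ofReal (Y t) ≤ ENNReal.ofReal n⁻¹ * ENNReal.ofReal (P t + n * Y t) := by
      rw [← ENNReal.ofReal_mul (inv_pos.2 hn0).le]
      refine ENNReal.ofReal_le_ofReal ?_
      rw [mul_add, ← mul_assoc, inv_mul_cancel₀ hn0.ne', one_mul]
      have := mul_nonneg (inv_pos.2 hn0).le (hPn t ht)
      linarith
    refine h1.trans (k.trans (le_of_eq ?_))
    rw [mul_add, ← ENNReal.ofReal_mul (inv_pos.2 hn0).le, ← mul_assoc n⁻¹,
      inv_mul_cancel₀ hn0.ne', one_mul, ← mul_assoc, ← ENNReal.ofReal_mul (inv_pos.2 hn0).le,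
      mul_comm n⁻¹]
  have hpr : (∫⁻ s in Ioo 0 T, ∫⁻ x, ENNReal.ofReal (r s x ^ 3 * (R * r s x * th s x)))
      ≤ ENNReal.ofReal n * eLpNorm (r 0) 3 volume ^ 3 + ENNReal.ofReal etaMass⁻¹ * Z := by
    have hT : T ∈ Icc 0 T := right_mem_Icc.2 h.pos.le
    rw [← h.ofReal_integral_pressure hR, ← h.ofReal_integral_cube h0,
      ← ENNReal.ofReal_mul hn0.le]
    refine le_trans (ENNReal.ofReal_le_ofReal ?_) (key T hT)
    have := mul_nonneg hn0.le (hYn T hT)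
    simp only [hP]
    linarith
  refine (add_le_add hsup hpr).trans (le_of_eq ?_)
  rw [ENNReal.ofReal_add (by positivity) (by positivity)]
  ring

end Flow

/-! ### Components of a strong solution -/

/-- Continuity bounds the norm near each time, and compactness of the interval leaves finitely many
such bounds. -/
lemma ContInLp.exists_bound {F : Type} [NormedAddCommGroup F] {T : ℝ} {p : ℝ≥0∞} (hp : 1 ≤ p)
    {f : ℝ → E3 → F} (h : ContInLp T p f) :
    ∃ B : ℝ≥0, ∀ t ∈ Icc 0 T, eLpNorm (f t) p volume ≤ B := by
  refine isCompact_Icc.induction_on (p := fun s => ∃ B : ℝ≥0, ∀ t ∈ s ∩ Icc 0 T,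
    eLpNorm (f t) p volume ≤ B) ?_ ?_ ?_ ?_ |>.imp fun B hB t ht => hB t ⟨ht, ht⟩
  · exact ⟨0, by simp⟩
  · rintro s s' hs ⟨B, hB⟩
    exact ⟨B, fun t ht => hB t ⟨hs ht.1, ht.2⟩⟩
  · rintro s s' ⟨B, hB⟩ ⟨B', hB'⟩
    refine ⟨max B B', fun t ht => ?_⟩
    rcases ht.1 with h1 | h1
    · exact (hB t ⟨h1, ht.2⟩).trans (by simp)
    · exact (hB' t ⟨h1, ht.2⟩).trans (by simp)
  · intro s hs
    have h1 : ∀ᶠ t in 𝓝[Icc 0 T] s, eLpNorm (f t - f s) p volume < 1 :=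
      (h.2 s hs).eventually (gt_mem_nhds one_pos)
    refine ⟨_, inter_mem h1 self_mem_nhdsWithin, (eLpNorm (f s) p volume).toNNReal + 1, ?_⟩
    rintro t ⟨⟨ht, -⟩, ht'⟩
    have e : f t = f s + (f t - f s) := by abel
    rw [e]
    refine (eLpNorm_add_le (h.1 s hs).1 ((h.1 t ht').1.sub (h.1 s hs).1) hp).trans ?_
    rw [ENNReal.coe_add, ENNReal.coe_toNNReal (h.1 s hs).2.ne]
    gcongr
    exact le_of_lt ht

lemma eLpNorm_clm_le {F : Type} [NormedAddCommGroup F] [NormedSpace ℝ F] {L : F →L[ℝ] ℝ}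
    (hL : ∀ y, ‖L y‖ ≤ ‖y‖) (f : E3 → F) (p : ℝ≥0∞) :
    eLpNorm (fun x => L (f x)) p volume ≤ eLpNorm f p volume :=
  eLpNorm_mono fun x => hL (f x)

lemma ContInLp.clm {F : Type} [NormedAddCommGroup F] [NormedSpace ℝ F] {T : ℝ} {p : ℝ≥0∞}
    {f : ℝ → E3 → F} (h : ContInLp T p f) {L : F →L[ℝ] ℝ} (hL : ∀ y, ‖L y‖ ≤ ‖y‖) :
    ContInLp T p (fun t x => L (f t x)) := by
  refine ⟨fun t ht => L.comp_memLp' (h.1 t ht), fun s hs => ?_⟩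
  refine tendsto_of_tendsto_of_tendsto_of_le_of_le tendsto_const_nhds (h.2 s hs)
    (fun _ => zero_le) fun t => ?_
  refine le_trans (le_of_eq ?_) (eLpNorm_clm_le hL (f t - f s) p)
  congr 1; ext x; simp

lemma JointMeas.clm {F : Type} [NormedAddCommGroup F] [NormedSpace ℝ F] {T : ℝ}
    {f : ℝ → E3 → F} (h : JointMeas T f) (L : F →L[ℝ] ℝ) :
    JointMeas T (fun t x => L (f t x)) :=
  L.continuous.comp_aestronglyMeasurable h

/-- Since b ≤ 1 + b² and the time interval is bounded, square integrability in time gives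
integrability, which is what time primitives require. -/
lemma L2InLp.lintegral_clm {F : Type} [NormedAddCommGroup F] [NormedSpace ℝ F] {T : ℝ}
    {p : ℝ≥0∞} {f : ℝ → E3 → F} (h : L2InLp T p f) {L : F →L[ℝ] ℝ} (hL : ∀ y, ‖L y‖ ≤ ‖y‖) :
    ∫⁻ t in Ioo 0 T, eLpNorm (fun x => L (f t x)) p volume < ⊤ := by
  have h1 : ∀ b : ℝ≥0∞, b ≤ 1 + b ^ 2 := by
    intro b
    rcases le_total b 1 with hb | hb
    · exact hb.trans le_self_add
    · calc b = b * 1 := (mul_one b).symm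
        _ ≤ b * b := by gcongr
        _ ≤ 1 + b ^ 2 := by rw [sq]; exact le_add_self
  refine lt_of_le_of_lt (lintegral_mono fun t => (eLpNorm_clm_le hL (f t) p).trans (h1 _)) ?_
  rw [lintegral_add_left measurable_const]
  refine ENNReal.add_lt_top.2 ⟨by simp, h⟩

lemma HasWeakTimeDeriv.clm {F : Type} [NormedAddCommGroup F] [NormedSpace ℝ F] [CompleteSpace F]
    {T : ℝ} {f g : ℝ → E3 → F} (h : HasWeakTimeDeriv T f g) (L : F →L[ℝ] ℝ) (φ : ℝ × E3 → ℝ)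
    (h1 : ContDiff ℝ ∞ φ) (h2 : HasCompactSupport φ) (h3 : tsupport φ ⊆ Ioo 0 T ×ˢ univ) :
    ∫ z, fderiv ℝ φ z (1, 0) * L (f z.1 z.2) = - ∫ z, φ z * L (g z.1 z.2) := by
  have hint : ∀ {G : ℝ × E3 → F} {ψ : ℝ × E3 → ℝ},
      LocallyIntegrableOn G (Ioo 0 T ×ˢ univ) volume → Continuous ψ → tsupport ψ ⊆ tsupport φ →
      Integrable (fun z => ψ z • G z) volume := by
    intro G ψ hG hψ hs
    have i1 : IntegrableOn G (tsupport φ) volume := hG.integrableOn_compact_subset h3 h2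
    have i2 : IntegrableOn (fun z => ψ z • G z) (tsupport φ) volume :=
      i1.continuousOn_smul hψ.continuousOn h2
    have hsub : Function.support (fun z => ψ z • G z) ⊆ tsupport φ := fun z hz =>
      hs (subset_tsupport _ (left_ne_zero_of_smul hz))
    exact (integrableOn_iff_integrable_of_support_subset hsub).1 i2
  have c1 : Continuous (fun z => fderiv ℝ φ z (1, 0)) :=
    (h1.continuous_fderiv (by simp)).clm_apply continuous_const
  have s1 : tsupport (fun z => fderiv ℝ φ z (1, 0)) ⊆ tsupport φ :=
    tsupport_fderiv_apply_subset ℝ _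
  have j1 := L.integral_comp_comm (hint h.1 c1 s1)
  have j2 := L.integral_comp_comm (hint h.2.1 h1.continuous subset_rfl)
  simp only [map_smul, smul_eq_mul] at j1 j2
  rw [j1, j2, h.2.2 φ h1 h2 h3, map_neg]


/-- The `i`-th entry of a gradient. -/
noncomputable def entry {F : Type} [NormedAddCommGroup F] [NormedSpace ℝ F] (i : Fin 3) :
    Grad F →L[ℝ] F := PiLp.proj 2 (fun _ : Fin 3 => F) i

lemma norm_entry_le {F : Type} [NormedAddCommGroup F] [NormedSpace ℝ F] (i : Fin 3) (A : Grad F) :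
    ‖entry i A‖ ≤ ‖A‖ := PiLp.norm_apply_le A i

section VelReg

variable {F : Type} [NormedAddCommGroup F] [NormedSpace ℝ F] [CompleteSpace F] {T : ℝ} {q : ℝ≥0∞}
  {f : ℝ → E3 → F} {Df : ℝ → E3 → Grad F} {D2f : ℝ → E3 → Grad (Grad F)}
  {ft : ℝ → E3 → F} {Dft : ℝ → E3 → Grad F} {L : F →L[ℝ] ℝ}

/-- The gradient is bounded in L², and by Sobolev applied to its entries also in L⁶, because second
derivatives are bounded in L². As 6 > 3, the sup bound by the gradient applies. -/
lemma VelReg.exists_sup_bound (h : VelReg T q f Df D2f ft Dft) (hL : ∀ y, ‖L y‖ ≤ ‖y‖) :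
    ∃ B : ℝ≥0, ∀ t ∈ Icc 0 T, eLpNorm (fun x => L (f t x)) ⊤ volume ≤ B := by
  obtain ⟨C, hC⟩ := HeatNS.exists_sup_bound (q := 6) (by norm_num) (by simp)
  obtain ⟨B1, hB1⟩ := h.cont_D.exists_bound (by norm_num)
  obtain ⟨B2, hB2⟩ := h.cont_D2.exists_bound (by norm_num)
  refine ⟨C * (3 * (B1 + sobConst * (3 * B2))), fun t ht => ?_⟩
  have n1 : ∀ i (A : Grad F), ‖(L.comp (entry i)) A‖ ≤ ‖A‖ := fun i A =>
    (hL _).trans (norm_entry_le i A)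
  have n2 : ∀ k i (A : Grad (Grad F)), ‖((L.comp (entry i)).comp (entry k)) A‖ ≤ ‖A‖ :=
    fun k i A => (n1 i _).trans (norm_entry_le k A)
  have d2 : ∀ i, MemLp (fun x => L (Df t x i)) 2 volume := fun i =>
    (L.comp (entry i)).comp_memLp' (h.cont_D.1 t ht)
  have b2 : ∀ i, eLpNorm (fun x => L (Df t x i)) 2 volume ≤ B1 := fun i =>
    (eLpNorm_clm_le (n1 i) (Df t) 2).trans (hB1 t ht)
  have b6 : ∀ i, eLpNorm (fun x => L (Df t x i)) 6 volume ≤ sobConst * (3 * B2) := by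
    intro i
    refine (eLpNorm_six_le_of_two (G := fun k x => L (D2f t x k i))
      (fun k => (h.grad2 t ht).isWeakPartial (L.comp (entry i)) k) (d2 i)).trans ?_
    gcongr
    refine (Finset.sum_le_sum fun k _ => (eLpNorm_clm_le (n2 k i) (D2f t) 2).trans
      (hB2 t ht)).trans (le_of_eq ?_)
    simp
  have hb := hC (fun x => L (f t x)) (fun i x => L (Df t x i))
    (fun i => (h.grad t ht).isWeakPartial L i) (.inr (L.comp_memLp' (h.cont.1 t ht))) d2
    (fun i => ⟨(d2 i).1, (b6 i).trans_lt (by finiteness)⟩)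
  refine hb.trans ?_
  push_cast
  gcongr
  refine (Finset.sum_le_sum fun i _ => add_le_add (b2 i) (b6 i)).trans (le_of_eq ?_)
  simp only [Finset.sum_const, Finset.card_univ, Fintype.card_fin, nsmul_eq_mul]
  norm_num

lemma VelReg.timeAC (h : VelReg T q f Df D2f ft Dft) (hT : 0 < T) (hL : ∀ y, ‖L y‖ ≤ ‖y‖) :
    TimeAC volume T (fun t x => L (f t x)) (fun t x => L (ft t x)) := by
  obtain ⟨B, hB⟩ := h.cont.exists_bound (by norm_num)
  refine timeAC_of_weak (p := 6) (p' := 6 / 5) (p₁ := 6) hT (by norm_num) (by norm_num)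
    (h.meas.clm L) (h.meas_t.clm L) (h.cont.clm hL) ?_ (h.sq_t.lintegral_clm hL)
    (h.timeDeriv.clm L)
  exact lintegral_lt_top_of_le (C := B) (by finiteness) fun t ht =>
    (eLpNorm_clm_le hL (f t) 6).trans (hB t ⟨ht.1.le, ht.2.le⟩)

end VelReg

namespace StrongSolution

variable {R γ μ lam κ : ℝ} {q : ℝ≥0∞} {T : ℝ} {ρ0 : E3 → ℝ} {u0 : E3 → E3} {θ0 : E3 → ℝ}

/-- This is where q > 3 enters: ∇ρ is bounded in L² ∩ L^q, which controls the sup norm. -/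
lemma exists_rho_bound (S : StrongSolution R γ μ lam κ q T ρ0 u0 θ0) (hq : 3 < q) (hq' : q ≠ ⊤) :
    ∃ B : ℝ≥0, ∀ t ∈ Icc 0 T, eLpNorm (S.ρ t) ⊤ volume ≤ B := by
  obtain ⟨C, hC⟩ := HeatNS.exists_sup_bound hq hq'
  obtain ⟨B1, hB1⟩ := S.cont_Dρ_two.exists_bound (by norm_num)
  have hq1 : 1 ≤ q := le_trans (by norm_num) hq.le
  obtain ⟨B2, hB2⟩ := S.cont_Dρ_q.exists_bound hq1
  refine ⟨C * (3 * (B1 + B2)), fun t ht => ?_⟩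
  have hb := hC (S.ρ t) (fun i x => S.Dρ t x i)
    (fun i => (S.grad_ρ t ht).isWeakPartial (ContinuousLinearMap.id ℝ ℝ) i)
    (.inl (S.cont_ρ_two.1 t ht)) (fun i => (entry i : Grad ℝ →L[ℝ] ℝ).comp_memLp' (S.cont_Dρ_two.1 t ht))
    (fun i => (entry i : Grad ℝ →L[ℝ] ℝ).comp_memLp' (S.cont_Dρ_q.1 t ht))
  refine hb.trans ?_
  push_cast
  gcongr
  refine (Finset.sum_le_sum fun i _ => add_le_add
    ((eLpNorm_clm_le (norm_entry_le i) (S.Dρ t) 2).trans (hB1 t ht))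
    ((eLpNorm_clm_le (norm_entry_le i) (S.Dρ t) q).trans (hB2 t ht))).trans (le_of_eq ?_)
  simp only [Finset.sum_const, Finset.card_univ, Fintype.card_fin, nsmul_eq_mul]
  norm_num

lemma norm_entry_entry_le (i j : Fin 3) (A : Grad E3) :
    ‖((EuclideanSpace.proj j : E3 →L[ℝ] ℝ).comp (entry i)) A‖ ≤ ‖A‖ :=
  (PiLp.norm_apply_le _ j).trans (norm_entry_le i A)

lemma memLp_top_of_le {f : E3 → ℝ} {B : ℝ≥0} (h1 : AEStronglyMeasurable f volume)
    (h2 : eLpNorm f ⊤ volume ≤ B) : MemLp f ⊤ volume := ⟨h1, h2.trans_lt ENNReal.coe_lt_top⟩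

lemma slice (S : StrongSolution R γ μ lam κ q T ρ0 u0 θ0) (hq : 3 < q) (hq' : q ≠ ⊤) {t : ℝ}
    (ht : t ∈ Icc 0 T) : Slice (S.ρ t) (fun i x => S.Dρ t x i) (fun j x => S.u t x j)
      (fun i j x => S.Du t x i j) where
  r_two := S.cont_ρ_two.1 t ht
  r_top := by
    obtain ⟨B, hB⟩ := S.exists_rho_bound hq hq'
    exact memLp_top_of_le (S.cont_ρ_two.1 t ht).1 (hB t ht)
  Dr_two i := (entry i : Grad ℝ →L[ℝ] ℝ).comp_memLp' (S.cont_Dρ_two.1 t ht)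
  r_partial i := (S.grad_ρ t ht).isWeakPartial (ContinuousLinearMap.id ℝ ℝ) i
  v_six j := (EuclideanSpace.proj j : E3 →L[ℝ] ℝ).comp_memLp' (S.reg_u.cont.1 t ht)
  v_top j := by
    obtain ⟨B, hB⟩ := S.reg_u.exists_sup_bound (L := (EuclideanSpace.proj j : E3 →L[ℝ] ℝ))
      fun y => PiLp.norm_apply_le y j
    exact memLp_top_of_le
      ((EuclideanSpace.proj j : E3 →L[ℝ] ℝ).comp_memLp' (S.reg_u.cont.1 t ht)).1 (hB t ht)
  Dv_two i j := ((EuclideanSpace.proj j : E3 →L[ℝ] ℝ).comp (entry i)).comp_memLp'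
    (S.reg_u.cont_D.1 t ht)
  v_partial i j := (S.reg_u.grad t ht).isWeakPartial (EuclideanSpace.proj j : E3 →L[ℝ] ℝ) i

/-- Any common bound serves as `M`. It gives integrability and domination only and does not appear
in the final estimate. -/
lemma exists_flow (S : StrongSolution R γ μ lam κ q T ρ0 u0 θ0) (hT : 0 < T) (hq : 3 < q)
    (hq' : q ≠ ⊤) : ∃ M : ℝ≥0, Flow T R μ lam S.ρ S.ρt S.θ (fun i t x => S.Dρ t x i)
      (fun i t x => S.Dθ t x i) (fun j t x => S.u t x j) (fun j t x => S.ut t x j)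
      (fun i j t x => S.Du t x i j) (fun k i j t x => S.D2u t x k i j) M := by
  have nu : ∀ j (y : E3), ‖(EuclideanSpace.proj j : E3 →L[ℝ] ℝ) y‖ ≤ ‖y‖ := fun j y =>
    PiLp.norm_apply_le y j
  have nid : ∀ y : ℝ, ‖(ContinuousLinearMap.id ℝ ℝ) y‖ ≤ ‖y‖ := fun y => le_rfl
  obtain ⟨M1, hM1⟩ := S.cont_ρ_two.exists_bound (by norm_num)
  obtain ⟨M2, hM2⟩ := S.exists_rho_bound hq hq'
  obtain ⟨M3, hM3⟩ := S.cont_ρt_two.exists_bound (by norm_num)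
  obtain ⟨M4, hM4⟩ := S.reg_u.cont.exists_bound (by norm_num)
  obtain ⟨M5, hM5⟩ := S.reg_u.cont_D.exists_bound (by norm_num)
  obtain ⟨M6, hM6⟩ := S.reg_θ.exists_sup_bound nid
  have hcont := S.continuity
  have hmom := S.momentum
  rw [spaceTime_eq] at hcont hmom
  obtain ⟨M, hM⟩ : ∃ M : ℝ≥0, M = M1 + M2 + M3 + M4 + M5 + M6 := ⟨_, rfl⟩
  refine ⟨M, ?_⟩
  have hle : M1 ≤ M ∧ M2 ≤ M ∧ M3 ≤ M ∧ M4 ≤ M ∧ M5 ≤ M ∧ M6 ≤ M := by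
    simp only [← NNReal.coe_le_coe, hM]
    push_cast
    refine ⟨?_, ?_, ?_, ?_, ?_, ?_⟩ <;>
      linarith [M1.2, M2.2, M3.2, M4.2, M5.2, M6.2]
  obtain ⟨l1, l2, l3, l4, l5, l6⟩ := hle
  have bu : ∀ t ∈ Icc 0 T, ∀ j, eLpNorm (fun x => S.u t x j) 6 volume ≤ M4 := fun t ht j =>
    (eLpNorm_clm_le (L := (EuclideanSpace.proj j : E3 →L[ℝ] ℝ)) (nu j) (S.u t) 6).trans (hM4 t ht)
  have bD : ∀ t ∈ Icc 0 T, ∀ i j, eLpNorm (fun x => S.Du t x i j) 2 volume ≤ M5 := fun t ht i j =>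
    (eLpNorm_clm_le (norm_entry_entry_le i j) (S.Du t) 2).trans (hM5 t ht)
  have mD : ∀ i j, JointMeas T (fun t x => S.Du t x i j) := fun i j =>
    S.reg_u.meas_D.clm ((EuclideanSpace.proj j : E3 →L[ℝ] ℝ).comp (entry i))
  refine ⟨hT, ?_, ?_, ?_, ?_, ?_, ?_, ?_, ?_, ?_, ?_, ?_, ?_, ?_, ?_, ?_, ?_, ?_, ?_, ?_, ?_, ?_, ?_⟩
  · exact fun t ht => S.slice hq hq' ht
  · exact S.ρ_nonneg
  · exact S.θ_nonneg
  · exact fun t ht => memLp_top_of_le (S.reg_θ.cont.1 t ht).1 (hM6 t ht)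
  · exact fun t ht j => (entry j : Grad ℝ →L[ℝ] ℝ).comp_memLp' (S.reg_θ.cont_D.1 t ht)
  · exact fun t ht j => (S.reg_θ.grad t ht).isWeakPartial (ContinuousLinearMap.id ℝ ℝ) j
  · exact fun t ht k i j => (((EuclideanSpace.proj j : E3 →L[ℝ] ℝ).comp (entry i)).comp
      (entry k)).comp_memLp' (S.reg_u.cont_D2.1 t ht)
  · exact fun t ht k i j => (S.reg_u.grad2 t ht).isWeakPartial
      ((EuclideanSpace.proj j : E3 →L[ℝ] ℝ).comp (entry i)) k
  · exact S.cont_ρt_two.1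
  · exact fun t ht => (hM1 t ht).trans (ENNReal.coe_le_coe.2 l1)
  · exact fun t ht => (hM2 t ht).trans (ENNReal.coe_le_coe.2 l2)
  · exact fun t ht => (hM3 t ht).trans (ENNReal.coe_le_coe.2 l3)
  · exact fun t ht j => (bu t ht j).trans (ENNReal.coe_le_coe.2 l4)
  · exact fun t ht i j => (bD t ht i j).trans (ENNReal.coe_le_coe.2 l5)
  · exact fun t ht => (hM6 t ht).trans (ENNReal.coe_le_coe.2 l6)
  · exact fun j => S.reg_u.sq_t.lintegral_clm (L := (EuclideanSpace.proj j : E3 →L[ℝ] ℝ)) (nu j)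
  · rw [← spaceTime_eq]; exact S.reg_θ.meas
  · intro i j
    rw [← spaceTime_eq]
    exact mD i j
  · exact timeAC_of_weak (p := 2) (p' := 2) (p₁ := 2) hT (by norm_num) (by norm_num) S.meas_ρ
      S.meas_ρt S.cont_ρ_two
      (lintegral_lt_top_of_le (C := M1) (by finiteness) fun t ht => hM1 t ⟨ht.1.le, ht.2.le⟩)
      (lintegral_lt_top_of_le (C := M3) (by finiteness) fun t ht => hM3 t ⟨ht.1.le, ht.2.le⟩)
      (S.timeDeriv_ρ.clm (ContinuousLinearMap.id ℝ ℝ))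
  · exact fun j => S.reg_u.timeAC (L := (EuclideanSpace.proj j : E3 →L[ℝ] ℝ)) hT (nu j)
  · filter_upwards [Measure.ae_ae_of_ae_prod hcont] with t ht
    filter_upwards [ht] with x hx
    simpa [advect, divg] using hx
  · filter_upwards [Measure.ae_ae_of_ae_prod hmom] with t ht
    filter_upwards [ht] with x hx j
    have := hx j
    simpa [advect, lapl, gradDiv] using this

end StrongSolution

end HeatNS

/-! ### The estimate and its constant -/

theorem proposition2p4 (R γ μ lam κ : ℝ) (hR : 0 < R) (hγ : 1 < γ) (hμ : 0 < μ)
    (hlam : 0 ≤ 2 * μ + 3 * lam) (hκ : 0 < κ) :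
    ∃ C : ℝ≥0, 0 < C ∧
      ∀ (q : ℝ≥0∞), 3 < q → q ≤ 6 → ∀ T : ℝ, 0 < T →
      ∀ (ρ0 : HeatNS.E3 → ℝ) (u0 : HeatNS.E3 → HeatNS.E3) (θ0 : HeatNS.E3 → ℝ)
        (S : HeatNS.StrongSolution R γ μ lam κ q T ρ0 u0 θ0),
        (⨆ t ∈ Icc 0 T, eLpNorm (S.ρ t) 3 volume ^ 3)
            + (∫⁻ t in Ioo 0 T, ∫⁻ x, ENNReal.ofReal (S.ρ t x ^ 3 * S.p t x))
          ≤ C * (⨆ t ∈ Icc 0 T,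
                eLpNorm (S.ρ t) ⊤ volume ^ (2 / 3 : ℝ)
                  * eLpNorm (fun x => Real.sqrt (S.ρ t x) • S.u t x) 2 volume ^ (1 / 3 : ℝ)
                  * eLpNorm (fun x => Real.sqrt (S.ρ t x) * ‖S.u t x‖ ^ 2) 2 volume ^ (1 / 3 : ℝ)
                  * eLpNorm (S.ρ t) 3 volume ^ 3)
            + C * (∫⁻ t in Ioo 0 T,
                eLpNorm (S.ρ t) ⊤ volume ^ 2 * eLpNorm (S.ρ t) 3 volume ^ 2
                  * eLpNorm (S.Du t) 2 volume ^ 2)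
            + C * eLpNorm ρ0 3 volume ^ 3 := by
  -- From 2μ + 3λ ≥ 0 one gets 2μ + λ ≥ 4μ/3 > 0.
  have hν : 0 < 2 * μ + lam := by linarith
  have hc := HeatNS.etaMass_pos
  obtain ⟨C1, hC1⟩ := HeatNS.exists_pairing_bound
  set n : ℝ≥0 := Real.toNNReal ((2 * μ + lam) / 2) with hn
  set m : ℝ≥0 := Real.toNNReal (HeatNS.etaMass⁻¹ * (2 / (2 * μ + lam)) + HeatNS.etaMass⁻¹) with hm
  -- The factor 81 = 9² comes from bounding the sum of the nine entries of ∇u by 9‖∇u‖₂ and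
  -- squaring.
  set K2 : ℝ≥0 := 36 * HeatNS.sobConst ^ 2 * Real.toNNReal HeatNS.etaMass * 81 with hK2
  -- The three summands are the coefficients of the initial datum, the supremum and the dissipation
  -- integral, so the sum dominates each. Within the second, 3 counts the components of the momentum
  -- and 2 the two endpoints in time. All ingredients are fixed before q, T and the solution.
  refine ⟨(1 + n) + m * (2 * (3 * C1)) + m * K2, by positivity, ?_⟩
  intro q hq hq6 T hT ρ0 u0 θ0 S
  have hqt : q ≠ ⊤ := (hq6.trans_lt (by simp)).ne
  obtain ⟨M, h⟩ := S.exists_flow hT hq hqt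
  set W : ℝ≥0∞ := ⨆ t ∈ Icc 0 T, eLpNorm (S.ρ t) ⊤ volume ^ (2 / 3 : ℝ)
    * eLpNorm (fun x => Real.sqrt (S.ρ t x) • S.u t x) 2 volume ^ (1 / 3 : ℝ)
    * eLpNorm (fun x => Real.sqrt (S.ρ t x) * ‖S.u t x‖ ^ 2) 2 volume ^ (1 / 3 : ℝ)
    * eLpNorm (S.ρ t) 3 volume ^ 3 with hW
  set I : ℝ≥0∞ := ∫⁻ t in Ioo 0 T, eLpNorm (S.ρ t) ⊤ volume ^ 2 * eLpNorm (S.ρ t) 3 volume ^ 2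
    * eLpNorm (S.Du t) 2 volume ^ 2 with hI
  have hpair : ∀ ε, 0 < ε → ε ≤ 1 → ∀ t ∈ Icc 0 T,
      ‖HeatNS.Flow.pair S.ρ (fun j t x => S.u t x j) ε t‖ₑ ≤ 3 * C1 * W := by
    intro ε hε h1 t ht
    have Sl := h.slice t ht
    have hj : ∀ j, ‖∫ x, S.ρ t x * S.u t x j
        * HeatNS.cv (HeatNS.ker1 ε j) (fun y => S.ρ t y ^ 3) x‖ₑ ≤ C1 * W := by
      intro j
      refine (hC1 (S.ρ t) (S.u t) Sl.r_two Sl.r_top (S.ρ_nonneg t ht) Sl.v_top ε hε h1 j).trans ?_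
      gcongr
      exact le_iSup₂ (f := fun t (_ : t ∈ Icc 0 T) => eLpNorm (S.ρ t) ⊤ volume ^ (2 / 3 : ℝ)
        * eLpNorm (fun x => Real.sqrt (S.ρ t x) • S.u t x) 2 volume ^ (1 / 3 : ℝ)
        * eLpNorm (fun x => Real.sqrt (S.ρ t x) * ‖S.u t x‖ ^ 2) 2 volume ^ (1 / 3 : ℝ)
        * eLpNorm (S.ρ t) 3 volume ^ 3) t ht
    refine (enorm_sum_le _ _).trans ((Finset.sum_le_sum fun j _ => hj j).trans (le_of_eq ?_))
    simp only [Finset.sum_const, Finset.card_univ, Fintype.card_fin, nsmul_eq_mul]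
    push_cast
    ring
  have hdef : ∀ ε, 0 < ε → ε ≤ 1 → ∀ t ∈ Icc 0 T,
      ‖HeatNS.Slice.defect (S.ρ t) (fun j x => S.u t x j) (fun i j x => S.Du t x i j) ε‖ₑ
        ≤ K2 * (eLpNorm (S.ρ t) ⊤ volume ^ 2 * eLpNorm (S.ρ t) 3 volume ^ 2
          * eLpNorm (S.Du t) 2 volume ^ 2) := by
    intro ε hε h1 t ht
    have Sl := h.slice t ht
    refine (Sl.enorm_defect_le hε h1).trans ?_
    have hV : ∑ i, ∑ j, eLpNorm (fun x => S.Du t x i j) 2 volume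
        ≤ 9 * eLpNorm (S.Du t) 2 volume := by
      refine (Finset.sum_le_sum fun i _ => Finset.sum_le_sum fun j _ =>
        HeatNS.eLpNorm_clm_le (HeatNS.StrongSolution.norm_entry_entry_le i j) (S.Du t) 2).trans
        (le_of_eq ?_)
      simp only [Finset.sum_const, Finset.card_univ, Fintype.card_fin, nsmul_eq_mul]
      push_cast
      ring
    calc _ ≤ 36 * (HeatNS.sobConst : ℝ≥0∞) ^ 2 * ENNReal.ofReal HeatNS.etaMass
          * (eLpNorm (S.ρ t) ⊤ volume ^ 2 * eLpNorm (S.ρ t) 3 volume ^ 2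
            * (9 * eLpNorm (S.Du t) 2 volume) ^ 2) := by gcongr
      _ = _ := by
          rw [hK2, ENNReal.ofReal]
          push_cast
          ring
  have key := h.density_pressure_le hR.le hν hpair hdef
  have e0 : eLpNorm (S.ρ 0) 3 volume = eLpNorm ρ0 3 volume := eLpNorm_congr_ae S.ρ_init
  have en : ENNReal.ofReal ((2 * μ + lam) / 2) = n := rfl
  have em : ENNReal.ofReal (HeatNS.etaMass⁻¹ * (2 / (2 * μ + lam)) + HeatNS.etaMass⁻¹) = m := rfl
  rw [e0, en, em, lintegral_const_mul' _ _ (by simp), ← hI] at key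
  simp only [HeatNS.StrongSolution.p]
  refine key.trans ?_
  set Y := eLpNorm ρ0 3 volume ^ 3
  have f1 : (1 + n : ℝ≥0∞) ≤ ((1 + n) + m * (2 * (3 * C1)) + m * K2 : ℝ≥0) := by
    push_cast; rw [add_assoc]; exact le_self_add
  have f2 : (m * (2 * (3 * C1)) : ℝ≥0∞) ≤ ((1 + n) + m * (2 * (3 * C1)) + m * K2 : ℝ≥0) := by
    push_cast; exact le_add_self.trans le_self_add
  have f3 : (m * K2 : ℝ≥0∞) ≤ ((1 + n) + m * (2 * (3 * C1)) + m * K2 : ℝ≥0) := by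
    push_cast; exact le_add_self
  calc (1 + (n : ℝ≥0∞)) * Y + m * (2 * (3 * C1 * W) + K2 * I)
      = (m * (2 * (3 * C1)) : ℝ≥0∞) * W + (m * K2 : ℝ≥0∞) * I + (1 + n) * Y := by ring
    _ ≤ _ := by gcongr
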